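/- **Conventions.** A space group is a discrete cocompact group $G$ of isometries of Euclidean 3-space. Two space groups are regarded as the same if they are conjugate by an affine map. The point group of $G$ is the group of linear parts of its elements; it is ${*}222$ if it consists of all sign changes of three orthogonal axes, and $222$ if it consists of the rotations among these. A fibration of $G$ is a system of parallel lines invariant under $G$, i.e. a direction that $G$ preserves up to sign (an axis); two fibered groups are regarded as the same if an affine map carries one to the other. $G$ is irreducible if it has no invariant direction. An axis of $G$ is symmetric if some affine map normalizing $G$ fixes this axis and interchanges two other axes. $G$ has a single asymmetric name if all its fibrations are the same (as fibered groups) and none of its axes is symmetric. **Names.** Let the invariant direction be that of the $z$-axis, so that each $g\in G$ acts as $(x,y,z)\mapsto(h(x,y),v(z))$, where $v$ is $c{+}\colon z\mapsto c+z$ or $c{-}\colon z\mapsto c-z$; we say that $h$ is coupled to $v$ (plus-coupled, respectively minus-coupled). The $h$ form a plane group $H$. Scale $z$, and choose its origin, so that the vertical maps coupled to the identity of $H$ are all $n{+}$ ($n\in\mathbb Z$; circular fibration, round brackets) or all $n{+}$ and $n{-}$ (interval fibration, square brackets). The plane groups needed, with standard generators, are - ${*}2222$, names ${*}P2_aQ2_bR2_cS2_d$: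 reflections $P,Q,R,S$ in the consecutive sides of a rectangle; - $2{*}22$, names $2_g{*}P2_aQ2_b$: a half turn $\gamma$ and reflections $P,Q$ with $1=\gamma^2=P^2=(PQ)^2=Q^2=(Q\gamma P\gamma^{-1})^2$; put $\lambda=\gamma^{-1}$; - $22{*}$, names $2_g2_d{*}P$: half turns $\gamma,\delta$ and a reflection $P$ with $1=\gamma^2=\delta^2=P^2=[P,\gamma\delta]$; put $\lambda=(\gamma\delta)^{-1}$; - $22\times$, names $2_g2_d\times$: half turns $\gamma,\delta$ and a glide reflection $Z$ with $1=\gamma^2=\delta^2=\gamma\delta Z^2$. In place of each letter $P,Q,R,S$ stands a mark: a blank, $\cdot$ or $:$ means that this reflection is minus-coupled, coupled to $0{+}$, or coupled to $\frac12{+}$ (in an interval fibration everything is plus-coupled as well as minus-coupled, and the notation refers to the plus-couplings). A gyration digit (subscript $g$ or $d$; half turn $\gamma$ or $\delta$) is written $2$ if the half turn is minus-coupled, and $2_i$ if it is coupled to $\frac i2{+}$. A corner digit between the marks of reflections $A$ and $B$ (cyclically; for $2{*}22$ the last digit is between $Q$ and $\gamma P\gamma^{-1}$) is $2_i$ if $AB$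 is coupled to $\frac i2{+}$, and $2$ if $AB$ is minus-coupled; the subscript is also omitted if $A$ and $B$ are both plus-coupled. The star is ${*}$ or $\bar{*}$ as $\lambda$ is plus- or minus-coupled ($\lambda=1$ for ${*}2222$). A subscript, $\bar{*}_i$, says that $P$ and $\lambda$ are coupled to $p{-}$ and $l{-}$ with $p-l\equiv\frac{\Sigma+i}2\pmod 1$, where $\Sigma$ is the sum of $\frac a2$ over the corner digits $2_a$. The cross is $\times$ or $\bar\times$ as $Z$ is plus- or minus-coupled, and $\times_i$ says that $Z$ is coupled to $\frac{-k+i}2{+}$, where $k=\frac{g+d}2$. Subscripts on stars and crosses are omitted where they are determined or immaterial. A fibered group has a given name if in suitable affine coordinates it is of the form the name describes. **Table.** Lines are separated by semicolons; the first name on a line is the primary name. Point group ${*}222$: $[{*}{\cdot}2{\cdot}2{\cdot}2{\cdot}2]$; $[{*}{\cdot}2{\cdot}2:2:2]$; $[{*}:2:2:2:2]$, $({*}2_0 2_0 2{\cdot}2)$; $({*}2_0 2{\cdot}2{\cdot}2)$, $[{*}{\cdot}2:2:2:2]$; $({*}2_0 2:2:2)$, $({*}2_0 2_1 2:2)$;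 $({*}2_1 2{\cdot}2{\cdot}2)$, $[2_0 {*}{\cdot}2:2]$; $({*}2_1 2:2:2)$; $[2_0 {*}{\cdot}2{\cdot}2]$, $[{*}{\cdot}2{\cdot}2{\cdot}2:2]$; $[2_0 {*}:2:2]$, $({*}2_0 2_1 2{\cdot}2)$; $[2_1 {*}{\cdot}2{\cdot}2]$; $[2_1 {*}:2:2]$, $({*}2_0 2{\cdot}2:2)$; $(2 \bar{*}{\cdot}2{\cdot}2)$, $[2_1 2_1 {*}{\cdot}]$; $(2 \bar{*}:2:2)$, $(2_1 2 \bar{*}_0)$; $(2 \bar{*}_0 2_0 2_0)$, $({*}2_0 2_0 2:2)$; $(2 \bar{*}_1 2_0 2_0)$; $(2 \bar{*} 2_0 2_1)$; $[2_0 2_0 \times_0]$, $({*}2{\cdot}2:2{\cdot}2)$; $[2_0 2_0 \times_1]$, $(2_1 {*}2{\cdot}2)$; $[2_0 2_0 {*}{\cdot}]$, $[{*}{\cdot}2:2{\cdot}2:2]$, $({*}2{\cdot}2{\cdot}2{\cdot}2)$; $[2_0 2_0 {*}:]$, $({*}2_1 2_1 2{\cdot}2)$, $(2_0 {*}2{\cdot}2)$;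 $[2_0 2_1 {*}{\cdot}]$, $({*}2{\cdot}2{\cdot}2:2)$, $[2_1 {*}{\cdot}2:2]$; $[2_0 2_1 {*}:]$, $({*}2{\cdot}2:2:2)$, $({*}2_1 2{\cdot}2:2)$; $(2_0 2 \bar{*}{\cdot})$, $({*}2:2{\cdot}2:2)$, $[2_1 2_1 {*}:]$; $(2_0 2 \bar{*}:)$, $(2_1 {*}2:2)$, $(2_1 2 \bar{*}_1)$; $(2_1 2 \bar{*}{\cdot})$, $(2 \bar{*}{\cdot}2:2)$, $[2_1 2_1 \times]$; $(2_1 2 \bar{*}:)$; $(2_0 2 \bar{*}_0)$, $({*}2:2:2:2)$, $({*}2_1 2_1 2:2)$; $(2_0 2 \bar{*}_1)$, $(2_0 {*}2:2)$, $(2 \bar{*} 2_1 2_1)$. Point group $222$: $({*}2_0 2_0 2_0 2_0)$; $({*}2_0 2_1 2_0 2_1)$; $({*}2_1 2_1 2_1 2_1)$, $(2_0 2_0 {*})$; $(2_0 {*}2_0 2_0)$, $({*}2_0 2_0 2_1 2_1)$; $(2_1 {*}2_0 2_0)$; $(2_0 {*}2_1 2_1)$; $(2_1 {*}2_1 2_1)$,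 $(2_0 2_1 {*})$; $(2_0 2_0 \bar{\times})$, $(2_1 2_1 {*})$; $(2_1 2_1 \bar{\times})$. **Theorem.** 1. For each line of the table there is a space group $G$ with the point group of that line such that, for each name on the line, a space group $G'$ has a fibration with this name if and only if $G'$ is the same space group as $G$. Each fibration of $G$ has one of the names on the line, and no other name in the table. (So two names in the table are aliases, i.e. names of fibrations of one space group, precisely if they are on the same line.) If the line has three names, no axis of $G$ is symmetric; if it has two, the axis with the primary name is symmetric and the others are not; if it has one, all axes of $G$ are symmetric, except for the line $(2_1 2 \bar{*}:)$, where none is. 2. A space group with point group $222$ or ${*}222$ has a single asymmetric name if and only if it has a fibration with the name $(2_1 2 \bar{*}:)$. 3. If a space group $G$ with point group $222$ or ${*}222$ has a single asymmetric name, then after a suitable rescaling along its axes (and possibly a translation) $G$ is a space group normalized by an isometry $c$ that permutes the three axes cyclically, such that $G$ and $c$ generate an irreducible space group in which $G$ has index $3$. -/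

import Mathlib

namespace Fibrifold

noncomputable section

/-! ### Space groups, point groups, fibrations -/

/-- Euclidean 3-space. -/
abbrev E3 := EuclideanSpace ℝ (Fin 3)

/-- A space group: a group of isometries of Euclidean 3-space which is discrete (a compact set
contains only finitely many images of a point) and cocompact (the images of some compact set
cover the space). -/
structure IsSpaceGroup (G : Subgroup (E3 ≃ᵃ[ℝ] E3)) : Prop where
  isometry : ∀ g ∈ G, Isometry g
  discrete : ∀ C : Set E3, IsCompact C → ∀ x : E3, {y | y ∈ C ∧ ∃ g ∈ G, g x = y}.Finite
  cocompact : ∃ C : Set E3, IsCompact C ∧ ∀ x : E3, ∃ g ∈ G, ∃ y ∈ C, g y = x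

/-- The point group: the group of linear parts. -/
def pointGroup (G : Subgroup (E3 ≃ᵃ[ℝ] E3)) : Subgroup (E3 ≃ₗ[ℝ] E3) :=
  G.map AffineEquiv.linearHom

/-- The two point groups considered, in orbifold notation `222` and `*222`. -/
inductive PointGroupType
  | p222
  | star222

/-- `star222` is the group of all sign changes of three orthogonal axes, and `p222` is its
subgroup of rotations. -/
def HasPointGroup (G : Subgroup (E3 ≃ᵃ[ℝ] E3)) : PointGroupType → Prop
  | .star222 => ∃ b : OrthonormalBasis (Fin 3) ℝ E3, ∀ A : E3 ≃ₗ[ℝ] E3,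
      A ∈ pointGroup G ↔ ∃ s : Fin 3 → ℤˣ, ∀ i, A (b i) = ((s i : ℤ) : ℝ) • b i
  | .p222 => ∃ b : OrthonormalBasis (Fin 3) ℝ E3, ∀ A : E3 ≃ₗ[ℝ] E3,
      A ∈ pointGroup G ↔
        ∃ s : Fin 3 → ℤˣ, s 0 * s 1 * s 2 = 1 ∧ ∀ i, A (b i) = ((s i : ℤ) : ℝ) • b i

/-- The conjugate `φ G φ⁻¹`. -/
def conj (φ : E3 ≃ᵃ[ℝ] E3) (G : Subgroup (E3 ≃ᵃ[ℝ] E3)) : Subgroup (E3 ≃ᵃ[ℝ] E3) :=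
  G.map (MulAut.conj φ).toMonoidHom

/-- The image of a direction under an affine map. -/
def mapDir (φ : E3 ≃ᵃ[ℝ] E3) (ℓ : Submodule ℝ E3) : Submodule ℝ E3 :=
  ℓ.map (φ.linear : E3 →ₗ[ℝ] E3)

/-- A fibration of `G`, i.e. a system of parallel lines invariant under `G`. It is given by its
direction, a one-dimensional subspace invariant under all linear parts. -/
def IsFibration (G : Subgroup (E3 ≃ᵃ[ℝ] E3)) (ℓ : Submodule ℝ E3) : Prop :=
  Module.finrank ℝ ℓ = 1 ∧ ∀ g ∈ G, mapDir g ℓ = ℓ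

/-- A group is irreducible if it has no invariant direction. -/
def IsIrreducibleGroup (G : Subgroup (E3 ≃ᵃ[ℝ] E3)) : Prop := ∀ ℓ, ¬ IsFibration G ℓ

/-- Two groups are the same space group if they are affinely conjugate. -/
def SameSpaceGroup (G G' : Subgroup (E3 ≃ᵃ[ℝ] E3)) : Prop := ∃ φ, conj φ G = G'

/-- Two fibered groups are the same if an affine map carries one to the other. -/
def SameFibered (G : Subgroup (E3 ≃ᵃ[ℝ] E3)) (ℓ : Submodule ℝ E3)
    (G' : Subgroup (E3 ≃ᵃ[ℝ] E3)) (ℓ' : Submodule ℝ E3) : Prop :=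
  ∃ φ, conj φ G = G' ∧ mapDir φ ℓ = ℓ'

/-- An axis is symmetric if some affine symmetry of the group fixes it and interchanges two
other axes. -/
def IsSymmetricAxis (G : Subgroup (E3 ≃ᵃ[ℝ] E3)) (ℓ : Submodule ℝ E3) : Prop :=
  ∃ φ, conj φ G = G ∧ mapDir φ ℓ = ℓ ∧
    ∃ ℓ₁ ℓ₂, IsFibration G ℓ₁ ∧ IsFibration G ℓ₂ ∧ ℓ₁ ≠ ℓ₂ ∧ ℓ₁ ≠ ℓ ∧ ℓ₂ ≠ ℓ ∧
      mapDir φ ℓ₁ = ℓ₂ ∧ mapDir φ ℓ₂ = ℓ₁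

/-- All fibrations of the group are the same (they have one and the same name), and no axis is
symmetric. -/
def HasSingleAsymmetricName (G : Subgroup (E3 ≃ᵃ[ℝ] E3)) : Prop :=
  (∀ ℓ ℓ', IsFibration G ℓ → IsFibration G ℓ' → SameFibered G ℓ G ℓ') ∧
    ∀ ℓ, IsFibration G ℓ → ¬ IsSymmetricAxis G ℓ

/-- `c` permutes three different axes of `G` cyclically. -/
def PermutesAxesCyclically (G : Subgroup (E3 ≃ᵃ[ℝ] E3)) (c : E3 ≃ᵃ[ℝ] E3) : Prop :=
  ∃ ℓ₁ ℓ₂ ℓ₃, IsFibration G ℓ₁ ∧ IsFibration G ℓ₂ ∧ IsFibration G ℓ₃ ∧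
    ℓ₁ ≠ ℓ₂ ∧ ℓ₂ ≠ ℓ₃ ∧ ℓ₁ ≠ ℓ₃ ∧
      mapDir c ℓ₁ = ℓ₂ ∧ mapDir c ℓ₂ = ℓ₃ ∧ mapDir c ℓ₃ = ℓ₁

/-! ### Fibrifold names -/

/-- Circular fibrations, written with round brackets, and interval fibrations, written with
square brackets. -/
inductive FiberKind
  | circle
  | interval

/-- The mark for a mirror generator: a blank, one dot `·` or two dots `:`. -/
inductive Mark
  | blank
  | dot
  | colon

/-- The embellishments of a star: `*`, or `*` with a bar and possibly a subscript. -/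
inductive Star
  | plain
  | bar (i : Option (Fin 2))

/-- The embellishments of a cross: `×`, possibly with a subscript, or `×` with a bar. -/
inductive Cross
  | plain (i : Option (Fin 2))
  | bar

/-- Fibrifold names over the plane groups `*2222`, `2*22`, `22*` and `22×`, with the entries in
the order in which they are printed. A digit `2`, `2_0`, `2_1` is given by its subscript: `none`,
`some 0`, `some 1`. -/
inductive Name
  /-- `* P 2_a Q 2_b R 2_c S 2_d` with marks `P, Q, R, S` -/
  | star2222 (f : FiberKind) (P : Mark) (a : Option (Fin 2)) (Q : Mark) (b : Option (Fin 2))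
      (R : Mark) (c : Option (Fin 2)) (S : Mark) (d : Option (Fin 2))
  /-- `2_g * P 2_a Q 2_b` with marks `P, Q` -/
  | two_star22 (f : FiberKind) (g : Option (Fin 2)) (s : Star) (P : Mark) (a : Option (Fin 2))
      (Q : Mark) (b : Option (Fin 2))
  /-- `2_g 2_d * P` with mark `P` -/
  | two_two_star (f : FiberKind) (g d : Option (Fin 2)) (s : Star) (P : Mark)
  /-- `2_g 2_d ×` -/
  | two_two_cross (f : FiberKind) (g d : Option (Fin 2)) (x : Cross)

/-- The vertical operation `c+ : z ↦ c + z`. -/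
def plus (c : ℝ) : Equiv.Perm ℝ := Equiv.addLeft c

/-- The vertical operation `c- : z ↦ c - z`. -/
def minus (c : ℝ) : Equiv.Perm ℝ := Equiv.subLeft c

/-- The horizontal operation `(x, y) ↦ (t + s x, u + r y)` with signs `s, r`. -/
def horiz (s : ℤˣ) (t : ℝ) (r : ℤˣ) (u : ℝ) : Equiv.Perm (ℝ × ℝ) :=
  Equiv.prodCongr ((Units.mulLeft (s.map (Int.castRingHom ℝ).toMonoidHom)).trans (Equiv.addLeft t))
    ((Units.mulLeft (r.map (Int.castRingHom ℝ).toMonoidHom)).trans (Equiv.addLeft u))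

theorem horiz_apply (s : ℤˣ) (t : ℝ) (r : ℤˣ) (u : ℝ) (p : ℝ × ℝ) :
    horiz s t r u p = (t + ((s : ℤ) : ℝ) * p.1, u + ((r : ℤ) : ℝ) * p.2) := rfl

/-! Standard generators of the four plane groups (unique up to affine maps).

* `*2222`: `P, Q, R, S` are the reflections in the consecutive sides of a rectangle, with
  `1 = P² = (PQ)² = Q² = (QR)² = R² = (RS)² = S² = (SP)²`.
* `2*22`: `P, Q` are reflections in perpendicular lines, `γ` is a half turn about a point on
  neither mirror, with `1 = γ² = P² = (PQ)² = Q² = (Q γ P γ⁻¹)²`.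
* `22*`: `γ, δ` are half turns and `P` a reflection, with `1 = γ² = δ² = P² = [P, γδ]`.
* `22×`: `γ, δ` are half turns and `Z` is a glide reflection, with `1 = γ² = δ² = γ δ Z²`. -/

def s2222P : Equiv.Perm (ℝ × ℝ) := horiz (-1) 0 1 0
def s2222Q : Equiv.Perm (ℝ × ℝ) := horiz 1 0 (-1) 0
def s2222R : Equiv.Perm (ℝ × ℝ) := horiz (-1) 1 1 0
def s2222S : Equiv.Perm (ℝ × ℝ) := horiz 1 0 (-1) 1

def s22P : Equiv.Perm (ℝ × ℝ) := horiz (-1) 0 1 0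
def s22Q : Equiv.Perm (ℝ × ℝ) := horiz 1 0 (-1) 0
def s22γ : Equiv.Perm (ℝ × ℝ) := horiz (-1) (1 / 2) (-1) (1 / 2)

def sγ : Equiv.Perm (ℝ × ℝ) := horiz (-1) 0 (-1) (1 / 2)
def sδ : Equiv.Perm (ℝ × ℝ) := horiz (-1) 1 (-1) (1 / 2)
def sP : Equiv.Perm (ℝ × ℝ) := horiz 1 0 (-1) 0

def xγ : Equiv.Perm (ℝ × ℝ) := horiz (-1) 0 (-1) 0
def xδ : Equiv.Perm (ℝ × ℝ) := horiz (-1) 1 (-1) 0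
def xZ : Equiv.Perm (ℝ × ℝ) := horiz 1 (1 / 2) (-1) (1 / 2)

/-- The plane group underlying a name. -/
def Name.planeGroup : Name → Subgroup (Equiv.Perm (ℝ × ℝ))
  | .star2222 .. => Subgroup.closure {s2222P, s2222Q, s2222R, s2222S}
  | .two_star22 .. => Subgroup.closure {s22γ, s22P, s22Q}
  | .two_two_star .. => Subgroup.closure {sγ, sδ, sP}
  | .two_two_cross .. => Subgroup.closure {xγ, xδ, xZ}

def Name.fiber : Name → FiberKind
  | .star2222 f .. => f
  | .two_star22 f .. => f
  | .two_two_star f .. => f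
  | .two_two_cross f .. => f

/-- The kernel of a fibration, scaled to have period 1: all `n+`, or all `n+` and `n-`. -/
def FiberKind.kernel : FiberKind → Set (Equiv.Perm ℝ)
  | .circle => {v | ∃ n : ℤ, v = plus n}
  | .interval => {v | ∃ n : ℤ, v = plus n ∨ v = minus n}

/-- `g` has horizontal part `h` and vertical part `v`. -/
def HasParts (g : E3 ≃ᵃ[ℝ] E3) (h : Equiv.Perm (ℝ × ℝ)) (v : Equiv.Perm ℝ) : Prop :=
  ∀ x y z : ℝ, g !₂[x, y, z] = !₂[(h (x, y)).1, (h (x, y)).2, v z]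

/-- In `G`, the horizontal operation `h` is coupled with the vertical operation `v`. -/
def Couples (G : Subgroup (E3 ≃ᵃ[ℝ] E3)) (h : Equiv.Perm (ℝ × ℝ)) (v : Equiv.Perm ℝ) : Prop :=
  ∃ g ∈ G, HasParts g h v

def PlusCoupled (G : Subgroup (E3 ≃ᵃ[ℝ] E3)) (h : Equiv.Perm (ℝ × ℝ)) : Prop :=
  ∃ c, Couples G h (plus c)

def MinusCoupled (G : Subgroup (E3 ≃ᵃ[ℝ] E3)) (h : Equiv.Perm (ℝ × ℝ)) : Prop :=
  ∃ c, Couples G h (minus c)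

/-- The number `a / 2` belonging to a digit `2_a`; it is only used for digits with a subscript,
and is `0` otherwise. -/
def half (a : Option (Fin 2)) : ℝ := a.elim 0 fun i => (i.val : ℝ) / 2

/-- The meaning of the mark of a reflection `P`. -/
def Mark.Holds (G : Subgroup (E3 ≃ᵃ[ℝ] E3)) (P : Equiv.Perm (ℝ × ℝ)) : Mark → Prop
  | .blank => MinusCoupled G P
  | .dot => Couples G P (plus 0)
  | .colon => Couples G P (plus (1 / 2))

/-- The meaning of a gyration digit `2` or `2_g` for a half turn `γ`. -/
def GyrationHolds (G : Subgroup (E3 ≃ᵃ[ℝ] E3)) (γ : Equiv.Perm (ℝ × ℝ)) :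
    Option (Fin 2) → Prop
  | none => MinusCoupled G γ
  | some g => Couples G γ (plus (half (some g)))

/-- The meaning of a corner digit `2` or `2_a` between reflections `P` and `Q`. The subscript is
also omitted when `P` and `Q` are both plus-coupled, because their marks then determine it. -/
def CornerHolds (G : Subgroup (E3 ≃ᵃ[ℝ] E3)) (P Q : Equiv.Perm (ℝ × ℝ)) :
    Option (Fin 2) → Prop
  | none => MinusCoupled G (P * Q) ∨ (PlusCoupled G P ∧ PlusCoupled G Q)
  | some a => Couples G (P * Q) (plus (half (some a)))

/-- The meaning of a star whose mirrors start with `P`, where `l` is the generator belonging to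
the star and `t` is the sum of the numbers `a / 2` over the corner digits `2_a`. A subscript `i`
on a star with a bar says that `P` and `l` are coupled to `p-` and `q-` with
`p - q = (t + i) / 2` modulo 1. -/
def Star.Holds (G : Subgroup (E3 ≃ᵃ[ℝ] E3)) (l P : Equiv.Perm (ℝ × ℝ)) (t : ℝ) : Star → Prop
  | .plain => PlusCoupled G l
  | .bar none => MinusCoupled G l
  | .bar (some i) => ∃ p q : ℝ, Couples G P (minus p) ∧ Couples G l (minus q) ∧
      p - q = (t + (i.val : ℝ)) / 2

/-- The meaning of a cross with generator `Z`, where the product of the other generators is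
coupled to `k+`. A subscript `i` says that `Z` is coupled to `((-k + i) / 2)+`. -/
def Cross.Holds (G : Subgroup (E3 ≃ᵃ[ℝ] E3)) (Z : Equiv.Perm (ℝ × ℝ)) (k : ℝ) : Cross → Prop
  | .plain none => PlusCoupled G Z
  | .plain (some i) => Couples G Z (plus ((-k + (i.val : ℝ)) / 2))
  | .bar => MinusCoupled G Z

/-- The couplings in `G` of the standard generators are as the name says. By the relation between
the generators, the star generator is `γ⁻¹` for `2*22` and `(γδ)⁻¹` for `22*`. -/
def Name.CouplingsHold (G : Subgroup (E3 ≃ᵃ[ℝ] E3)) : Name → Prop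
  | .star2222 _ P a Q b R c S d =>
      P.Holds G s2222P ∧ Q.Holds G s2222Q ∧ R.Holds G s2222R ∧ S.Holds G s2222S ∧
      CornerHolds G s2222P s2222Q a ∧ CornerHolds G s2222Q s2222R b ∧
      CornerHolds G s2222R s2222S c ∧ CornerHolds G s2222S s2222P d
  | .two_star22 _ g s P a Q b =>
      GyrationHolds G s22γ g ∧ s.Holds G s22γ⁻¹ s22P (half a + half b) ∧
      P.Holds G s22P ∧ Q.Holds G s22Q ∧
      CornerHolds G s22P s22Q a ∧ CornerHolds G s22Q (s22γ * s22P * s22γ⁻¹) b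
  | .two_two_star _ g d s P =>
      GyrationHolds G sγ g ∧ GyrationHolds G sδ d ∧ s.Holds G (sγ * sδ)⁻¹ sP 0 ∧ P.Holds G sP
  | .two_two_cross _ g d x =>
      GyrationHolds G xγ g ∧ GyrationHolds G xδ d ∧ x.Holds G xZ (half g + half d)

/-- `G`, fibered by the vertical lines, is a fibration over the standard plane group of the name
`N`, of the kind and with the couplings that `N` prescribes. -/
structure IsModel (G : Subgroup (E3 ≃ᵃ[ℝ] E3)) (N : Name) : Prop where
  parts : ∀ g ∈ G, ∃ h ∈ N.planeGroup, ∃ c, HasParts g h (plus c) ∨ HasParts g h (minus c)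
  onto : ∀ h ∈ N.planeGroup, ∃ v, Couples G h v
  kernel : ∀ v, Couples G 1 v ↔ v ∈ N.fiber.kernel
  couplings : N.CouplingsHold G

/-- The fibered group `(G, ℓ)` has the name `N`: in suitable affine coordinates, with `ℓ` as the
direction of the `z`-axis, it is a fibration as described by `N`. -/
def HasName (G : Subgroup (E3 ≃ᵃ[ℝ] E3)) (ℓ : Submodule ℝ E3) (N : Name) : Prop :=
  IsFibration G ℓ ∧ ∃ φ : E3 ≃ᵃ[ℝ] E3,
    mapDir φ ℓ = Submodule.span ℝ {!₂[(0 : ℝ), 0, 1]} ∧ IsModel (conj φ G) N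

/-! ### The table -/

/-- A line of the table: point group, primary name, secondary names. -/
structure Line where
  pointGroup : PointGroupType
  primary : Name
  secondary : List Name

def Line.names (L : Line) : List Name := L.primary :: L.secondary

/-- The name `(2_1 2 *̄ :)`. -/
def namePbca : Name := .two_two_star .circle (some 1) none (.bar none) .colon

open PointGroupType FiberKind Mark Name

/-- Point group `*222`. Each line is preceded by the number and symbol of the group in the
International Tables; `*̄` stands for a star with a bar. -/
def tableStar222 : List Line := [
  -- 47 Pmmm: [*·2·2·2·2]
  ⟨star222, star2222 interval dot none dot none dot none dot none, []⟩,
  -- 69 Fmmm: [*·2·2:2:2]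
  ⟨star222, star2222 interval dot none dot none colon none colon none, []⟩,
  -- 49 Pccm: [*:2:2:2:2], (*2_0 2_0 2·2)
  ⟨star222, star2222 interval colon none colon none colon none colon none,
    [star2222 circle blank (some 0) blank (some 0) blank none dot none]⟩,
  -- 67 Cmma: (*2_0 2·2·2), [*·2:2:2:2]
  ⟨star222, star2222 circle blank (some 0) blank none dot none dot none,
    [star2222 interval dot none colon none colon none colon none]⟩,
  -- 68 Ccca: (*2_0 2:2:2), (*2_0 2_1 2:2)
  ⟨star222, star2222 circle blank (some 0) blank none colon none colon none,
    [star2222 circle blank (some 0) blank (some 1) blank none colon none]⟩,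
  -- 74 Imma: (*2_1 2·2·2), [2_0 *·2:2]
  ⟨star222, star2222 circle blank (some 1) blank none dot none dot none,
    [two_star22 interval (some 0) .plain dot none colon none]⟩,
  -- 73 Ibca: (*2_1 2:2:2)
  ⟨star222, star2222 circle blank (some 1) blank none colon none colon none, []⟩,
  -- 65 Cmmm: [2_0 *·2·2], [*·2·2·2:2]
  ⟨star222, two_star22 interval (some 0) .plain dot none dot none,
    [star2222 interval dot none dot none dot none colon none]⟩,
  -- 66 Cccm: [2_0 *:2:2], (*2_0 2_1 2·2)
  ⟨star222, two_star22 interval (some 0) .plain colon none colon none,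
    [star2222 circle blank (some 0) blank (some 1) blank none dot none]⟩,
  -- 71 Immm: [2_1 *·2·2]
  ⟨star222, two_star22 interval (some 1) .plain dot none dot none, []⟩,
  -- 72 Ibam: [2_1 *:2:2], (*2_0 2·2:2)
  ⟨star222, two_star22 interval (some 1) .plain colon none colon none,
    [star2222 circle blank (some 0) blank none dot none colon none]⟩,
  -- 59 Pmmn: (2 *̄·2·2), [2_1 2_1 *·]
  ⟨star222, two_star22 circle none (.bar none) dot none dot none,
    [two_two_star interval (some 1) (some 1) .plain dot]⟩,
  -- 56 Pccn: (2 *̄:2:2), (2_1 2 *̄_0)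
  ⟨star222, two_star22 circle none (.bar none) colon none colon none,
    [two_two_star circle (some 1) none (.bar (some 0)) blank]⟩,
  -- 50 Pban: (2 *̄_0 2_0 2_0), (*2_0 2_0 2:2)
  ⟨star222, two_star22 circle none (.bar (some 0)) blank (some 0) blank (some 0),
    [star2222 circle blank (some 0) blank (some 0) blank none colon none]⟩,
  -- 48 Pnnn: (2 *̄_1 2_0 2_0)
  ⟨star222, two_star22 circle none (.bar (some 1)) blank (some 0) blank (some 0), []⟩,
  -- 70 Fddd: (2 *̄ 2_0 2_1)
  ⟨star222, two_star22 circle none (.bar none) blank (some 0) blank (some 1), []⟩,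
  -- 55 Pbam: [2_0 2_0 ×_0], (*2·2:2·2)
  ⟨star222, two_two_cross interval (some 0) (some 0) (.plain (some 0)),
    [star2222 circle blank none dot none colon none dot none]⟩,
  -- 58 Pnnm: [2_0 2_0 ×_1], (2_1 *2·2)
  ⟨star222, two_two_cross interval (some 0) (some 0) (.plain (some 1)),
    [two_star22 circle (some 1) .plain blank none dot none]⟩,
  -- 51 Pmma: [2_0 2_0 *·], [*·2:2·2:2], (*2·2·2·2)
  ⟨star222, two_two_star interval (some 0) (some 0) .plain dot,
    [star2222 interval dot none colon none dot none colon none,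
      star2222 circle blank none dot none dot none dot none]⟩,
  -- 53 Pmna: [2_0 2_0 *:], (*2_1 2_1 2·2), (2_0 *2·2)
  ⟨star222, two_two_star interval (some 0) (some 0) .plain colon,
    [star2222 circle blank (some 1) blank (some 1) blank none dot none,
      two_star22 circle (some 0) .plain blank none dot none]⟩,
  -- 63 Cmcm: [2_0 2_1 *·], (*2·2·2:2), [2_1 *·2:2]
  ⟨star222, two_two_star interval (some 0) (some 1) .plain dot,
    [star2222 circle blank none dot none dot none colon none,
      two_star22 interval (some 1) .plain dot none colon none]⟩,
  -- 64 Cmca: [2_0 2_1 *:], (*2·2:2:2), (*2_1 2·2:2)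
  ⟨star222, two_two_star interval (some 0) (some 1) .plain colon,
    [star2222 circle blank none dot none colon none colon none,
      star2222 circle blank (some 1) blank none dot none colon none]⟩,
  -- 57 Pbcm: (2_0 2 *̄·), (*2:2·2:2), [2_1 2_1 *:]
  ⟨star222, two_two_star circle (some 0) none (.bar none) dot,
    [star2222 circle blank none colon none dot none colon none,
      two_two_star interval (some 1) (some 1) .plain colon]⟩,
  -- 60 Pbcn: (2_0 2 *̄:), (2_1 *2:2), (2_1 2 *̄_1)
  ⟨star222, two_two_star circle (some 0) none (.bar none) colon,
    [two_star22 circle (some 1) .plain blank none colon none,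
      two_two_star circle (some 1) none (.bar (some 1)) blank]⟩,
  -- 62 Pnma: (2_1 2 *̄·), (2 *̄·2:2), [2_1 2_1 ×]
  ⟨star222, two_two_star circle (some 1) none (.bar none) dot,
    [two_star22 circle none (.bar none) dot none colon none,
      two_two_cross interval (some 1) (some 1) (.plain none)]⟩,
  -- 61 Pbca: (2_1 2 *̄:)
  ⟨star222, namePbca, []⟩,
  -- 54 Pcca: (2_0 2 *̄_0), (*2:2:2:2), (*2_1 2_1 2:2)
  ⟨star222, two_two_star circle (some 0) none (.bar (some 0)) blank,
    [star2222 circle blank none colon none colon none colon none,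
      star2222 circle blank (some 1) blank (some 1) blank none colon none]⟩,
  -- 52 Pnna: (2_0 2 *̄_1), (2_0 *2:2), (2 *̄ 2_1 2_1)
  ⟨star222, two_two_star circle (some 0) none (.bar (some 1)) blank,
    [two_star22 circle (some 0) .plain blank none colon none,
      two_star22 circle none (.bar none) blank (some 1) blank (some 1)]⟩]

/-- Point group `222`. -/
def table222 : List Line := [
  -- 16 P222: (*2_0 2_0 2_0 2_0)
  ⟨p222, star2222 circle blank (some 0) blank (some 0) blank (some 0) blank (some 0), []⟩,
  -- 22 F222: (*2_0 2_1 2_0 2_1)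
  ⟨p222, star2222 circle blank (some 0) blank (some 1) blank (some 0) blank (some 1), []⟩,
  -- 17 P222_1: (*2_1 2_1 2_1 2_1), (2_0 2_0 *)
  ⟨p222, star2222 circle blank (some 1) blank (some 1) blank (some 1) blank (some 1),
    [two_two_star circle (some 0) (some 0) .plain blank]⟩,
  -- 21 C222: (2_0 *2_0 2_0), (*2_0 2_0 2_1 2_1)
  ⟨p222, two_star22 circle (some 0) .plain blank (some 0) blank (some 0),
    [star2222 circle blank (some 0) blank (some 0) blank (some 1) blank (some 1)]⟩,
  -- 23 I222: (2_1 *2_0 2_0)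
  ⟨p222, two_star22 circle (some 1) .plain blank (some 0) blank (some 0), []⟩,
  -- 24 I2_12_12_1: (2_0 *2_1 2_1)
  ⟨p222, two_star22 circle (some 0) .plain blank (some 1) blank (some 1), []⟩,
  -- 20 C222_1: (2_1 *2_1 2_1), (2_0 2_1 *)
  ⟨p222, two_star22 circle (some 1) .plain blank (some 1) blank (some 1),
    [two_two_star circle (some 0) (some 1) .plain blank]⟩,
  -- 18 P2_12_12: (2_0 2_0 ×) with a bar on the cross, (2_1 2_1 *)
  ⟨p222, two_two_cross circle (some 0) (some 0) .bar,
    [two_two_star circle (some 1) (some 1) .plain blank]⟩,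
  -- 19 P2_12_12_1: (2_1 2_1 ×) with a bar on the cross
  ⟨p222, two_two_cross circle (some 1) (some 1) .bar, []⟩]

def table : List Line := tableStar222 ++ table222

end

end Fibrifold

open Fibrifold

namespace Fibrifold

/-! ### Conjugation and transport of directions -/

section Transport

variable {G : Subgroup (E3 ≃ᵃ[ℝ] E3)}

/-! For these point groups everything reduces to finite arithmetic. In coordinates along the three
axes every element is a sign change followed by a translation. Adding to a lattice vector its image
under the half turn about axis `i` gives a translation along that axis by twice the `i`-th
coordinate. So once the primitive axis translations have length 1, the lattice lies between ℤ³ and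
(½ℤ)³ and is described by a set `W` of parities. The other translation parts can be taken in
quarters after a choice of origin. A group becomes a `Dat`, and membership, symmetries and
fibrations become decidable.

Each line of the table has an explicit group `grp k`, with adapted coordinates for each of its three
axes; a computation shows that it is a model of the stated names (`isModel_of_check`). Conversely,
models of a table name are unique up to affine maps fixing the vertical direction
(`IsModel.unique`). Indeed the name fixes the plus-couplings of generators and, usually, the
differences between minus-couplings, so one vertical shift aligns everything. Three names leave a
twofold ambiguity, removed by a vertical reflection or by the diagonal symmetry of the plane group.
Thus a fibered group with a table name is some `grp k` with some axis.

Affine conjugacies of normalized groups are signed permutations with translations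
(`IsNormalized.exists_mon`). Hence the data of which sign changes occur with which half translations
along their fixed coordinates (`HasHalf`) are invariant up to permutation of the axes. A number
computed from them separates all 37 groups except I222 and I2₁2₁2₁, which differ in having a common
centre of rotations; the same data separate axes with different names inside one group. Symmetric
axes come from explicit interchanges. In Pbca (index 25) an interchange is impossible, because the
glide reflections orthogonal to an axis distinguish the two other axes.

If a group has a single asymmetric name, some symmetry carries axis 0 to axis 1. It cannot fix axis
2, so it is a 3-cycle of the axes. The lattice is then of type P, I or F, and running through the
remaining finite data (`cyclic_dat`) leaves only groups with a symmetric axis and the two settings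
of Pbca. Finally, Pbca in cubic scaling is normalized by the cyclic permutation of the coordinates.
Adjoining it gives the extension of index 3, irreducible because the invariant directions of Pbca
are only the axes, and these are moved. -/

theorem conj_mem_conj {φ g : E3 ≃ᵃ[ℝ] E3} : φ * g * φ⁻¹ ∈ conj φ G ↔ g ∈ G := by
  constructor
  · rintro ⟨h, hh, e⟩
    have : h = g := by simpa [MulAut.conj_apply] using e
    exact this ▸ hh
  · intro h
    exact ⟨g, h, rfl⟩

theorem mem_conj_iff {φ g : E3 ≃ᵃ[ℝ] E3} : g ∈ conj φ G ↔ φ⁻¹ * g * φ ∈ G := by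
  have h : g = φ * (φ⁻¹ * g * φ) * φ⁻¹ := by simp [mul_assoc]
  conv_lhs => rw [h]
  exact conj_mem_conj

/-- Conjugate membership is read off from an intertwining relation, which for monomial maps is a
computation in coordinates without inverses. -/
theorem mem_conj_of_mul_eq {φ g h : E3 ≃ᵃ[ℝ] E3} (e : φ * g = h * φ) :
    h ∈ conj φ G ↔ g ∈ G := by
  rw [mem_conj_iff, mul_assoc, ← e, inv_mul_cancel_left]

theorem conj_mul (φ ψ : E3 ≃ᵃ[ℝ] E3) : conj (φ * ψ) G = conj φ (conj ψ G) := by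
  ext g
  simp only [mem_conj_iff, mul_inv_rev, mul_assoc]

@[simp] theorem conj_one : conj 1 G = G := by
  ext g
  simp [mem_conj_iff]

theorem conj_inv_eq {φ : E3 ≃ᵃ[ℝ] E3} {G' : Subgroup (E3 ≃ᵃ[ℝ] E3)} (h : conj φ G = G') :
    conj φ⁻¹ G' = G := by
  rw [← h, ← conj_mul, inv_mul_cancel, conj_one]

theorem mapDir_mul (φ ψ : E3 ≃ᵃ[ℝ] E3) (ℓ : Submodule ℝ E3) :
    mapDir (φ * ψ) ℓ = mapDir φ (mapDir ψ ℓ) := by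
  simp only [mapDir]
  rw [← Submodule.map_comp]
  rfl

@[simp] theorem mapDir_one (ℓ : Submodule ℝ E3) : mapDir 1 ℓ = ℓ := by
  simp only [mapDir]
  exact Submodule.map_id ℓ

theorem mapDir_inv_eq {φ : E3 ≃ᵃ[ℝ] E3} {ℓ ℓ' : Submodule ℝ E3} (h : mapDir φ ℓ = ℓ') :
    mapDir φ⁻¹ ℓ' = ℓ := by
  rw [← h, ← mapDir_mul, inv_mul_cancel, mapDir_one]

theorem mapDir_injective (φ : E3 ≃ᵃ[ℝ] E3) : Function.Injective (mapDir φ) := fun a b h => by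
  rw [← mapDir_inv_eq (φ := φ) (ℓ := a) rfl, h, mapDir_inv_eq rfl]

theorem IsFibration.conj {ℓ : Submodule ℝ E3} (h : IsFibration G ℓ) (φ : E3 ≃ᵃ[ℝ] E3) :
    IsFibration (conj φ G) (mapDir φ ℓ) := by
  refine ⟨?_, fun g hg => ?_⟩
  · rw [← h.1]
    exact LinearEquiv.finrank_map_eq φ.linear ℓ
  · have := h.2 _ (mem_conj_iff.1 hg)
    rw [mul_assoc, mapDir_mul, mapDir_mul] at this
    have h2 := congrArg (mapDir φ) this
    rwa [← mapDir_mul, mul_inv_cancel, mapDir_one] at h2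

theorem isFibration_conj_iff {φ : E3 ≃ᵃ[ℝ] E3} {ℓ : Submodule ℝ E3} :
    IsFibration (Fibrifold.conj φ G) (mapDir φ ℓ) ↔ IsFibration G ℓ := by
  refine ⟨fun h => ?_, fun h => h.conj φ⟩
  have := h.conj φ⁻¹
  rwa [conj_inv_eq rfl, mapDir_inv_eq rfl] at this

theorem HasName.conj {ℓ : Submodule ℝ E3} {N : Name} (h : HasName G ℓ N) (φ : E3 ≃ᵃ[ℝ] E3) :
    HasName (conj φ G) (mapDir φ ℓ) N := by
  obtain ⟨h1, ψ, h2, h3⟩ := h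
  refine ⟨h1.conj φ, ψ * φ⁻¹, ?_, ?_⟩
  · rw [← mapDir_mul, inv_mul_cancel_right, h2]
  · rwa [← conj_mul, inv_mul_cancel_right]

theorem SameFibered.conj {ℓ ℓ' : Submodule ℝ E3} (h : SameFibered G ℓ G ℓ') (φ : E3 ≃ᵃ[ℝ] E3) :
    SameFibered (conj φ G) (mapDir φ ℓ) (Fibrifold.conj φ G) (mapDir φ ℓ') := by
  obtain ⟨ψ, h1, h2⟩ := h
  refine ⟨φ * ψ * φ⁻¹, ?_, ?_⟩
  · rw [← conj_mul, inv_mul_cancel_right, conj_mul, h1]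
  · rw [← mapDir_mul, inv_mul_cancel_right, mapDir_mul, h2]

theorem IsSymmetricAxis.conj {ℓ : Submodule ℝ E3} (h : IsSymmetricAxis G ℓ) (φ : E3 ≃ᵃ[ℝ] E3) :
    IsSymmetricAxis (conj φ G) (mapDir φ ℓ) := by
  obtain ⟨ψ, h1, h2, ℓ₁, ℓ₂, f1, f2, n1, n2, n3, e1, e2⟩ := h
  refine ⟨φ * ψ * φ⁻¹, ?_, ?_, mapDir φ ℓ₁, mapDir φ ℓ₂, f1.conj φ, f2.conj φ,
    (mapDir_injective φ).ne n1, (mapDir_injective φ).ne n2, (mapDir_injective φ).ne n3, ?_, ?_⟩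
  · rw [← conj_mul, inv_mul_cancel_right, conj_mul, h1]
  · rw [← mapDir_mul, inv_mul_cancel_right, mapDir_mul, h2]
  · rw [← mapDir_mul, inv_mul_cancel_right, mapDir_mul, e1]
  · rw [← mapDir_mul, inv_mul_cancel_right, mapDir_mul, e2]

theorem isSymmetricAxis_conj_iff {φ : E3 ≃ᵃ[ℝ] E3} {ℓ : Submodule ℝ E3} :
    IsSymmetricAxis (Fibrifold.conj φ G) (mapDir φ ℓ) ↔ IsSymmetricAxis G ℓ := by
  refine ⟨fun h => ?_, fun h => h.conj φ⟩
  have := h.conj φ⁻¹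
  rwa [conj_inv_eq rfl, mapDir_inv_eq rfl] at this

theorem HasSingleAsymmetricName.conj (h : HasSingleAsymmetricName G) (φ : E3 ≃ᵃ[ℝ] E3) :
    HasSingleAsymmetricName (conj φ G) := by
  have key : ∀ ℓ, ∃ ℓ', mapDir φ ℓ' = ℓ := fun ℓ => ⟨mapDir φ⁻¹ ℓ, by
    rw [← mapDir_mul, mul_inv_cancel, mapDir_one]⟩
  constructor
  · intro ℓ ℓ' h1 h2
    obtain ⟨ℓ, rfl⟩ := key ℓ
    obtain ⟨ℓ', rfl⟩ := key ℓ'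
    exact (h.1 ℓ ℓ' (isFibration_conj_iff.1 h1) (isFibration_conj_iff.1 h2)).conj φ
  · intro ℓ h1 h2
    obtain ⟨ℓ, rfl⟩ := key ℓ
    exact h.2 ℓ (isFibration_conj_iff.1 h1) (isSymmetricAxis_conj_iff.1 h2)

end Transport

/-! ### Monomial maps -/

/-- The affine map with `i`-th coordinate `d i * x (π i) + t i`. -/
noncomputable def mon (π : Equiv.Perm (Fin 3)) (d : Fin 3 → ℝˣ) (t : Fin 3 → ℝ) : E3 ≃ᵃ[ℝ] E3 :=
  (LinearEquiv.toAffineEquiv (V₁ := E3) (V₂ := E3)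
    { toFun := fun x : E3 => WithLp.toLp 2 fun i => (d i : ℝ) * x (π i)
      invFun := fun y : E3 => WithLp.toLp 2 fun j => ((d (π.symm j))⁻¹ : ℝˣ) * y (π.symm j)
      map_add' := fun x y => by ext i; simp [mul_add]
      map_smul' := fun c x => by ext i; simp [mul_left_comm]
      left_inv := fun x => by ext i; simp
      right_inv := fun x => by ext i; simp }).trans
    (AffineEquiv.constVAdd ℝ E3 (WithLp.toLp 2 t))

variable {π π' : Equiv.Perm (Fin 3)} {d d' : Fin 3 → ℝˣ} {t t' : Fin 3 → ℝ}

@[simp] theorem mon_apply (x : E3) (i : Fin 3) : mon π d t x i = d i * x (π i) + t i := by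
  simp [mon, add_comm]

@[simp] theorem mon_linear_apply (x : E3) (i : Fin 3) :
    (mon π d t).linear x i = d i * x (π i) := rfl

theorem mon_mul : mon π d t * mon π' d' t' =
    mon (π' * π) (fun i => d i * d' (π i)) (fun i => d i * t' (π i) + t i) := by
  ext x i
  simp [AffineEquiv.mul_def]
  ring

/-- The `i`-th coordinate axis. -/
noncomputable def axis (i : Fin 3) : Submodule ℝ E3 :=
  Submodule.span ℝ {EuclideanSpace.single i (1 : ℝ)}

theorem mem_axis {i : Fin 3} {x : E3} : x ∈ axis i ↔ ∀ j, j ≠ i → x j = 0 := by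
  rw [axis, Submodule.mem_span_singleton]
  constructor
  · rintro ⟨a, rfl⟩ j hj
    simp [hj]
  · intro h
    refine ⟨x i, ?_⟩
    ext j
    by_cases hj : j = i
    · subst hj; simp
    · simp [hj, h j hj]

theorem axis_injective : Function.Injective axis := fun i j h => by
  by_contra hij
  have : EuclideanSpace.single i (1 : ℝ) ∈ axis j := h ▸ Submodule.mem_span_singleton_self _
  simpa using mem_axis.1 this i hij

theorem finrank_axis (i : Fin 3) : Module.finrank ℝ (axis i) = 1 :=
  finrank_span_singleton (by simp)

theorem axis_two : axis 2 = Submodule.span ℝ {!₂[(0 : ℝ), 0, 1]} := by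
  rw [axis]
  congr 2
  ext i
  fin_cases i <;> simp

/-- Coordinate `i` of the image reads coordinate `π i`, so directions move by the inverse of `π`.
This convention governs all later permutations of axes. -/
theorem mapDir_mon_axis (i : Fin 3) : mapDir (mon π d t) (axis (π i)) = axis i := by
  rw [mapDir, axis, axis, Submodule.map_span, Set.image_singleton]
  have : ((mon π d t).linear : E3 →ₗ[ℝ] E3) (EuclideanSpace.single (π i) (1 : ℝ)) =
      (d i : ℝ) • EuclideanSpace.single i (1 : ℝ) := by
    ext j
    by_cases hj : j = i
    · subst hj; simp
    · simp [hj]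
  rw [this]
  exact Submodule.span_singleton_smul_eq (d i).isUnit _

/-- The sign of a Boolean: `true` is `-1`. -/
def sgn (b : Bool) : ℝˣ := if b then -1 else 1

@[simp] theorem sgn_false : sgn false = 1 := rfl
@[simp] theorem sgn_true : sgn true = -1 := rfl

theorem sgn_xor (a b : Bool) : sgn (a ^^ b) = sgn a * sgn b := by
  cases a <;> cases b <;> simp

/-- The affine map changing the signs of coordinates as prescribed, followed by a translation. -/
noncomputable def aff (s : Fin 3 → Bool) (t : Fin 3 → ℝ) : E3 ≃ᵃ[ℝ] E3 :=
  mon 1 (fun i => sgn (s i)) t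

variable {s s' : Fin 3 → Bool}

@[simp] theorem aff_apply (x : E3) (i : Fin 3) : aff s t x i = sgn (s i) * x i + t i := by
  simp [aff]

@[simp] theorem aff_linear_apply (x : E3) (i : Fin 3) :
    (aff s t).linear x i = sgn (s i) * x i := by
  simp [aff]

theorem aff_mul : aff s t * aff s' t' =
    aff (fun i => s i ^^ s' i) (fun i => sgn (s i) * t' i + t i) := by
  ext x i
  simp [AffineEquiv.mul_def, sgn_xor]
  ring

@[simp] theorem aff_one : aff (fun _ => false) (fun _ => 0) = 1 := by
  ext x i
  simp

theorem aff_inv : (aff s t)⁻¹ = aff s (fun i => - (sgn (s i) * t i)) := by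
  rw [inv_eq_iff_mul_eq_one, aff_mul, ← aff_one]
  congr 1
  · simp
  · ext i
    cases s i <;> simp

theorem aff_inj : aff s t = aff s' t' ↔ s = s' ∧ t = t' := by
  constructor
  · intro h
    have h0 : t = t' := by
      ext i
      simpa using congrArg (fun g : E3 ≃ᵃ[ℝ] E3 => g 0 i) h
    refine ⟨?_, h0⟩
    ext i
    have := congrArg (fun g : E3 ≃ᵃ[ℝ] E3 => g (EuclideanSpace.single i 1) i) h
    simp [h0] at this
    cases h1 : s i <;> cases h2 : s' i <;> simp [h1, h2] at this ⊢ <;> norm_num at this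
  · rintro ⟨rfl, rfl⟩
    rfl

/-- Conjugating a sign change by a monomial map. -/
theorem mon_mul_aff : mon π d t' * aff s t = aff (fun i => s (π i))
    (fun i => d i * t (π i) + (t' i - sgn (s (π i)) * t' i)) * mon π d t' := by
  ext x i
  simp [AffineEquiv.mul_def]
  ring

theorem mapDir_aff_axis (i : Fin 3) : mapDir (aff s t) (axis i) = axis i :=
  mapDir_mon_axis (π := 1) i

theorem isometry_mon_sgn : Isometry (mon π (fun i => sgn (s i)) t) := by
  refine Isometry.of_dist_eq fun x y => ?_
  rw [EuclideanSpace.dist_eq, EuclideanSpace.dist_eq]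
  congr 1
  rw [← Equiv.sum_comp π fun i => dist (x i) (y i) ^ 2]
  refine Finset.sum_congr rfl fun i _ => ?_
  rw [mon_apply, mon_apply, Real.dist_eq, Real.dist_eq]
  cases s i <;> simp [sq_abs]
  ring

end Fibrifold

namespace Fibrifold

/-! ### Groups given by finite data -/

/-- Lattice vectors, in quarters of the primitive axis vectors: all entries are even, and
`W` admits the parities of their halves. -/
def latMem (W : (Fin 3 → Bool) → Bool) (X : Fin 3 → ℤ) : Bool :=
  X 0 % 2 == 0 && X 1 % 2 == 0 && X 2 % 2 == 0 && W fun i => X i % 4 == 2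

/-- Whether a sign change reverses the orientation. -/
def odd (s : Fin 3 → Bool) : Bool := s 0 ^^ s 1 ^^ s 2

/-- Change of signs. -/
def flip (s : Fin 3 → Bool) (X : Fin 3 → ℤ) : Fin 3 → ℤ := fun i => if s i then -X i else X i

/-- Finite data for a group: the centring `W`, whether there are orientation reversing elements,
and a translation part `c s` for every sign change `s`, in quarters of the axis vectors. -/
structure Dat where
  W : (Fin 3 → Bool) → Bool
  inv : Bool
  c : (Fin 3 → Bool) → Fin 3 → ℤ

namespace Dat

/-- The sign change `s` occurs. -/
def ok (D : Dat) (s : Fin 3 → Bool) : Bool := D.inv || !odd s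

/-- The sign change `s` followed by the translation `T` belongs to the group. -/
def mem (D : Dat) (s : Fin 3 → Bool) (T : Fin 3 → ℤ) : Bool :=
  D.ok s && latMem D.W fun i => T i - D.c s i

/-- Sufficient conditions for the data to describe a group. -/
structure Valid (D : Dat) : Prop where
  zero : D.W (fun _ => false) = true
  add : ∀ u v, D.W u = true → D.W v = true → D.W (fun i => u i ^^ v i) = true
  one : D.mem (fun _ => false) (fun _ => 0) = true
  mul : ∀ s r, D.ok s = true → D.ok r = true →
    D.mem (fun i => s i ^^ r i) (fun i => D.c s i + flip s (D.c r) i) = true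

/-- The data obtained by permuting the coordinates by `π` and shifting by `V / 8`. -/
def tr (D : Dat) (π : Equiv.Perm (Fin 3)) (V : Fin 3 → ℤ) : Dat where
  W u := D.W fun j => u (π.symm j)
  inv := D.inv
  c s i := D.c (fun j => s (π.symm j)) (π i) + if s i then V i else 0

end Dat

/-! ### Arithmetic of the translation lattice and of the finite data -/

section latMem

variable {W : (Fin 3 → Bool) → Bool} {X Y : Fin 3 → ℤ}

theorem latMem_iff : latMem W X = true ↔
    (∀ i, X i % 2 = 0) ∧ W (fun i => X i % 4 == 2) = true := by
  simp [latMem, Fin.forall_fin_succ, and_assoc]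

/-- All entries are 0 or 2 modulo 4, so addition of vectors adds the parities of their halves. -/
theorem latMem_add (hW : ∀ u v, W u = true → W v = true → W (fun i => u i ^^ v i) = true)
    (hX : latMem W X = true) (hY : latMem W Y = true) :
    latMem W (fun i => X i + Y i) = true := by
  rw [latMem_iff] at *
  refine ⟨fun i => by have := hX.1 i; have := hY.1 i; omega, ?_⟩
  convert hW _ _ hX.2 hY.2 using 2
  ext i
  have h1 : X i % 4 = 0 ∨ X i % 4 = 2 := by have := hX.1 i; omega
  have h2 : Y i % 4 = 0 ∨ Y i % 4 = 2 := by have := hY.1 i; omega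
  rcases h1 with h1 | h1 <;> rcases h2 with h2 | h2 <;> simp [h1, h2, Int.add_emod]

/-- Being even, and being 2 modulo 4, do not depend on the sign. Hence every such lattice is
invariant under all sign changes and `Dat.Valid` need not demand it. -/
theorem latMem_flip (s : Fin 3 → Bool) : latMem W (flip s X) = latMem W X := by
  rw [Bool.eq_iff_iff, latMem_iff, latMem_iff]
  have h : ∀ i, flip s X i % 2 = 0 ↔ X i % 2 = 0 := fun i => by
    unfold flip; split <;> omega
  simp only [h]
  refine and_congr_right fun hX => ?_
  have : (fun i => flip s X i % 4 == 2) = fun i => X i % 4 == 2 := by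
    ext i
    have := hX i
    rw [Bool.eq_iff_iff, beq_iff_eq, beq_iff_eq]
    unfold flip; split <;> omega
  rw [this]

theorem latMem_congr (h : ∀ i, X i % 4 = Y i % 4) : latMem W X = latMem W Y := by
  have h2 : ∀ i, X i % 2 = Y i % 2 := fun i => by have := h i; omega
  simp only [latMem, h, h2]

theorem latMem_perm (π : Equiv.Perm (Fin 3)) :
    latMem (fun u => W fun j => u (π.symm j)) (fun i => X (π i)) = latMem W X := by
  rw [Bool.eq_iff_iff, latMem_iff, latMem_iff]
  simp only [Equiv.apply_symm_apply]
  rw [π.forall_congr_left]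
  simp

end latMem

theorem odd_perm (π : Equiv.Perm (Fin 3)) (s : Fin 3 → Bool) :
    odd (fun i => s (π i)) = odd s := by
  revert π s
  decide

namespace Dat

variable {D : Dat}

/-- The lattice test sees entries only modulo 4, i.e. modulo ℤ³; this is what makes all checks
finite. -/
theorem mem_congr {s : Fin 3 → Bool} {T T' : Fin 3 → ℤ} (h : ∀ i, T i % 4 = T' i % 4) :
    D.mem s T = D.mem s T' := by
  rw [mem, mem, latMem_congr]
  intro i
  have := h i
  omega

theorem mem_iff {s : Fin 3 → Bool} {T : Fin 3 → ℤ} :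
    D.mem s T = true ↔ D.ok s = true ∧ latMem D.W (fun i => T i - D.c s i) = true := by
  simp [mem]

theorem Valid.mem_mul (h : D.Valid) {s r : Fin 3 → Bool} {T U : Fin 3 → ℤ}
    (hs : D.mem s T = true) (hr : D.mem r U = true) :
    D.mem (fun i => s i ^^ r i) (fun i => T i + flip s U i) = true := by
  rw [mem_iff] at hs hr
  have := h.mul s r hs.1 hr.1
  rw [mem_iff] at this ⊢
  refine ⟨this.1, ?_⟩
  have h1 := latMem_add h.add (latMem_add h.add this.2 hs.2) ((latMem_flip s).trans hr.2)
  convert h1 using 2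
  ext i
  unfold flip
  split <;> ring

theorem Valid.mem_inv (h : D.Valid) {s : Fin 3 → Bool} {T : Fin 3 → ℤ}
    (hs : D.mem s T = true) : D.mem s (fun i => - flip s T i) = true := by
  have h1 := mem_iff.1 hs
  -- The square of a sign change is a pure translation, so the product of the representative with
  -- itself lies in the lattice coset of the identity.
  have h2 := h.mul s s h1.1 h1.1
  have h0 := mem_iff.1 h.one
  rw [mem_iff] at h2 ⊢
  refine ⟨h1.1, ?_⟩
  have e : (fun i => (s i ^^ s i)) = fun _ => false := by ext; simp
  rw [e] at h2
  have h3 := latMem_add h.add ((latMem_flip s).trans h1.2) h2.2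
  convert latMem_add h.add ((latMem_flip fun _ => true).trans h3) h0.2 using 2
  ext i
  simp only [flip]
  cases s i <;> (simp; try ring)

theorem mem_tr (π : Equiv.Perm (Fin 3)) (V : Fin 3 → ℤ) (s : Fin 3 → Bool) (T : Fin 3 → ℤ) :
    (D.tr π V).mem (fun i => s (π i)) (fun i => T (π i) + if s (π i) then V i else 0) =
      D.mem s T := by
  unfold mem ok
  rw [odd_perm]
  congr 1
  simpa [tr] using latMem_perm (W := D.W) (X := fun i => T i - D.c s i) π

end Dat

/-- The group `G` is given by the data `D`, in units of `q i / 4` along the `i`-th axis. -/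
def Repr (G : Subgroup (E3 ≃ᵃ[ℝ] E3)) (q : Fin 3 → ℝˣ) (D : Dat) : Prop :=
  ∀ g, g ∈ G ↔ ∃ s T, D.mem s T = true ∧ g = aff s fun i => (q i : ℝ) * (T i : ℝ) / 4

variable {G G' : Subgroup (E3 ≃ᵃ[ℝ] E3)} {D D' : Dat} {q : Fin 3 → ℝˣ}

theorem Repr.mem_aff (h : Repr G q D) {s : Fin 3 → Bool} {T : Fin 3 → ℤ} :
    aff s (fun i => (q i : ℝ) * (T i : ℝ) / 4) ∈ G ↔ D.mem s T = true := by
  rw [h]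
  constructor
  · rintro ⟨s', T', hm, e⟩
    obtain ⟨rfl, e'⟩ := aff_inj.1 e
    have : T = T' := by
      ext i
      have := congrFun e' i
      have hq := (q i).ne_zero
      field_simp at this
      exact_mod_cast this
    rwa [this]
  · exact fun hm => ⟨s, T, hm, rfl⟩

theorem Repr.eq (h : Repr G q D) (h' : Repr G' q D')
    (e : ∀ s T, D.mem s T = D'.mem s T) : G = G' := by
  ext g
  rw [h, h']
  simp only [e]

/-- A shift by `v` adds `2 v` to the translation part exactly on the reversed coordinates. Shifts in
eighths therefore change the data by quarters. -/
theorem Repr.conj (h : Repr G 1 D) (π : Equiv.Perm (Fin 3)) (q : Fin 3 → ℝˣ) (V : Fin 3 → ℤ) :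
    Repr (conj (mon π q fun i => q i * V i / 8) G) q (D.tr π V) := by
  have key : ∀ s (T : Fin 3 → ℤ),
      mon π q (fun i => q i * V i / 8) * aff s (fun i => ((1 : Fin 3 → ℝˣ) i : ℝ) * T i / 4) =
      aff (fun i => s (π i)) (fun i => (q i : ℝ) *
        ((T (π i) + if s (π i) then V i else 0 : ℤ) : ℝ) / 4) *
        mon π q (fun i => q i * V i / 8) := by
    intro s T
    rw [mon_mul_aff]
    congr 2
    ext i
    cases s (π i) <;> simp <;> ring
  intro g
  constructor
  · intro hg
    obtain ⟨s, T, hm, e⟩ := (h _).1 (mem_conj_iff.1 hg)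
    refine ⟨_, _, (Dat.mem_tr π V s T).trans hm, ?_⟩
    have := key s T
    rw [← e] at this
    rw [← mul_left_inj, ← this]
    simp [mul_assoc]
  · rintro ⟨s, T, hm, rfl⟩
    have e := key (fun j => s (π.symm j))
      fun j => T (π.symm j) - if s (π.symm j) then V (π.symm j) else 0
    have e2 := Dat.mem_tr (D := D) π V (fun j => s (π.symm j))
      fun j => T (π.symm j) - if s (π.symm j) then V (π.symm j) else 0
    simp only [Equiv.symm_apply_apply, sub_add_cancel] at e e2
    rw [mem_conj_of_mul_eq e, h.mem_aff, ← e2]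
    exact hm

end Fibrifold

/-! ### The group of valid data: discreteness, cocompactness, point group -/

namespace Fibrifold

variable {G G' : Subgroup (E3 ≃ᵃ[ℝ] E3)} {D : Dat}

/-- The group described by valid data. -/
noncomputable def Dat.group (D : Dat) (h : D.Valid) : Subgroup (E3 ≃ᵃ[ℝ] E3) where
  carrier := {g | ∃ s T, D.mem s T = true ∧ g = aff s fun i => (T i : ℝ) / 4}
  one_mem' := ⟨_, _, h.one, by simp⟩
  mul_mem' := by
    rintro _ _ ⟨s, T, hT, rfl⟩ ⟨r, U, hU, rfl⟩
    refine ⟨_, _, h.mem_mul hT hU, ?_⟩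
    rw [aff_mul]
    congr 1
    ext i
    unfold flip
    cases s i <;> (simp; ring)
  inv_mem' := by
    rintro _ ⟨s, T, hT, rfl⟩
    refine ⟨_, _, h.mem_inv hT, ?_⟩
    rw [aff_inv]
    congr 1
    ext i
    unfold flip
    cases s i <;> (simp; try ring)

theorem Dat.repr_group (h : D.Valid) : Repr (D.group h) 1 D := fun g => by
  simp [Dat.group, ← SetLike.mem_coe]

/-- If `g x` lies in a ball of radius `R`, each quarter translation is at most `R + ‖x‖`. Only
finitely many integers `T i` remain, besides finitely many permutations and signs. -/
theorem discrete_of_mon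
    (hG : ∀ g ∈ G, ∃ π, ∃ s : Fin 3 → Bool, ∃ T : Fin 3 → ℤ,
      g = mon π (fun i => sgn (s i)) fun i => (T i : ℝ) / 4)
    (C : Set E3) (hC : IsCompact C) (x : E3) : {y | y ∈ C ∧ ∃ g ∈ G, g x = y}.Finite := by
  obtain ⟨R, hR⟩ := hC.isBounded.exists_norm_le
  obtain ⟨K, hK⟩ := exists_nat_ge (4 * (R + ‖x‖))
  let f : Equiv.Perm (Fin 3) × (Fin 3 → Bool) × (Fin 3 → ℤ) → E3 := fun p =>
    mon p.1 (fun i => sgn (p.2.1 i)) (fun i => (p.2.2 i : ℝ) / 4) x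
  refine ((Set.finite_univ.prod (Set.finite_univ.prod
    (Set.finite_Icc (fun _ => (-K : ℤ)) fun _ => (K : ℤ)))).image f).subset ?_
  rintro y ⟨hy, g, hg, rfl⟩
  obtain ⟨π, s, T, rfl⟩ := hG g hg
  refine ⟨(π, s, T), ⟨trivial, trivial, ?_⟩, rfl⟩
  have key : ∀ i, |(T i : ℝ)| ≤ K := fun i => by
    have h1 := (PiLp.norm_apply_le (mon π (fun i => sgn (s i)) (fun i => (T i : ℝ) / 4) x) i).trans
      (hR _ hy)
    have h2 := PiLp.norm_apply_le x (π i)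
    rw [mon_apply] at h1
    rw [Real.norm_eq_abs] at h1 h2
    have h3 : |(sgn (s i) : ℝ) * x (π i)| = |x (π i)| := by cases s i <;> simp
    have h4 : (T i : ℝ) =
        4 * (((sgn (s i) : ℝ) * x (π i) + T i / 4) - (sgn (s i) : ℝ) * x (π i)) := by
      ring
    rw [h4, abs_mul, abs_of_pos (by norm_num : (0 : ℝ) < 4)]
    refine le_trans ?_ hK
    have := abs_sub ((sgn (s i) : ℝ) * x (π i) + T i / 4) ((sgn (s i) : ℝ) * x (π i))
    gcongr
    linarith
  constructor <;> intro i
  · have := (abs_le.1 (key i)).1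
    exact_mod_cast this
  · have := (abs_le.1 (key i)).2
    exact_mod_cast this

theorem isSpaceGroup_of_mon
    (hG : ∀ g ∈ G, ∃ π, ∃ s : Fin 3 → Bool, ∃ T : Fin 3 → ℤ,
      g = mon π (fun i => sgn (s i)) fun i => (T i : ℝ) / 4)
    (hT : ∀ T : Fin 3 → ℤ, aff (fun _ => false) (fun i => (T i : ℝ)) ∈ G) : IsSpaceGroup G where
  isometry g hg := by
    obtain ⟨π, s, T, rfl⟩ := hG g hg
    exact isometry_mon_sgn
  discrete := discrete_of_mon hG
  cocompact := by
    -- The vector of fractional parts has norm at most √3, which is below 2.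
    refine ⟨Metric.closedBall 0 2, isCompact_closedBall _ _, fun x => ⟨_, hT fun i => ⌊x i⌋,
      WithLp.toLp 2 fun i => Int.fract (x i), ?_, ?_⟩⟩
    · rw [mem_closedBall_zero_iff, EuclideanSpace.norm_eq, Real.sqrt_le_left (by norm_num),
        Fin.sum_univ_three]
      have : ∀ i, ‖Int.fract (x i)‖ ^ 2 ≤ 1 := fun i => by
        rw [Real.norm_eq_abs, sq_abs]
        have := Int.fract_nonneg (x i)
        have := Int.fract_lt_one (x i)
        nlinarith
      have h0 := this 0
      have h1 := this 1
      have h2 := this 2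
      simp only
      linarith
    · ext i
      simp

/-- The sign of a Boolean as a unit of `ℤ`. -/
def sg (b : Bool) : ℤˣ := if b then -1 else 1

theorem sg_cast (b : Bool) : ((sg b : ℤ) : ℝ) = sgn b := by cases b <;> simp [sg]

theorem exists_sg (s : Fin 3 → ℤˣ) : ∃ r : Fin 3 → Bool, s = fun i => sg (r i) := by
  refine ⟨fun i => decide (s i = -1), ?_⟩
  ext i
  rcases Int.units_eq_one_or (s i) with h | h <;> simp [h, sg]

theorem sg_prod (s : Fin 3 → Bool) : sg (s 0) * sg (s 1) * sg (s 2) = 1 ↔ odd s = false := by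
  unfold odd
  cases s 0 <;> cases s 1 <;> cases s 2 <;> simp [sg]

theorem linear_eq_aff_iff {A : E3 ≃ₗ[ℝ] E3} {s : Fin 3 → Bool} {t : Fin 3 → ℝ} :
    (∀ i, A (EuclideanSpace.basisFun (Fin 3) ℝ i) =
      ((sg (s i) : ℤ) : ℝ) • EuclideanSpace.basisFun (Fin 3) ℝ i) ↔ (aff s t).linear = A := by
  have h : ∀ i, (aff s t).linear (EuclideanSpace.basisFun (Fin 3) ℝ i) =
      ((sg (s i) : ℤ) : ℝ) • EuclideanSpace.basisFun (Fin 3) ℝ i := fun i => by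
    ext j
    rw [aff_linear_apply, sg_cast]
    by_cases hj : j = i
    · subst hj; simp
    · simp [hj]
  constructor
  · intro hA
    refine LinearEquiv.toLinearMap_injective
      ((EuclideanSpace.basisFun (Fin 3) ℝ).toBasis.ext fun i => ?_)
    have := (h i).trans (hA i).symm
    simpa using this
  · rintro rfl
    exact h

theorem mem_pointGroup_iff {A : E3 ≃ₗ[ℝ] E3} : A ∈ pointGroup G ↔ ∃ g ∈ G, g.linear = A :=
  Iff.rfl

theorem Repr.mem_pointGroup {q : Fin 3 → ℝˣ} (h : Repr G q D) (h0 : D.W (fun _ => false) = true)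
    {A : E3 ≃ₗ[ℝ] E3} : A ∈ pointGroup G ↔ ∃ s, D.ok s = true ∧
      ∀ i, A (EuclideanSpace.basisFun (Fin 3) ℝ i) =
        ((sg (s i) : ℤ) : ℝ) • EuclideanSpace.basisFun (Fin 3) ℝ i := by
  rw [mem_pointGroup_iff]
  constructor
  · rintro ⟨g, hg, rfl⟩
    obtain ⟨s, T, hm, rfl⟩ := (h g).1 hg
    exact ⟨s, (Dat.mem_iff.1 hm).1, linear_eq_aff_iff.2 rfl⟩
  · rintro ⟨s, hs, hA⟩
    refine ⟨_, (h.mem_aff (T := D.c s) (s := s)).2 (Dat.mem_iff.2 ⟨hs, ?_⟩),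
      linear_eq_aff_iff.1 hA⟩
    simpa [latMem] using h0

theorem Repr.hasPointGroup {q : Fin 3 → ℝˣ} (h : Repr G q D) (h0 : D.W (fun _ => false) = true) :
    HasPointGroup G (if D.inv then .star222 else .p222) := by
  cases hi : D.inv
  · refine ⟨EuclideanSpace.basisFun (Fin 3) ℝ, fun A => ?_⟩
    rw [h.mem_pointGroup h0]
    constructor
    · rintro ⟨s, hs, hA⟩
      exact ⟨fun i => sg (s i), (sg_prod s).2 (by simpa [Dat.ok, hi] using hs), hA⟩
    · rintro ⟨s, hs, hA⟩
      obtain ⟨r, rfl⟩ := exists_sg s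
      exact ⟨r, by simpa [Dat.ok, hi] using (sg_prod r).1 hs, hA⟩
  · refine ⟨EuclideanSpace.basisFun (Fin 3) ℝ, fun A => ?_⟩
    rw [h.mem_pointGroup h0]
    constructor
    · rintro ⟨s, hs, hA⟩
      exact ⟨fun i => sg (s i), hA⟩
    · rintro ⟨s, hA⟩
      obtain ⟨r, rfl⟩ := exists_sg s
      exact ⟨r, by simp [Dat.ok, hi], hA⟩

theorem Dat.Valid.isSpaceGroup (h : D.Valid) : IsSpaceGroup (D.group h) := by
  refine isSpaceGroup_of_mon ?_ fun T => ?_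
  · rintro g ⟨s, T, -, rfl⟩
    exact ⟨1, s, T, rfl⟩
  · refine ⟨fun _ => false, fun i => 4 * T i, ?_, ?_⟩
    · rw [← h.one]
      exact Dat.mem_congr fun i => by simp
    · congr 1
      ext i
      push_cast
      ring

end Fibrifold

namespace Fibrifold

/-! ### Horizontal and vertical operations -/

theorem horiz_mul (s r s' r' : ℤˣ) (t u t' u' : ℝ) : horiz s t r u * horiz s' t' r' u' =
    horiz (s * s') (t + ((s : ℤ) : ℝ) * t') (r * r') (u + ((r : ℤ) : ℝ) * u') := by
  ext p <;> simp [horiz_apply] <;> ring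

/-- A horizontal operation with translation part in half units. -/
structure Hz where
  a : Bool
  m : ℤ
  b : Bool
  n : ℤ

namespace Hz

noncomputable def perm (h : Hz) : Equiv.Perm (ℝ × ℝ) :=
  horiz (sg h.a) ((h.m : ℝ) / 2) (sg h.b) ((h.n : ℝ) / 2)

def mul (h k : Hz) : Hz :=
  ⟨h.a ^^ k.a, h.m + if h.a then -k.m else k.m, h.b ^^ k.b, h.n + if h.b then -k.n else k.n⟩

def inv (h : Hz) : Hz := ⟨h.a, if h.a then h.m else -h.m, h.b, if h.b then h.n else -h.n⟩

theorem sg_xor (a b : Bool) : sg (a ^^ b) = sg a * sg b := by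
  cases a <;> cases b <;> simp [sg]

theorem perm_mul (h k : Hz) : h.perm * k.perm = (h.mul k).perm := by
  rw [perm, perm, horiz_mul, perm]
  simp only [mul, sg_xor, sg_cast]
  congr 1
  · cases h.a <;> simp <;> ring
  · cases h.b <;> simp <;> ring

theorem perm_one : perm ⟨false, 0, false, 0⟩ = 1 := by
  ext p <;> simp [perm, horiz_apply, sg]

theorem perm_inv (h : Hz) : h.perm⁻¹ = h.inv.perm := by
  rw [inv_eq_iff_mul_eq_one, perm_mul, ← perm_one]
  congr 1
  simp only [mul, inv, Hz.mk.injEq]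
  cases h.a <;> cases h.b <;> simp

end Hz

theorem s2222P_eq : s2222P = Hz.perm ⟨true, 0, false, 0⟩ := by
  simp [s2222P, Hz.perm, sg]
theorem s2222Q_eq : s2222Q = Hz.perm ⟨false, 0, true, 0⟩ := by
  simp [s2222Q, Hz.perm, sg]
theorem s2222R_eq : s2222R = Hz.perm ⟨true, 2, false, 0⟩ := by
  simp [s2222R, Hz.perm, sg]
theorem s2222S_eq : s2222S = Hz.perm ⟨false, 0, true, 2⟩ := by
  simp [s2222S, Hz.perm, sg]
theorem s22P_eq : s22P = Hz.perm ⟨true, 0, false, 0⟩ := by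
  simp [s22P, Hz.perm, sg]
theorem s22Q_eq : s22Q = Hz.perm ⟨false, 0, true, 0⟩ := by
  simp [s22Q, Hz.perm, sg]
theorem s22γ_eq : s22γ = Hz.perm ⟨true, 1, true, 1⟩ := by
  simp [s22γ, Hz.perm, sg]
theorem sγ_eq : sγ = Hz.perm ⟨true, 0, true, 1⟩ := by
  simp [sγ, Hz.perm, sg]
theorem sδ_eq : sδ = Hz.perm ⟨true, 2, true, 1⟩ := by
  simp [sδ, Hz.perm, sg]
theorem sP_eq : sP = Hz.perm ⟨false, 0, true, 0⟩ := by
  simp [sP, Hz.perm, sg]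
theorem xγ_eq : xγ = Hz.perm ⟨true, 0, true, 0⟩ := by
  simp [xγ, Hz.perm, sg]
theorem xδ_eq : xδ = Hz.perm ⟨true, 2, true, 0⟩ := by
  simp [xδ, Hz.perm, sg]
theorem xZ_eq : xZ = Hz.perm ⟨false, 1, true, 1⟩ := by
  simp [xZ, Hz.perm, sg]

/-- The vertical operation `c-` or `c+`. -/
def vert (e : Bool) (c : ℝ) : Equiv.Perm ℝ := if e then minus c else plus c

theorem vert_apply (e : Bool) (c z : ℝ) : vert e c z = c + sgn e * z := by
  cases e <;> simp [vert, plus, minus, sub_eq_add_neg]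

theorem vert_mul (e e' : Bool) (c c' : ℝ) :
    vert e c * vert e' c' = vert (e ^^ e') (c + sgn e * c') := by
  ext z
  simp [vert_apply, sgn_xor]
  ring

theorem plus_eq_vert (c : ℝ) : plus c = vert false c := rfl
theorem minus_eq_vert (c : ℝ) : minus c = vert true c := rfl

theorem vert_inj {e e' : Bool} {c c' : ℝ} : vert e c = vert e' c' ↔ e = e' ∧ c = c' := by
  constructor
  · intro h
    have h0 := congrArg (fun v : Equiv.Perm ℝ => v 0) h
    have h1 := congrArg (fun v : Equiv.Perm ℝ => v 1) h
    simp only [vert_apply, mul_zero, add_zero, mul_one] at h0 h1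
    refine ⟨?_, h0⟩
    cases e <;> cases e' <;> simp [h0] at h1 ⊢ <;> norm_num at h1
  · rintro ⟨rfl, rfl⟩
    rfl

theorem horiz_inj {a b a' b' : Bool} {t u t' u' : ℝ} :
    horiz (sg a) t (sg b) u = horiz (sg a') t' (sg b') u' ↔ a = a' ∧ t = t' ∧ b = b' ∧ u = u' := by
  constructor
  · intro h
    have h0 := congrArg (fun v : Equiv.Perm (ℝ × ℝ) => v 0) h
    have h1 := congrArg (fun v : Equiv.Perm (ℝ × ℝ) => v (1, 1)) h
    simp only [horiz_apply, sg_cast, Prod.fst_zero, Prod.snd_zero, mul_zero, add_zero, mul_one,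
      Prod.mk.injEq] at h0 h1
    obtain ⟨h0, h0'⟩ := h0
    obtain ⟨h1, h1'⟩ := h1
    refine ⟨?_, h0, ?_, h0'⟩
    · cases a <;> cases a' <;> simp [h0] at h1 ⊢ <;> norm_num at h1
    · cases b <;> cases b' <;> simp [h0'] at h1' ⊢ <;> norm_num at h1'
  · rintro ⟨rfl, rfl, rfl, rfl⟩
    rfl

theorem hasParts_iff {g : E3 ≃ᵃ[ℝ] E3} {a b e : Bool} {t u c : ℝ} :
    HasParts g (horiz (sg a) t (sg b) u) (vert e c) ↔ g = aff ![a, b, e] ![t, u, c] := by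
  have h : HasParts (aff ![a, b, e] ![t, u, c]) (horiz (sg a) t (sg b) u) (vert e c) := by
    intro x y z
    ext i
    fin_cases i <;> simp [horiz_apply, vert_apply, sg_cast, add_comm]
  constructor
  · intro hg
    ext x i
    have e : x = !₂[x 0, x 1, x 2] := by ext i; fin_cases i <;> rfl
    rw [e, hg, h]
  · rintro rfl
    exact h

theorem HasParts.unique {g g' : E3 ≃ᵃ[ℝ] E3} {h : Equiv.Perm (ℝ × ℝ)} {v : Equiv.Perm ℝ}
    (hg : HasParts g h v) (hg' : HasParts g' h v) : g = g' := by
  ext x i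
  have e : x = !₂[x 0, x 1, x 2] := by ext i; fin_cases i <;> rfl
  rw [e, hg, hg']

theorem HasParts.parts_unique {g : E3 ≃ᵃ[ℝ] E3} {h h' : Equiv.Perm (ℝ × ℝ)} {v v' : Equiv.Perm ℝ}
    (hg : HasParts g h v) (hg' : HasParts g h' v') : h = h' ∧ v = v' := by
  have key : ∀ x y z, h (x, y) = h' (x, y) ∧ v z = v' z := fun x y z => by
    have := (hg x y z).symm.trans (hg' x y z)
    have h0 := congrArg (fun p : E3 => p 0) this
    have h1 := congrArg (fun p : E3 => p 1) this
    have h2 := congrArg (fun p : E3 => p 2) this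
    exact ⟨Prod.ext h0 h1, h2⟩
  exact ⟨Equiv.ext fun p => (key p.1 p.2 0).1, Equiv.ext fun z => (key 0 0 z).2⟩

theorem HasParts.mul {g g' : E3 ≃ᵃ[ℝ] E3} {h h' : Equiv.Perm (ℝ × ℝ)} {v v' : Equiv.Perm ℝ}
    (hg : HasParts g h v) (hg' : HasParts g' h' v') : HasParts (g * g') (h * h') (v * v') := by
  intro x y z
  rw [AffineEquiv.mul_def, AffineEquiv.trans_apply, hg', hg]
  rfl

theorem HasParts.inv {g : E3 ≃ᵃ[ℝ] E3} {h : Equiv.Perm (ℝ × ℝ)} {v : Equiv.Perm ℝ}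
    (hg : HasParts g h v) : HasParts g⁻¹ h⁻¹ v⁻¹ := by
  intro x y z
  change g.symm _ = _
  rw [AffineEquiv.symm_apply_eq, hg]
  simp

theorem hasParts_one : HasParts 1 1 1 := fun _ _ _ => rfl

section Couples

variable {G : Subgroup (E3 ≃ᵃ[ℝ] E3)} {h h' : Equiv.Perm (ℝ × ℝ)} {v v' : Equiv.Perm ℝ}

theorem Couples.mul (c : Couples G h v) (c' : Couples G h' v') :
    Couples G (h * h') (v * v') := by
  obtain ⟨g, hg, p⟩ := c
  obtain ⟨g', hg', p'⟩ := c'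
  exact ⟨g * g', G.mul_mem hg hg', p.mul p'⟩

theorem Couples.inv (c : Couples G h v) : Couples G h⁻¹ v⁻¹ := by
  obtain ⟨g, hg, p⟩ := c
  exact ⟨g⁻¹, G.inv_mem hg, p.inv⟩

theorem couples_one : Couples G 1 1 := ⟨1, G.one_mem, hasParts_one⟩

/-- The two parts determine an affine map, so a coupling is a statement about membership of one
particular element. -/
theorem Couples.mem {g : E3 ≃ᵃ[ℝ] E3} (c : Couples G h v) (p : HasParts g h v) : g ∈ G := by
  obtain ⟨g', hg', p'⟩ := c
  exact p.unique p' ▸ hg'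

end Couples

/-! ### The elements of the plane groups -/

section PlaneGroup

variable {H : Subgroup (Equiv.Perm (ℝ × ℝ))}

theorem Hz.mul_mem {h k : Hz} (hh : h.perm ∈ H) (hk : k.perm ∈ H) : (h.mul k).perm ∈ H := by
  rw [← Hz.perm_mul]
  exact H.mul_mem hh hk

theorem Hz.zpow_mem {m n : ℤ} (h : Hz.perm ⟨false, m, false, n⟩ ∈ H) (k : ℤ) :
    Hz.perm ⟨false, k * m, false, k * n⟩ ∈ H := by
  have e : ∀ k : ℤ, Hz.perm ⟨false, k * m, false, k * n⟩ = Hz.perm ⟨false, m, false, n⟩ ^ k := by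
    intro k
    induction k using Int.induction_on with
    | zero => simp [Hz.perm_one]
    | succ k ih =>
      rw [zpow_add_one, ← ih, Hz.perm_mul]
      simp [Hz.mul, add_mul]
    | pred k ih =>
      rw [zpow_sub_one, ← ih, Hz.perm_inv, Hz.perm_mul]
      simp [Hz.mul, Hz.inv, add_mul, sub_eq_add_neg]
  rw [e]
  exact H.zpow_mem h k

/-- Reduces membership in a plane group to two translations and one representative for each linear
part. -/
theorem Hz.lattice_mem {a b : Bool} {m n m₁ n₁ m₂ n₂ : ℤ} (k₁ k₂ : ℤ)
    (h₁ : Hz.perm ⟨false, m₁, false, n₁⟩ ∈ H) (h₂ : Hz.perm ⟨false, m₂, false, n₂⟩ ∈ H)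
    (h : Hz.perm ⟨a, m, b, n⟩ ∈ H) {x y : ℤ} (hx : x = k₁ * m₁ + k₂ * m₂ + m)
    (hy : y = k₁ * n₁ + k₂ * n₂ + n) : Hz.perm ⟨a, x, b, y⟩ ∈ H := by
  have := Hz.mul_mem (Hz.mul_mem (Hz.zpow_mem h₁ k₁) (Hz.zpow_mem h₂ k₂)) h
  simpa [Hz.mul, hx, hy] using this

/-- Which horizontal operations belong to the plane group of a name. -/
def Name.hasHz (N : Name) (h : Hz) : Bool :=
  match N with
  | .star2222 .. => h.m % 2 == 0 && h.n % 2 == 0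
  | .two_star22 .. => h.m % 2 == h.n % 2
  | .two_two_star .. => h.m % 2 == 0 && h.n % 2 == if h.a then 1 else 0
  | .two_two_cross .. => (h.m % 2 == if h.a ^^ h.b then 1 else 0) &&
      h.n % 2 == if h.a ^^ h.b then 1 else 0

theorem perm_mem_s2222 {a b : Bool} {m n : ℤ} (h : m % 2 = 0 ∧ n % 2 = 0) :
    Hz.perm ⟨a, m, b, n⟩ ∈
        Subgroup.closure ({s2222P, s2222Q, s2222R, s2222S} : Set (Equiv.Perm (ℝ × ℝ))) := by
  have hP : Hz.perm ⟨true, 0, false, 0⟩ ∈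
      Subgroup.closure ({s2222P, s2222Q, s2222R, s2222S} : Set (Equiv.Perm (ℝ × ℝ))) :=
    Subgroup.subset_closure (by simp [s2222P_eq])
  have hQ : Hz.perm ⟨false, 0, true, 0⟩ ∈
      Subgroup.closure ({s2222P, s2222Q, s2222R, s2222S} : Set (Equiv.Perm (ℝ × ℝ))) :=
    Subgroup.subset_closure (by simp [s2222Q_eq])
  have hR : Hz.perm ⟨true, 2, false, 0⟩ ∈
      Subgroup.closure ({s2222P, s2222Q, s2222R, s2222S} : Set (Equiv.Perm (ℝ × ℝ))) :=
    Subgroup.subset_closure (by simp [s2222R_eq])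
  have hS : Hz.perm ⟨false, 0, true, 2⟩ ∈
      Subgroup.closure ({s2222P, s2222Q, s2222R, s2222S} : Set (Equiv.Perm (ℝ × ℝ))) :=
    Subgroup.subset_closure (by simp [s2222S_eq])
  have hx : Hz.perm ⟨false, 2, false, 0⟩ ∈
      Subgroup.closure ({s2222P, s2222Q, s2222R, s2222S} : Set (Equiv.Perm (ℝ × ℝ))) := by
    simpa [Hz.mul] using Hz.mul_mem hR hP
  have hy : Hz.perm ⟨false, 0, false, 2⟩ ∈
      Subgroup.closure ({s2222P, s2222Q, s2222R, s2222S} : Set (Equiv.Perm (ℝ × ℝ))) := by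
    simpa [Hz.mul] using Hz.mul_mem hS hQ
  refine Hz.lattice_mem (m := 0) (n := 0) (m / 2) (n / 2)
    hx hy ?_ (by omega) (by omega)
  cases a <;> cases b
  · simpa [Hz.mul] using Hz.mul_mem hP hP
  · simpa [Hz.mul] using hQ
  · simpa [Hz.mul] using hP
  · simpa [Hz.mul] using Hz.mul_mem hP hQ

theorem perm_mem_s22 {a b : Bool} {m n : ℤ} (h : m % 2 = n % 2) :
    Hz.perm ⟨a, m, b, n⟩ ∈ Subgroup.closure ({s22γ, s22P, s22Q} : Set (Equiv.Perm (ℝ × ℝ))) := by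
  have hγ : Hz.perm ⟨true, 1, true, 1⟩ ∈
      Subgroup.closure ({s22γ, s22P, s22Q} : Set (Equiv.Perm (ℝ × ℝ))) :=
    Subgroup.subset_closure (by simp [s22γ_eq])
  have hP : Hz.perm ⟨true, 0, false, 0⟩ ∈
      Subgroup.closure ({s22γ, s22P, s22Q} : Set (Equiv.Perm (ℝ × ℝ))) :=
    Subgroup.subset_closure (by simp [s22P_eq])
  have hQ : Hz.perm ⟨false, 0, true, 0⟩ ∈
      Subgroup.closure ({s22γ, s22P, s22Q} : Set (Equiv.Perm (ℝ × ℝ))) :=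
    Subgroup.subset_closure (by simp [s22Q_eq])
  have hy : Hz.perm ⟨false, 1, false, 1⟩ ∈
      Subgroup.closure ({s22γ, s22P, s22Q} : Set (Equiv.Perm (ℝ × ℝ))) := by
    simpa [Hz.mul] using Hz.mul_mem hγ (Hz.mul_mem hP hQ)
  have hz : Hz.perm ⟨false, 1, false, -1⟩ ∈
      Subgroup.closure ({s22γ, s22P, s22Q} : Set (Equiv.Perm (ℝ × ℝ))) := by
    simpa [Hz.mul] using Hz.mul_mem hQ (Hz.mul_mem hy hQ)
  have hx : Hz.perm ⟨false, 2, false, 0⟩ ∈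
      Subgroup.closure ({s22γ, s22P, s22Q} : Set (Equiv.Perm (ℝ × ℝ))) := by
    simpa [Hz.mul] using Hz.mul_mem hy hz
  -- The lattice is spanned by (2, 0) and (1, 1) in half units; since `m` and `n` have the same
  -- parity, (m, n) = ((m - n) / 2)·(2, 0) + n·(1, 1).
  refine Hz.lattice_mem (m := 0) (n := 0) ((m - n) / 2) (n) hx hy ?_ (by omega) (by omega)
  cases a <;> cases b
  · simpa [Hz.mul] using Hz.mul_mem hP hP
  · simpa [Hz.mul] using hQ
  · simpa [Hz.mul] using hP
  · simpa [Hz.mul] using Hz.mul_mem hP hQ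

theorem perm_mem_s {a b : Bool} {m n : ℤ} (h : m % 2 = 0 ∧ n % 2 = if a then 1 else 0) :
    Hz.perm ⟨a, m, b, n⟩ ∈ Subgroup.closure ({sγ, sδ, sP} : Set (Equiv.Perm (ℝ × ℝ))) := by
  have hγ : Hz.perm ⟨true, 0, true, 1⟩ ∈
      Subgroup.closure ({sγ, sδ, sP} : Set (Equiv.Perm (ℝ × ℝ))) :=
    Subgroup.subset_closure (by simp [sγ_eq])
  have hδ : Hz.perm ⟨true, 2, true, 1⟩ ∈
      Subgroup.closure ({sγ, sδ, sP} : Set (Equiv.Perm (ℝ × ℝ))) :=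
    Subgroup.subset_closure (by simp [sδ_eq])
  have hP : Hz.perm ⟨false, 0, true, 0⟩ ∈
      Subgroup.closure ({sγ, sδ, sP} : Set (Equiv.Perm (ℝ × ℝ))) :=
    Subgroup.subset_closure (by simp [sP_eq])
  have hx : Hz.perm ⟨false, 2, false, 0⟩ ∈
      Subgroup.closure ({sγ, sδ, sP} : Set (Equiv.Perm (ℝ × ℝ))) := by
    simpa [Hz.mul] using Hz.mul_mem hδ hγ
  have hz : Hz.perm ⟨true, 0, false, 1⟩ ∈
      Subgroup.closure ({sγ, sδ, sP} : Set (Equiv.Perm (ℝ × ℝ))) := by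
    simpa [Hz.mul] using Hz.mul_mem hγ hP
  have hy : Hz.perm ⟨false, 0, false, 2⟩ ∈
      Subgroup.closure ({sγ, sδ, sP} : Set (Equiv.Perm (ℝ × ℝ))) := by
    simpa [Hz.mul] using Hz.mul_mem hz hz
  refine Hz.lattice_mem (m := 0) (n := if a then 1 else 0) (m / 2) (n / 2)
    hx hy ?_ (by omega) (by omega)
  cases a <;> cases b
  · simpa [Hz.mul] using Hz.mul_mem hP hP
  · simpa [Hz.mul] using hP
  · simpa [Hz.mul] using hz
  · simpa [Hz.mul] using hγ

theorem perm_mem_x {a b : Bool} {m n : ℤ}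
    (h : m % 2 = (if a ^^ b then 1 else 0) ∧ n % 2 = if a ^^ b then 1 else 0) :
    Hz.perm ⟨a, m, b, n⟩ ∈ Subgroup.closure ({xγ, xδ, xZ} : Set (Equiv.Perm (ℝ × ℝ))) := by
  have hγ : Hz.perm ⟨true, 0, true, 0⟩ ∈
      Subgroup.closure ({xγ, xδ, xZ} : Set (Equiv.Perm (ℝ × ℝ))) :=
    Subgroup.subset_closure (by simp [xγ_eq])
  have hδ : Hz.perm ⟨true, 2, true, 0⟩ ∈
      Subgroup.closure ({xγ, xδ, xZ} : Set (Equiv.Perm (ℝ × ℝ))) :=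
    Subgroup.subset_closure (by simp [xδ_eq])
  have hZ : Hz.perm ⟨false, 1, true, 1⟩ ∈
      Subgroup.closure ({xγ, xδ, xZ} : Set (Equiv.Perm (ℝ × ℝ))) :=
    Subgroup.subset_closure (by simp [xZ_eq])
  have hx : Hz.perm ⟨false, 2, false, 0⟩ ∈
      Subgroup.closure ({xγ, xδ, xZ} : Set (Equiv.Perm (ℝ × ℝ))) := by
    simpa [Hz.mul] using Hz.mul_mem hδ hγ
  have hz : Hz.perm ⟨true, 1, false, 1⟩ ∈
      Subgroup.closure ({xγ, xδ, xZ} : Set (Equiv.Perm (ℝ × ℝ))) := by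
    simpa [Hz.mul] using Hz.mul_mem hZ hγ
  have hy : Hz.perm ⟨false, 0, false, 2⟩ ∈
      Subgroup.closure ({xγ, xδ, xZ} : Set (Equiv.Perm (ℝ × ℝ))) := by
    simpa [Hz.mul] using Hz.mul_mem hz hz
  refine Hz.lattice_mem (m := if a ^^ b then 1 else 0) (n := if a ^^ b then 1 else 0)
    (m / 2) (n / 2) hx hy ?_ (by omega) (by omega)
  cases a <;> cases b
  · simpa [Hz.mul] using Hz.mul_mem hγ hγ
  · simpa [Hz.mul] using hZ
  · simpa [Hz.mul] using hz
  · simpa [Hz.mul] using hγ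

/-- Only this implication is needed: it places the horizontal parts of a group in the plane group,
while surjectivity follows from the couplings of the generators. -/
theorem Name.perm_mem_planeGroup {N : Name} {h : Hz} (hN : N.hasHz h = true) :
    h.perm ∈ N.planeGroup := by
  cases N with
  | star2222 => exact perm_mem_s2222 (by simpa [hasHz] using hN)
  | two_star22 => exact perm_mem_s22 (by simpa [hasHz] using hN)
  | two_two_star => exact perm_mem_s (by simpa [hasHz] using hN)
  | two_two_cross => exact perm_mem_x (by simpa [hasHz] using hN)

end PlaneGroup

end Fibrifold

namespace Fibrifold

/-! ### Checking that a group given by finite data is a model of a name -/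

/-- All sign patterns satisfy `f`. -/
def allB (f : (Fin 3 → Bool) → Bool) : Bool :=
  f ![false, false, false] && f ![false, false, true] && f ![false, true, false] &&
  f ![false, true, true] && f ![true, false, false] && f ![true, false, true] &&
  f ![true, true, false] && f ![true, true, true]

theorem forall_bool_fun {p : (Fin 3 → Bool) → Prop} :
    (∀ s, p s) ↔ ∀ a b c, p ![a, b, c] := by
  refine ⟨fun h a b c => h _, fun h s => ?_⟩
  have : s = ![s 0, s 1, s 2] := by ext i; fin_cases i <;> rfl
  rw [this]
  exact h _ _ _

theorem allB_iff {f : (Fin 3 → Bool) → Bool} : allB f = true ↔ ∀ s, f s = true := by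
  rw [forall_bool_fun]
  simp [allB, Bool.forall_bool, and_assoc]

/-- The scaling factors: `2` on the axes where `z` is true. -/
noncomputable def qu (z : Fin 3 → Bool) (i : Fin 3) : ℝˣ :=
  if z i then Units.mk0 2 two_ne_zero else 1

section Check

variable (D : Dat) (z : Fin 3 → Bool)

/-- The horizontal operation `h` is coupled with `(j / 4)-` or `(j / 4)+`. -/
def cp (h : Hz) (e : Bool) (j : ℤ) : Bool :=
  D.mem ![h.a, h.b, e] ![if z 0 then h.m else 2 * h.m, if z 1 then h.n else 2 * h.n, j]

def anyQuarter (f : ℤ → Bool) : Bool := f 0 || f 1 || f 2 || f 3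

def checkMark (h : Hz) : Mark → Bool
  | .blank => anyQuarter (cp D z h true)
  | .dot => cp D z h false 0
  | .colon => cp D z h false 2

/-- The subscript of a digit, `0` if there is none. -/
def digit (a : Option (Fin 2)) : ℤ := a.elim 0 fun i => i.val

def checkGyration (h : Hz) : Option (Fin 2) → Bool
  | none => anyQuarter (cp D z h true)
  | some g => cp D z h false (2 * g.val)

def checkCorner (h k : Hz) : Option (Fin 2) → Bool
  | none => anyQuarter (cp D z (h.mul k) true) ||
      (anyQuarter (cp D z h false) && anyQuarter (cp D z k false))
  | some a => cp D z (h.mul k) false (2 * a.val)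

def checkStar (l P : Hz) (t : ℤ) : Star → Bool
  | .plain => anyQuarter (cp D z l false)
  | .bar none => anyQuarter (cp D z l true)
  | .bar (some i) => anyQuarter fun j => cp D z P true j && cp D z l true (j - (t + 2 * i.val))

def checkCross (Z : Hz) (k : ℤ) : Cross → Bool
  | .plain none => anyQuarter (cp D z Z false)
  | .plain (some i) => cp D z Z false (-k + 2 * i.val)
  | .bar => anyQuarter (cp D z Z true)

def checkCouplings : Name → Bool
  | .star2222 _ P a Q b R c S d =>
      let hP : Hz := ⟨true, 0, false, 0⟩
      let hQ : Hz := ⟨false, 0, true, 0⟩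
      let hR : Hz := ⟨true, 2, false, 0⟩
      let hS : Hz := ⟨false, 0, true, 2⟩
      checkMark D z hP P && checkMark D z hQ Q && checkMark D z hR R && checkMark D z hS S &&
      checkCorner D z hP hQ a && checkCorner D z hQ hR b && checkCorner D z hR hS c &&
      checkCorner D z hS hP d
  | .two_star22 _ g s P a Q b =>
      let γ : Hz := ⟨true, 1, true, 1⟩
      let hP : Hz := ⟨true, 0, false, 0⟩
      let hQ : Hz := ⟨false, 0, true, 0⟩
      checkGyration D z γ g && checkStar D z γ.inv hP (digit a + digit b) s &&
      checkMark D z hP P && checkMark D z hQ Q &&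
      checkCorner D z hP hQ a && checkCorner D z hQ ((γ.mul hP).mul γ.inv) b
  | .two_two_star _ g d s P =>
      let γ : Hz := ⟨true, 0, true, 1⟩
      let δ : Hz := ⟨true, 2, true, 1⟩
      let hP : Hz := ⟨false, 0, true, 0⟩
      checkGyration D z γ g && checkGyration D z δ d && checkStar D z (γ.mul δ).inv hP 0 s &&
      checkMark D z hP P
  | .two_two_cross _ g d x =>
      let γ : Hz := ⟨true, 0, true, 0⟩
      let δ : Hz := ⟨true, 2, true, 0⟩
      checkGyration D z γ g && checkGyration D z δ d &&
      checkCross D z ⟨false, 1, true, 1⟩ (digit g + digit d) x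

def scale (b : Bool) (x : ℤ) : ℤ := if b then 2 * x else x

/-- All elements have their horizontal parts in the plane group of `N`. -/
def checkParts (N : Name) : Bool :=
  allB fun s => !D.ok s || allB fun w => !D.W w ||
    (let X := scale (z 0) (D.c s 0 + 2 * (w 0).toInt)
    let Y := scale (z 1) (D.c s 1 + 2 * (w 1).toInt)
    X % 2 == 0 && Y % 2 == 0 && N.hasHz ⟨s 0, X / 2, s 1, Y / 2⟩)

def FiberKind.isInterval : FiberKind → Bool
  | .circle => false
  | .interval => true

/-- The kernel of the fibration is as `N` says. -/
def checkKernel (N : Name) : Bool :=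
  [false, true].all fun e => [0, 1, 2, 3].all fun j =>
    D.mem ![false, false, e] ![0, 0, j] == (j == 0 && (!e || N.fiber.isInterval))

def checkModel (N : Name) : Bool :=
  !z 2 && checkParts D z N && checkKernel D N && checkCouplings D z N

end Check

/-! ### Soundness of the checks -/

section Sound

variable {G : Subgroup (E3 ≃ᵃ[ℝ] E3)} {D : Dat} {z : Fin 3 → Bool}

theorem couples_of_cp (hG : Repr G (qu z) D) (hz : z 2 = false) {h : Hz} {e : Bool} {j : ℤ}
    (hc : cp D z h e j = true) : Couples G h.perm (vert e (j / 4)) := by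
  refine ⟨_, hG.mem_aff.2 hc, hasParts_iff.2 ?_⟩
  congr 1
  ext i
  fin_cases i
  -- Horizontal translations are in halves and the data in quarters: `m / 2` is `2 * m / 4` on an
  -- unscaled axis and `2 * (m / 4)` on an axis scaled by 2.
  · cases h0 : z 0 <;> simp [qu, h0] <;> ring
  · cases h1 : z 1 <;> simp [qu, h1] <;> ring
  · simp [qu, hz]

theorem exists_of_anyQuarter {f : ℤ → Bool} (h : anyQuarter f = true) : ∃ j, f j = true := by
  simp only [anyQuarter, Bool.or_eq_true] at h
  rcases h with ((h | h) | h) | h <;> exact ⟨_, h⟩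

theorem plusCoupled_of_check (hG : Repr G (qu z) D) (hz : z 2 = false) {h : Hz}
    (hc : anyQuarter (cp D z h false) = true) : PlusCoupled G h.perm :=
  let ⟨_, hj⟩ := exists_of_anyQuarter hc
  ⟨_, couples_of_cp hG hz hj⟩

theorem minusCoupled_of_check (hG : Repr G (qu z) D) (hz : z 2 = false) {h : Hz}
    (hc : anyQuarter (cp D z h true) = true) : MinusCoupled G h.perm :=
  let ⟨_, hj⟩ := exists_of_anyQuarter hc
  ⟨_, couples_of_cp hG hz hj⟩

theorem couples_plus_of_cp (hG : Repr G (qu z) D) (hz : z 2 = false) {h : Hz} {j : ℤ} {c : ℝ}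
    (hc : cp D z h false j = true) (e : (j : ℝ) / 4 = c) : Couples G h.perm (plus c) :=
  e ▸ couples_of_cp hG hz hc

theorem couples_minus_of_cp (hG : Repr G (qu z) D) (hz : z 2 = false) {h : Hz} {j : ℤ} {c : ℝ}
    (hc : cp D z h true j = true) (e : (j : ℝ) / 4 = c) : Couples G h.perm (minus c) :=
  e ▸ couples_of_cp hG hz hc

theorem half_eq_digit (a : Option (Fin 2)) : half a = (digit a : ℝ) / 2 := by
  cases a <;> simp [half, digit]

theorem mark_holds (hG : Repr G (qu z) D) (hz : z 2 = false) {h : Hz} {m : Mark}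
    (hc : checkMark D z h m = true) : m.Holds G h.perm := by
  cases m with
  | blank => exact minusCoupled_of_check hG hz hc
  | dot => exact couples_plus_of_cp hG hz hc (by simp)
  | colon => exact couples_plus_of_cp hG hz hc (by norm_num)

theorem gyration_holds (hG : Repr G (qu z) D) (hz : z 2 = false) {h : Hz} {g : Option (Fin 2)}
    (hc : checkGyration D z h g = true) : GyrationHolds G h.perm g := by
  cases g with
  | none => exact minusCoupled_of_check hG hz hc
  | some g => exact couples_plus_of_cp hG hz hc (by simp [half]; ring)

theorem corner_holds (hG : Repr G (qu z) D) (hz : z 2 = false) {h k : Hz} {a : Option (Fin 2)}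
    (hc : checkCorner D z h k a = true) : CornerHolds G h.perm k.perm a := by
  cases a with
  | none =>
    simp only [checkCorner, Bool.or_eq_true, Bool.and_eq_true] at hc
    rw [CornerHolds, Hz.perm_mul]
    exact hc.imp (minusCoupled_of_check hG hz) fun h =>
      ⟨plusCoupled_of_check hG hz h.1, plusCoupled_of_check hG hz h.2⟩
  | some a =>
    rw [CornerHolds, Hz.perm_mul]
    exact couples_plus_of_cp hG hz hc (by simp [half]; ring)

theorem star_holds (hG : Repr G (qu z) D) (hz : z 2 = false) {l P : Hz} {t : ℤ} {s : Star}
    (hc : checkStar D z l P t s = true) : s.Holds G l.perm P.perm ((t : ℝ) / 2) := by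
  match s with
  | .plain => exact plusCoupled_of_check hG hz hc
  | .bar none => exact minusCoupled_of_check hG hz hc
  | .bar (some i) =>
    rw [checkStar] at hc
    obtain ⟨j, hj⟩ := exists_of_anyQuarter hc
    rw [Bool.and_eq_true] at hj
    -- In quarters the prescribed difference is `t + 2 * i`, since `(t / 2 + i) / 2 = (t + 2 * i) /
    -- 4`.
    refine ⟨_, _, couples_minus_of_cp hG hz hj.1 rfl, couples_minus_of_cp hG hz hj.2 rfl, ?_⟩
    push_cast
    ring

theorem cross_holds (hG : Repr G (qu z) D) (hz : z 2 = false) {Z : Hz} {k : ℤ} {x : Cross}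
    (hc : checkCross D z Z k x = true) : x.Holds G Z.perm ((k : ℝ) / 2) := by
  match x with
  | .plain none => exact plusCoupled_of_check hG hz hc
  | .plain (some i) => exact couples_plus_of_cp hG hz hc (by push_cast; ring)
  | .bar => exact minusCoupled_of_check hG hz hc

theorem couplingsHold_of_check (hG : Repr G (qu z) D) (hz : z 2 = false) {N : Name}
    (hc : checkCouplings D z N = true) : N.CouplingsHold G := by
  cases N with
  | star2222 =>
    simp only [checkCouplings, Bool.and_eq_true] at hc
    obtain ⟨⟨⟨⟨⟨⟨⟨h1, h2⟩, h3⟩, h4⟩, h5⟩, h6⟩, h7⟩, h8⟩ := hc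
    rw [Name.CouplingsHold, s2222P_eq, s2222Q_eq, s2222R_eq, s2222S_eq]
    exact ⟨mark_holds hG hz h1, mark_holds hG hz h2, mark_holds hG hz h3, mark_holds hG hz h4,
      corner_holds hG hz h5, corner_holds hG hz h6, corner_holds hG hz h7, corner_holds hG hz h8⟩
  | two_star22 f g s P a Q b =>
    simp only [checkCouplings, Bool.and_eq_true] at hc
    obtain ⟨⟨⟨⟨⟨h1, h2⟩, h3⟩, h4⟩, h5⟩, h6⟩ := hc
    rw [Name.CouplingsHold, s22P_eq, s22Q_eq, s22γ_eq, Hz.perm_inv, Hz.perm_mul, Hz.perm_mul,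
      show half a + half b = ((digit a + digit b : ℤ) : ℝ) / 2 by
        rw [half_eq_digit, half_eq_digit]; push_cast; ring]
    exact ⟨gyration_holds hG hz h1, star_holds hG hz h2, mark_holds hG hz h3, mark_holds hG hz h4,
      corner_holds hG hz h5, corner_holds hG hz h6⟩
  | two_two_star f g d s P =>
    simp only [checkCouplings, Bool.and_eq_true] at hc
    obtain ⟨⟨⟨h1, h2⟩, h3⟩, h4⟩ := hc
    rw [Name.CouplingsHold, sγ_eq, sδ_eq, sP_eq, Hz.perm_mul, Hz.perm_inv]
    have h3' := star_holds hG hz h3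
    rw [Int.cast_zero, zero_div] at h3'
    exact ⟨gyration_holds hG hz h1, gyration_holds hG hz h2, h3', mark_holds hG hz h4⟩
  | two_two_cross f g d x =>
    simp only [checkCouplings, Bool.and_eq_true] at hc
    obtain ⟨⟨h1, h2⟩, h3⟩ := hc
    rw [Name.CouplingsHold, xγ_eq, xδ_eq, xZ_eq,
      show half g + half d = ((digit g + digit d : ℤ) : ℝ) / 2 by
        rw [half_eq_digit, half_eq_digit]; push_cast; ring]
    exact ⟨gyration_holds hG hz h1, gyration_holds hG hz h2, cross_holds hG hz h3⟩

/-- Every horizontal operation of the plane group is coupled with something. -/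
theorem Name.CouplingsHold.onto {N : Name} (hN : N.CouplingsHold G) :
    ∀ h ∈ N.planeGroup, ∃ v, Couples G h v := by
  have mark : ∀ {P m}, Mark.Holds G P m → ∃ v, Couples G P v := fun {P m} h => by
    cases m
    · obtain ⟨c, hc⟩ := h; exact ⟨_, hc⟩
    · exact ⟨_, h⟩
    · exact ⟨_, h⟩
  have gyr : ∀ {γ g}, GyrationHolds G γ g → ∃ v, Couples G γ v := fun {γ g} h => by
    cases g
    · obtain ⟨c, hc⟩ := h; exact ⟨_, hc⟩
    · exact ⟨_, h⟩
  have cross : ∀ {Z k x}, Cross.Holds G Z k x → ∃ v, Couples G Z v := fun {Z k x} h => by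
    match x with
    | .plain none => obtain ⟨c, hc⟩ := h; exact ⟨_, hc⟩
    | .plain (some i) => exact ⟨_, h⟩
    | .bar => obtain ⟨c, hc⟩ := h; exact ⟨_, hc⟩
  -- The horizontal operations coupled with something form a subgroup, so it suffices to look at
  -- generators.
  have key : ∀ T : Set (Equiv.Perm (ℝ × ℝ)), (∀ h ∈ T, ∃ v, Couples G h v) →
      ∀ h ∈ Subgroup.closure T, ∃ v, Couples G h v := fun T hT h hh => by
    induction hh using Subgroup.closure_induction with
    | mem x hx => exact hT x hx
    | one => exact ⟨1, couples_one⟩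
    | mul x y _ _ hx hy =>
      obtain ⟨v, hv⟩ := hx
      obtain ⟨w, hw⟩ := hy
      exact ⟨_, hv.mul hw⟩
    | inv x _ hx =>
      obtain ⟨v, hv⟩ := hx
      exact ⟨_, hv.inv⟩
  cases N with
  | star2222 =>
    obtain ⟨h1, h2, h3, h4, -⟩ := hN
    refine key _ ?_
    rintro h (rfl | rfl | rfl | rfl)
    exacts [mark h1, mark h2, mark h3, mark h4]
  | two_star22 =>
    obtain ⟨h1, -, h3, h4, -⟩ := hN
    refine key _ ?_
    rintro h (rfl | rfl | rfl)
    exacts [gyr h1, mark h3, mark h4]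
  | two_two_star =>
    obtain ⟨h1, h2, -, h4⟩ := hN
    refine key _ ?_
    rintro h (rfl | rfl | rfl)
    exacts [gyr h1, gyr h2, mark h4]
  | two_two_cross =>
    obtain ⟨h1, h2, h3⟩ := hN
    refine key _ ?_
    rintro h (rfl | rfl | rfl)
    exacts [gyr h1, gyr h2, cross h3]

theorem hasHz_congr {N : Name} {a b : Bool} {m n m' n' : ℤ} (hm : m % 2 = m' % 2)
    (hn : n % 2 = n' % 2) : N.hasHz ⟨a, m, b, n⟩ = N.hasHz ⟨a, m', b, n'⟩ := by
  cases N <;> simp [Name.hasHz, hm, hn]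

/-- Splits a translation part into the representative, a centring vector and an integral vector;
only the first two, finitely many, have to be checked. -/
theorem Dat.exists_of_mem {s : Fin 3 → Bool} {T : Fin 3 → ℤ} (h : D.mem s T = true) :
    ∃ w, D.W w = true ∧ ∃ k : Fin 3 → ℤ, ∀ i, T i = D.c s i + 2 * (w i).toInt + 4 * k i := by
  obtain ⟨h1, h2⟩ := latMem_iff.1 (mem_iff.1 h).2
  refine ⟨_, h2, fun i => (T i - D.c s i) / 4, fun i => ?_⟩
  have := h1 i
  change T i = D.c s i + 2 * ((T i - D.c s i) % 4 == 2).toInt + 4 * ((T i - D.c s i) / 4)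
  cases h4 : ((T i - D.c s i) % 4 == 2)
  · have := beq_eq_false_iff_ne.1 h4
    simp only [Bool.toInt_false]
    omega
  · have := beq_iff_eq.1 h4
    simp only [Bool.toInt_true]
    omega

theorem parts_of_check (hG : Repr G (qu z) D) (hz : z 2 = false) {N : Name}
    (hc : checkParts D z N = true) : ∀ g ∈ G, ∃ h ∈ N.planeGroup, ∃ c,
      HasParts g h (plus c) ∨ HasParts g h (minus c) := by
  intro g hg
  obtain ⟨s, T, hm, rfl⟩ := (hG g).1 hg
  obtain ⟨w, hw, k, hT⟩ := Dat.exists_of_mem hm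
  have h1 := allB_iff.1 hc s
  rw [(Dat.mem_iff.1 hm).1, Bool.not_true, Bool.false_or] at h1
  have h2 := allB_iff.1 h1 w
  simp only [hw, Bool.not_true, Bool.false_or, Bool.and_eq_true, beq_iff_eq] at h2
  obtain ⟨⟨hX, hY⟩, hN⟩ := h2
  have e : ∀ i, scale (z i) (T i) =
      scale (z i) (D.c s i + 2 * (w i).toInt) + 4 * scale (z i) (k i) := by
    intro i
    rw [hT]
    unfold scale
    split <;> ring
  have hX' := e 0
  have hY' := e 1
  -- Integral translations change the scaled entries by multiples of 4, hence their halves by even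
  -- numbers, and the plane group test depends only on parities.
  rw [hasHz_congr (m' := scale (z 0) (T 0) / 2) (n' := scale (z 1) (T 1) / 2)
    (by omega) (by omega)] at hN
  refine ⟨_, Name.perm_mem_planeGroup hN, (T 2 : ℝ) / 4, ?_⟩
  have r : ∀ i, (qu z i : ℝ) * T i = ((scale (z i) (T i) : ℤ) : ℝ) := fun i => by
    unfold qu scale
    split <;> simp
  have key : HasParts (aff s fun i => (qu z i : ℝ) * (T i : ℝ) / 4)
      (Hz.perm ⟨s 0, scale (z 0) (T 0) / 2, s 1, scale (z 1) (T 1) / 2⟩)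
        (vert (s 2) (T 2 / 4)) := by
    rw [Hz.perm, hasParts_iff, aff_inj]
    constructor
    · ext i; fin_cases i <;> rfl
    · have c : ∀ x : ℤ, x % 2 = 0 → ((x / 2 : ℤ) : ℝ) = (x : ℝ) / 2 := fun x hx => by
        rw [Int.cast_div (Int.dvd_of_emod_eq_zero hx) (by norm_num)]
        norm_num
      ext i
      fin_cases i
      · simp only [Fin.zero_eta, r]
        simp only [Matrix.cons_val_zero]
        rw [c _ (by omega)]
        ring
      · simp only [Fin.mk_one, r]
        simp only [Matrix.cons_val_one, Matrix.cons_val_zero]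
        rw [c _ (by omega)]
        ring
      · simp [qu, hz]
  cases h : s 2
  · exact .inl (by simpa [vert, h] using key)
  · exact .inr (by simpa [vert, h] using key)

/-- The check covers the vertical translations 0, 1, 2, 3 in quarters, and these represent all of
them modulo the integral ones. -/
theorem mem_vertical_of_check {N : Name} (hc : checkKernel D N = true) (e : Bool) (j : ℤ) :
    D.mem ![false, false, e] ![0, 0, j] = (j % 4 == 0 && (!e || N.fiber.isInterval)) := by
  have h : D.mem ![false, false, e] ![0, 0, j] = D.mem ![false, false, e] ![0, 0, j % 4] :=
    Dat.mem_congr fun i => by fin_cases i <;> simp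
  rw [h]
  simp only [checkKernel, List.all_cons, List.all_nil, Bool.and_true, Bool.and_eq_true,
    beq_iff_eq] at hc
  obtain ⟨⟨h0, h1, h2, h3⟩, h0', h1', h2', h3'⟩ := hc
  have : j % 4 = 0 ∨ j % 4 = 1 ∨ j % 4 = 2 ∨ j % 4 = 3 := by omega
  rcases this with h | h | h | h <;> rw [h] <;> cases e <;> assumption

theorem kernel_of_check (hG : Repr G (qu z) D) (hz : z 2 = false) {N : Name}
    (hc : checkKernel D N = true) (v : Equiv.Perm ℝ) : Couples G 1 v ↔ v ∈ N.fiber.kernel := by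
  have hk : v ∈ N.fiber.kernel ↔ ∃ (e : Bool) (n : ℤ), v = vert e n ∧
      (!e || N.fiber.isInterval) = true := by
    cases N.fiber <;> simp [FiberKind.kernel, FiberKind.isInterval, vert, exists_or]
  rw [hk]
  constructor
  · rintro ⟨g, hg, hp⟩
    obtain ⟨s, T, hm, rfl⟩ := (hG g).1 hg
    have e3 : (aff s fun i => (qu z i : ℝ) * (T i : ℝ) / 4) = aff ![s 0, s 1, s 2]
        ![(qu z 0 : ℝ) * (T 0 : ℝ) / 4, (qu z 1 : ℝ) * (T 1 : ℝ) / 4,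
          (qu z 2 : ℝ) * (T 2 : ℝ) / 4] := by
      congr 1 <;> (ext i; fin_cases i <;> rfl)
    obtain ⟨h1, rfl⟩ := hp.parts_unique (hasParts_iff.2 e3)
    rw [← Hz.perm_one, Hz.perm, horiz_inj] at h1
    obtain ⟨h1, h2, h3, h4⟩ := h1
    have hT : ∀ i, 0 = (qu z i : ℝ) * (T i : ℝ) / 4 → T i = 0 := fun i h => by
      have := (qu z i).ne_zero
      field_simp at h
      simpa [eq_comm] using h
    have hT0 := hT 0 (by simpa using h2)
    have hT1 := hT 1 (by simpa using h4)
    have hs : s = ![false, false, s 2] := by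
      ext i; fin_cases i
      exacts [h1.symm, h3.symm, rfl]
    have hT' : T = ![0, 0, T 2] := by
      ext i; fin_cases i
      exacts [hT0, hT1, rfl]
    rw [hs, hT', mem_vertical_of_check hc, Bool.and_eq_true, beq_iff_eq] at hm
    refine ⟨s 2, T 2 / 4, ?_, hm.2⟩
    rw [Int.cast_div (Int.dvd_of_emod_eq_zero hm.1) (by norm_num)]
    simp [qu, hz]
  · rintro ⟨e, n, rfl, h⟩
    have hm : D.mem ![false, false, e] ![0, 0, 4 * n] = true := by
      rw [mem_vertical_of_check hc]
      simp [h]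
    refine ⟨_, hG.mem_aff.2 hm, ?_⟩
    rw [← Hz.perm_one, Hz.perm, hasParts_iff]
    congr 1
    ext i
    fin_cases i <;> simp [qu, hz]

theorem isModel_of_check (hG : Repr G (qu z) D) {N : Name} (hc : checkModel D z N = true) :
    IsModel G N := by
  simp only [checkModel, Bool.and_eq_true, Bool.not_eq_true'] at hc
  obtain ⟨⟨⟨hz, h1⟩, h2⟩, h3⟩ := hc
  have := couplingsHold_of_check hG hz h3
  exact ⟨parts_of_check hG hz h1, this.onto, kernel_of_check hG hz h2, this⟩

end Sound

end Fibrifold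

namespace Fibrifold

/-! ### Models of a name are unique -/

section Unique

variable {G G' : Subgroup (E3 ≃ᵃ[ℝ] E3)} {N : Name}

/-- The horizontal operations coupled in `G` and, after conjugation, in `G'` with the same
vertical operation. -/
def commonSubgroup (G G' : Subgroup (E3 ≃ᵃ[ℝ] E3)) (α : Equiv.Perm (ℝ × ℝ)) (σ : Equiv.Perm ℝ) :
    Subgroup (Equiv.Perm (ℝ × ℝ)) where
  carrier := {h | ∃ w, Couples G h w ∧ Couples G' (α * h * α⁻¹) (σ * w * σ⁻¹)}
  one_mem' := ⟨1, couples_one, by simpa using couples_one⟩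
  mul_mem' := by
    rintro h k ⟨w, c1, c2⟩ ⟨x, d1, d2⟩
    exact ⟨w * x, c1.mul d1, by simpa [mul_assoc] using c2.mul d2⟩
  inv_mem' := by
    rintro h ⟨w, c1, c2⟩
    exact ⟨w⁻¹, c1.inv, by simpa [mul_assoc] using c2.inv⟩

/-- Two vertical operations coupled with the same horizontal one differ by an element of the kernel,
and both models have the same kernel, preserved by `σ`. Hence one matching coupling for each
horizontal operation makes the conjugate of `G` equal to `G'`. As the matching operations form a
subgroup, generators suffice. -/
theorem conj_eq_of_common (hG : IsModel G N) (hG' : IsModel G' N) {φ : E3 ≃ᵃ[ℝ] E3}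
    {α : Equiv.Perm (ℝ × ℝ)} {σ : Equiv.Perm ℝ} (hφ : HasParts φ α σ)
    (hα : ∀ h ∈ N.planeGroup, α⁻¹ * h * α ∈ N.planeGroup)
    (hσ : ∀ v ∈ N.fiber.kernel, σ * v * σ⁻¹ ∈ N.fiber.kernel ∧ σ⁻¹ * v * σ ∈ N.fiber.kernel)
    (hc : N.planeGroup ≤ commonSubgroup G G' α σ) : conj φ G = G' := by
  have parts : ∀ {K : Subgroup (E3 ≃ᵃ[ℝ] E3)}, IsModel K N → ∀ g ∈ K, ∃ h ∈ N.planeGroup, ∃ v,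
      HasParts g h v := fun {K} hK g hg => by
    obtain ⟨h, hh, c, hp | hp⟩ := hK.parts g hg
    exacts [⟨h, hh, _, hp⟩, ⟨h, hh, _, hp⟩]
  apply le_antisymm
  · rintro _ ⟨g, hg, rfl⟩
    obtain ⟨h, hh, v, hp⟩ := parts hG g hg
    obtain ⟨w, c1, c2⟩ := hc hh
    have c3 : Couples G 1 (v * w⁻¹) := by
      simpa using Couples.mul (G := G) ⟨g, hg, hp⟩ c1.inv
    have c4 := (hG'.kernel _).2 (hσ _ ((hG.kernel _).1 c3)).1
    refine (c4.mul c2).mem ?_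
    have := (hφ.mul hp).mul hφ.inv
    simpa [mul_assoc] using this
  · intro g hg
    obtain ⟨h, hh, v, hp⟩ := parts hG' g hg
    obtain ⟨w, c1, c2⟩ := hc (hα h hh)
    have c3 : Couples G' 1 (v * (σ * w * σ⁻¹)⁻¹) := by
      have := Couples.mul (G := G') ⟨g, hg, hp⟩ c2.inv
      simpa [mul_assoc] using this
    have c4 := (hG.kernel _).2 (hσ _ ((hG'.kernel _).1 c3)).2
    rw [mem_conj_iff]
    refine (c4.mul c1).mem ?_
    have := (hφ.inv.mul hp).mul hφ
    simpa [mul_assoc] using this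

theorem Couples.shift (hG : IsModel G N) {h : Equiv.Perm (ℝ × ℝ)} {e : Bool} {x y : ℝ} {n : ℤ}
    (c : Couples G h (vert e x)) (hn : x - y = n) : Couples G h (vert e y) := by
  have : Couples G 1 (vert false (-n : ℤ)) := by
    rw [hG.kernel]
    cases N.fiber
    · exact ⟨-n, rfl⟩
    · exact ⟨-n, .inl rfl⟩
  have := this.mul c
  rw [vert_mul] at this
  convert this using 1
  · simp
  · congr 1
    · simp
    · push_cast
      rw [← hn]
      simp

/-- The quotient of the two couplings lies in the kernel, whose translations are integral for both
kinds of fiber. -/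
theorem Couples.sub_int (hG : IsModel G N) {h : Equiv.Perm (ℝ × ℝ)} {x y : ℝ}
    (c : Couples G h (plus x)) (d : Couples G h (plus y)) : ∃ n : ℤ, x - y = n := by
  have hv : plus x * (plus y)⁻¹ = vert false (x - y) := by
    rw [mul_inv_eq_iff_eq_mul, plus_eq_vert, plus_eq_vert, vert_mul]
    simp
  have := c.mul d.inv
  rw [mul_inv_cancel, hv, hG.kernel] at this
  cases hN : N.fiber with
  | circle =>
    rw [hN] at this
    obtain ⟨n, hn⟩ := this
    exact ⟨n, (vert_inj.1 (hn.trans (plus_eq_vert _))).2⟩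
  | interval =>
    rw [hN] at this
    obtain ⟨n, hn | hn⟩ := this
    · exact ⟨n, (vert_inj.1 (hn.trans (plus_eq_vert _))).2⟩
    · exact absurd (vert_inj.1 (hn.trans (minus_eq_vert _))).1 (by simp)

/-- Shift of the vertical axis. -/
noncomputable def vshift (v : ℝ) : E3 ≃ᵃ[ℝ] E3 := aff ![false, false, false] ![0, 0, v]

theorem hasParts_vshift (v : ℝ) : HasParts (vshift v) 1 (plus v) := by
  rw [← Hz.perm_one, Hz.perm, plus_eq_vert, hasParts_iff]
  simp [vshift]

theorem plus_conj_plus (v c : ℝ) : plus v * plus c * (plus v)⁻¹ = plus c := by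
  rw [mul_inv_eq_iff_eq_mul]
  simp only [plus_eq_vert, vert_mul]
  simp [add_comm]

theorem plus_conj_minus (v c : ℝ) : plus v * minus c * (plus v)⁻¹ = minus (c + 2 * v) := by
  rw [mul_inv_eq_iff_eq_mul]
  simp only [plus_eq_vert, minus_eq_vert, vert_mul]
  congr 1
  simp
  ring

theorem minus_mul_minus_inv (p q : ℝ) : minus p * (minus q)⁻¹ = plus (p - q) := by
  rw [mul_inv_eq_iff_eq_mul]
  simp only [plus_eq_vert, minus_eq_vert, vert_mul]
  simp

variable {h k : Equiv.Perm (ℝ × ℝ)} {v : ℝ}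

theorem mem_common_of_plus {c : ℝ} (h1 : Couples G h (plus c)) (h2 : Couples G' h (plus c)) :
    h ∈ commonSubgroup G G' 1 (plus v) :=
  ⟨plus c, h1, by simpa [plus_conj_plus] using h2⟩

/-- Shifting the vertical axis by `v` turns `c-` into `(c + 2 v)-`, so half the difference of the
constants aligns one minus-coupled operation. -/
theorem exists_common_of_minus (h1 : MinusCoupled G h) (h2 : MinusCoupled G' h) :
    ∃ v, h ∈ commonSubgroup G G' 1 (plus v) := by
  obtain ⟨c, h1⟩ := h1
  obtain ⟨c', h2⟩ := h2
  refine ⟨(c' - c) / 2, minus c, h1, ?_⟩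
  rw [plus_conj_minus, one_mul, inv_one, mul_one]
  convert h2 using 2
  ring

/-- The mark determines the coupling. -/
def Mark.isDotted : Mark → Bool
  | .blank => false
  | _ => true

def Star.isSubscripted : Star → Bool
  | .bar (some _) => true
  | _ => false

theorem Mark.Holds.mem_common {m : Mark} (hm : m.isDotted = true) (h1 : m.Holds G h)
    (h2 : m.Holds G' h) : h ∈ commonSubgroup G G' 1 (plus v) := by
  cases m
  · simp [isDotted] at hm
  · exact mem_common_of_plus h1 h2
  · exact mem_common_of_plus h1 h2

/-- In an interval fibration a general shift would move the reflections `n-` of the kernel, so `v =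
0` is used and the mark must already determine the coupling. -/
theorem Mark.Holds.exists_common {m : Mark} {f : FiberKind}
    (hm : (m.isDotted || !f.isInterval) = true) (h1 : m.Holds G h) (h2 : m.Holds G' h) :
    ∃ v, (f.isInterval = true → v = 0) ∧ h ∈ commonSubgroup G G' 1 (plus v) := by
  by_cases hd : m.isDotted = true
  · exact ⟨0, fun _ => rfl, h1.mem_common hd h2⟩
  · cases m
    · obtain ⟨v, hv⟩ := exists_common_of_minus h1 h2
      exact ⟨v, fun hf => by simp [isDotted, hf] at hm, hv⟩
    · exact absurd rfl hd
    · exact absurd rfl hd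

theorem GyrationHolds.mem_common {g : Option (Fin 2)} (hg : g.isSome = true)
    (h1 : GyrationHolds G h g) (h2 : GyrationHolds G' h g) :
    h ∈ commonSubgroup G G' 1 (plus v) := by
  cases g
  · simp at hg
  · exact mem_common_of_plus h1 h2

theorem CornerHolds.mem_common {a : Option (Fin 2)} (ha : a.isSome = true)
    (h1 : CornerHolds G h k a) (h2 : CornerHolds G' h k a) :
    h * k ∈ commonSubgroup G G' 1 (plus v) := by
  cases a
  · simp at ha
  · exact mem_common_of_plus h1 h2

/-- The subscript fixes the difference of two minus-couplings, i.e. the plus-coupling of the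
quotient of the two generators. -/
theorem Star.Holds.mem_common {s : Star} {t : ℝ} (hs : s.isSubscripted = true)
    (h1 : s.Holds G h k t) (h2 : s.Holds G' h k t) :
    k * h⁻¹ ∈ commonSubgroup G G' 1 (plus v) := by
  match s with
  | .plain => simp [isSubscripted] at hs
  | .bar none => simp [isSubscripted] at hs
  | .bar (some i) =>
    obtain ⟨p, q, c1, c2, e⟩ := h1
    obtain ⟨p', q', d1, d2, e'⟩ := h2
    have c := c1.mul c2.inv
    have d := d1.mul d2.inv
    rw [minus_mul_minus_inv, e] at c
    rw [minus_mul_minus_inv, e'] at d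
    exact mem_common_of_plus c d

/-- The second mark is determined by itself or by the corner digit before it. -/
theorem mem_common_of_corner {P : Equiv.Perm (ℝ × ℝ)} {m : Mark} {a : Option (Fin 2)}
    (hm : (m.isDotted || a.isSome) = true) (hP : P ∈ commonSubgroup G G' 1 (plus v))
    (h1 : m.Holds G h) (h2 : m.Holds G' h) (c1 : CornerHolds G P h a) (c2 : CornerHolds G' P h a) :
    h ∈ commonSubgroup G G' 1 (plus v) := by
  rw [Bool.or_eq_true] at hm
  rcases hm with hm | hm
  · exact h1.mem_common hm h2
  · exact (Subgroup.mul_mem_cancel_left _ hP).1 (c1.mem_common hm c2)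

theorem mem_common_of_star {l P : Equiv.Perm (ℝ × ℝ)} {m : Mark} {s : Star} {t : ℝ}
    (hm : (m.isDotted || s.isSubscripted) = true) (hl : l ∈ commonSubgroup G G' 1 (plus v))
    (h1 : m.Holds G P) (h2 : m.Holds G' P) (c1 : s.Holds G l P t) (c2 : s.Holds G' l P t) :
    P ∈ commonSubgroup G G' 1 (plus v) := by
  rw [Bool.or_eq_true] at hm
  rcases hm with hm | hm
  · exact h1.mem_common hm h2
  · exact (Subgroup.mul_mem_cancel_right _ (Subgroup.inv_mem _ hl)).1 (c1.mem_common hm c2)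

theorem conj_vshift_eq (hG : IsModel G N) (hG' : IsModel G' N)
    (hv : N.fiber.isInterval = true → v = 0)
    (hc : N.planeGroup ≤ commonSubgroup G G' 1 (plus v)) :
    ∃ φ, conj φ G = G' ∧ mapDir φ (axis 2) = axis 2 := by
  refine ⟨vshift v, conj_eq_of_common hG hG' (hasParts_vshift v) (by simp) ?_ hc,
    mapDir_aff_axis 2⟩
  have h0 : plus 0 = 1 := by ext z; simp [plus]
  cases hN : N.fiber
  · rintro _ ⟨n, rfl⟩
    refine ⟨⟨n, plus_conj_plus _ _⟩, n, ?_⟩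
    rw [mul_assoc, inv_mul_eq_iff_eq_mul]
    simp [plus_eq_vert, vert_mul, add_comm]
  · rw [hv (by rw [hN]; rfl), h0]
    simp

/-- The couplings of all generators are determined by the name, up to a vertical shift. -/
def Name.isDetermined : Name → Bool
  | .star2222 f P a Q b R c S _ => (P.isDotted || !f.isInterval) && (Q.isDotted || a.isSome) &&
      (R.isDotted || b.isSome) && (S.isDotted || c.isSome)
  | .two_star22 f (some _) _ P a Q _ => (P.isDotted || !f.isInterval) && (Q.isDotted || a.isSome)
  | .two_star22 f none s P a Q _ => !f.isInterval && (P.isDotted || s.isSubscripted) &&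
      (Q.isDotted || a.isSome)
  | .two_two_star f (some _) (some _) _ P => P.isDotted || !f.isInterval
  | .two_two_star f (some _) none s P => !f.isInterval && (P.isDotted || s.isSubscripted)
  | .two_two_star _ none _ _ _ => false
  | .two_two_cross _ (some _) (some _) (.plain (some _)) => true
  | .two_two_cross f (some _) (some _) .bar => !f.isInterval
  | _ => false

/-- At most one vertical shift is available. It aligns a first minus-coupled generator; the other
generators follow, either because their plus-coupling is named or because a corner digit or star
subscript names their quotient with a generator already aligned. -/
theorem IsModel.unique_of_determined (hG : IsModel G N) (hG' : IsModel G' N)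
    (hN : N.isDetermined = true) : ∃ φ, conj φ G = G' ∧ mapDir φ (axis 2) = axis 2 := by
  suffices h : ∃ v, (N.fiber.isInterval = true → v = 0) ∧
      N.planeGroup ≤ commonSubgroup G G' 1 (plus v) by
    obtain ⟨v, hv, hc⟩ := h
    exact conj_vshift_eq hG hG' hv hc
  have c1 := hG.couplings
  have c2 := hG'.couplings
  match N with
  | .star2222 f P a Q b R c S d =>
    simp only [Name.isDetermined, Bool.and_eq_true] at hN
    obtain ⟨⟨⟨n1, n2⟩, n3⟩, n4⟩ := hN
    obtain ⟨p1, p2, p3, p4, p5, p6, p7, -⟩ := c1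
    obtain ⟨q1, q2, q3, q4, q5, q6, q7, -⟩ := c2
    obtain ⟨v, hv, hP⟩ := p1.exists_common n1 q1
    have hQ := mem_common_of_corner n2 hP p2 q2 p5 q5
    have hR := mem_common_of_corner n3 hQ p3 q3 p6 q6
    have hS := mem_common_of_corner n4 hR p4 q4 p7 q7
    refine ⟨v, hv, (Subgroup.closure_le _).2 ?_⟩
    rintro h (rfl | rfl | rfl | rfl)
    exacts [hP, hQ, hR, hS]
  | .two_star22 f (some g) s P a Q b =>
    simp only [Name.isDetermined, Bool.and_eq_true] at hN
    obtain ⟨n1, n2⟩ := hN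
    obtain ⟨p1, p2, p3, p4, p5, -⟩ := c1
    obtain ⟨q1, q2, q3, q4, q5, -⟩ := c2
    obtain ⟨v, hv, hP⟩ := p3.exists_common n1 q3
    have hQ := mem_common_of_corner n2 hP p4 q4 p5 q5
    refine ⟨v, hv, (Subgroup.closure_le _).2 ?_⟩
    rintro h (rfl | rfl | rfl)
    exacts [p1.mem_common rfl q1, hP, hQ]
  | .two_star22 f none s P a Q b =>
    simp only [Name.isDetermined, Bool.and_eq_true, Bool.not_eq_true'] at hN
    obtain ⟨⟨n1, n2⟩, n3⟩ := hN
    obtain ⟨p1, p2, p3, p4, p5, -⟩ := c1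
    obtain ⟨q1, q2, q3, q4, q5, -⟩ := c2
    obtain ⟨v, hγ⟩ := exists_common_of_minus p1 q1
    have hP := mem_common_of_star n2 (Subgroup.inv_mem _ hγ) p3 q3 p2 q2
    have hQ := mem_common_of_corner n3 hP p4 q4 p5 q5
    refine ⟨v, fun hf => absurd (n1.symm.trans hf) (by simp), (Subgroup.closure_le _).2 ?_⟩
    rintro h (rfl | rfl | rfl)
    exacts [hγ, hP, hQ]
  | .two_two_star f (some g) (some d) s P =>
    obtain ⟨p1, p2, p3, p4⟩ := c1
    obtain ⟨q1, q2, q3, q4⟩ := c2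
    obtain ⟨v, hv, hP⟩ := p4.exists_common hN q4
    refine ⟨v, hv, (Subgroup.closure_le _).2 ?_⟩
    rintro h (rfl | rfl | rfl)
    exacts [p1.mem_common rfl q1, p2.mem_common rfl q2, hP]
  | .two_two_star f (some g) none s P =>
    simp only [Name.isDetermined, Bool.and_eq_true, Bool.not_eq_true'] at hN
    obtain ⟨n1, n2⟩ := hN
    obtain ⟨p1, p2, p3, p4⟩ := c1
    obtain ⟨q1, q2, q3, q4⟩ := c2
    obtain ⟨v, hδ⟩ := exists_common_of_minus p2 q2
    have hγ := p1.mem_common (v := v) rfl q1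
    have hP := mem_common_of_star n2 (Subgroup.inv_mem _ (Subgroup.mul_mem _ hγ hδ)) p4 q4 p3 q3
    refine ⟨v, fun hf => absurd (n1.symm.trans hf) (by simp), (Subgroup.closure_le _).2 ?_⟩
    rintro h (rfl | rfl | rfl)
    exacts [hγ, hδ, hP]
  | .two_two_cross f (some g) (some d) (.plain (some i)) =>
    obtain ⟨p1, p2, p3⟩ := c1
    obtain ⟨q1, q2, q3⟩ := c2
    refine ⟨0, fun _ => rfl, (Subgroup.closure_le _).2 ?_⟩
    rintro h (rfl | rfl | rfl)
    exacts [p1.mem_common rfl q1, p2.mem_common rfl q2, mem_common_of_plus p3 q3]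
  | .two_two_cross f (some g) (some d) .bar =>
    simp only [Name.isDetermined, Bool.not_eq_true'] at hN
    obtain ⟨p1, p2, p3⟩ := c1
    obtain ⟨q1, q2, q3⟩ := c2
    obtain ⟨v, hZ⟩ := exists_common_of_minus p3 q3
    refine ⟨v, fun hf => absurd (hN.symm.trans hf) (by simp), (Subgroup.closure_le _).2 ?_⟩
    rintro h (rfl | rfl | rfl)
    exacts [p1.mem_common rfl q1, p2.mem_common rfl q2, hZ]
  | .two_two_star _ none _ _ _ => simp [Name.isDetermined] at hN
  | .two_two_cross _ none _ _ => simp [Name.isDetermined] at hN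
  | .two_two_cross _ (some _) none _ => simp [Name.isDetermined] at hN
  | .two_two_cross _ (some _) (some _) (.plain none) => simp [Name.isDetermined] at hN

end Unique

end Fibrifold

namespace Fibrifold

/-! ### Names whose couplings are determined only up to a symmetry of the plane group -/

section Exceptional

variable {G G' : Subgroup (E3 ≃ᵃ[ℝ] E3)} {N : Name} {h : Equiv.Perm (ℝ × ℝ)} {v : ℝ}

/-- The name `(2 *̄ 2_a 2_b)`. -/
def nameBar (a b : Fin 2) : Name :=
  .two_star22 .circle none (.bar none) .blank (some a) .blank (some b)

/-- The name `[2_1 2_1 ×]`. -/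
def nameCross : Name := .two_two_cross .interval (some 1) (some 1) (.plain none)

/-- The reflection in the diagonal. -/
def diag : Equiv.Perm (ℝ × ℝ) := Equiv.prodComm ℝ ℝ

theorem diag_conj_horiz (s r : ℤˣ) (t u : ℝ) :
    diag * horiz s t r u * diag⁻¹ = horiz r u s t := by
  ext p <;> simp [diag, Equiv.Perm.inv_def, horiz_apply]

theorem diag_conj_perm (a b : Bool) (m n : ℤ) :
    diag * Hz.perm ⟨a, m, b, n⟩ * diag⁻¹ = Hz.perm ⟨b, n, a, m⟩ := diag_conj_horiz ..

/-- The interchange of the horizontal axes, followed by a vertical shift. -/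
noncomputable def swapShift (v : ℝ) : E3 ≃ᵃ[ℝ] E3 := mon (Equiv.swap 0 1) 1 ![0, 0, v]

theorem hasParts_swapShift (v : ℝ) : HasParts (swapShift v) diag (plus v) := by
  intro x y z
  ext i
  fin_cases i <;> simp [swapShift, diag, plus, Equiv.swap_apply_of_ne_of_ne, add_comm]

theorem mapDir_swapShift (v : ℝ) : mapDir (swapShift v) (axis 2) = axis 2 :=
  mapDir_mon_axis (π := Equiv.swap 0 1) 2

theorem diag_conj_mem {T : Set (Equiv.Perm (ℝ × ℝ))}
    (hT : ∀ h ∈ T, diag * h * diag⁻¹ ∈ Subgroup.closure T) :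
    ∀ h ∈ Subgroup.closure T, diag⁻¹ * h * diag ∈ Subgroup.closure T := by
  intro h hh
  have : Subgroup.closure T ≤ (Subgroup.closure T).comap (MulAut.conj diag).toMonoidHom :=
    (Subgroup.closure_le _).2 hT
  exact this hh

theorem plus_kernel {f : FiberKind} (hf : f.isInterval = true → v = 0) :
    ∀ w ∈ f.kernel, plus v * w * (plus v)⁻¹ ∈ f.kernel ∧ (plus v)⁻¹ * w * plus v ∈ f.kernel := by
  have h0 : plus 0 = 1 := by ext z; simp [plus]
  cases f
  · rintro _ ⟨n, rfl⟩
    refine ⟨⟨n, plus_conj_plus _ _⟩, n, ?_⟩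
    rw [mul_assoc, inv_mul_eq_iff_eq_mul]
    simp [plus_eq_vert, vert_mul, add_comm]
  · rw [hf rfl, h0]
    simp

theorem minus_conj_plus (v c : ℝ) : minus v * plus c * (minus v)⁻¹ = plus (-c) := by
  rw [mul_inv_eq_iff_eq_mul]
  simp only [minus_eq_vert, plus_eq_vert, vert_mul]
  simp [add_comm]

theorem minus_conj_minus (v c : ℝ) : minus v * minus c * (minus v)⁻¹ = minus (2 * v - c) := by
  rw [mul_inv_eq_iff_eq_mul]
  simp only [minus_eq_vert, vert_mul]
  congr 1
  simp
  ring

theorem minus_inv (v : ℝ) : (minus v)⁻¹ = minus v := by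
  rw [inv_eq_iff_mul_eq_one]
  ext z
  simp [minus]

theorem minus_kernel (w : Equiv.Perm ℝ) (hw : w ∈ FiberKind.circle.kernel) :
    minus v * w * (minus v)⁻¹ ∈ FiberKind.circle.kernel ∧
      (minus v)⁻¹ * w * minus v ∈ FiberKind.circle.kernel := by
  obtain ⟨n, rfl⟩ := hw
  have : minus v * plus n * (minus v)⁻¹ ∈ FiberKind.circle.kernel :=
    ⟨-n, by rw [minus_conj_plus]; simp⟩
  refine ⟨this, ?_⟩
  rw [minus_inv] at *
  exact this

/-- The vertical reflection `c-`. -/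
noncomputable def vflip (v : ℝ) : E3 ≃ᵃ[ℝ] E3 := aff ![false, false, true] ![0, 0, v]

theorem hasParts_vflip (v : ℝ) : HasParts (vflip v) 1 (minus v) := by
  rw [← Hz.perm_one, Hz.perm, minus_eq_vert, hasParts_iff]
  simp [vflip]

theorem Couples.shift_plus (hG : IsModel G N) {x y : ℝ} {n : ℤ}
    (c : Couples G h (plus x)) (hn : x - y = n) : Couples G h (plus y) :=
  Couples.shift hG (e := false) c hn

theorem Couples.shift_minus (hG : IsModel G N) {x y : ℝ} {n : ℤ}
    (c : Couples G h (minus x)) (hn : x - y = n) : Couples G h (minus y) :=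
  Couples.shift hG (e := true) c hn

/-- The couplings in a model of `(2 *̄ 2_a 2_b)`. -/
theorem nameBar_couplings {a b : Fin 2} (hG : IsModel G (nameBar a b)) : ∃ g e : ℝ, ∃ n : ℤ,
    Couples G s22γ (minus g) ∧ Couples G s22P (minus (g + e)) ∧
    Couples G s22Q (minus (g + e - a.val / 2)) ∧ 2 * e = (a.val + b.val) / 2 + n := by
  obtain ⟨⟨g, hγ⟩, -, ⟨p, hP⟩, -, hPQ, hQP⟩ := hG.couplings
  have hPQ' : Couples G (s22P * s22Q) (plus (a.val / 2)) := hPQ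
  have hQP' : Couples G (s22Q * (s22γ * s22P * s22γ⁻¹)) (plus (b.val / 2)) := hQP
  have hQ : Couples G s22Q (minus (p - a.val / 2)) := by
    have := hP.inv.mul hPQ'
    rw [inv_mul_cancel_left, minus_inv, minus_eq_vert, plus_eq_vert, vert_mul] at this
    convert this using 1
    rw [minus_eq_vert]
    congr 1
    simp
    ring
  -- The last corner product is computed from the minus-couplings of the generators; comparison with
  -- its digit `b` determines `2 (p - g)` modulo 1.
  have h2 := hQ.mul ((hγ.mul hP).mul hγ.inv)
  rw [minus_inv] at h2
  simp only [minus_eq_vert, vert_mul] at h2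
  have h3 : Couples G (s22Q * (s22γ * s22P * s22γ⁻¹)) (plus (2 * p - 2 * g - a.val / 2)) := by
    convert h2 using 1
    rw [plus_eq_vert]
    congr 1
    simp
    ring
  obtain ⟨n, hn⟩ := Couples.sub_int hG h3 hQP'
  refine ⟨g, p - g, n, hγ, by simpa using hP, by simpa using hQ, by linarith⟩

/-- The invariant of a model is the offset `e` modulo 1 of the mirror `P` against `γ`. If the
offsets agree, aligning `γ` by a shift aligns everything. -/
theorem unique_nameBar_of_sub {a b : Fin 2} {g e g' e' : ℝ} {k : ℤ}
    (hG : IsModel G (nameBar a b)) (hG' : IsModel G' (nameBar a b))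
    (c1 : Couples G s22γ (minus g)) (c2 : Couples G s22P (minus (g + e)))
    (c3 : Couples G s22Q (minus (g + e - a.val / 2)))
    (d1 : Couples G' s22γ (minus g')) (d2 : Couples G' s22P (minus (g' + e')))
    (d3 : Couples G' s22Q (minus (g' + e' - a.val / 2))) (hk : e' - e = k) :
    ∃ φ, conj φ G = G' ∧ mapDir φ (axis 2) = axis 2 := by
  refine ⟨vshift ((g' - g) / 2), conj_eq_of_common hG hG' (hasParts_vshift _) (by simp)
    (plus_kernel (by simp [nameBar, Name.fiber, FiberKind.isInterval]))
    ((Subgroup.closure_le _).2 ?_), mapDir_aff_axis 2⟩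
  rintro h (rfl | rfl | rfl)
  · refine ⟨_, c1, ?_⟩
    rw [plus_conj_minus, one_mul, inv_one, mul_one]
    convert d1 using 2
    ring
  · refine ⟨_, c2, ?_⟩
    rw [plus_conj_minus, one_mul, inv_one, mul_one]
    refine Couples.shift_minus hG' d2 (n := k) ?_
    rw [← hk]
    ring
  · refine ⟨_, c3, ?_⟩
    rw [plus_conj_minus, one_mul, inv_one, mul_one]
    refine Couples.shift_minus hG' d3 (n := k) ?_
    rw [← hk]
    ring

/-- A vertical reflection aligning `γ` replaces `e` by `-e`. For `a = 0` both mirrors have the same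
coupling, so nothing else changes. -/
theorem unique_nameBar_of_add {a b : Fin 2} {g e g' e' : ℝ} {k : ℤ}
    (hG : IsModel G (nameBar a b)) (hG' : IsModel G' (nameBar a b))
    (c1 : Couples G s22γ (minus g)) (c2 : Couples G s22P (minus (g + e)))
    (c3 : Couples G s22Q (minus (g + e - a.val / 2)))
    (d1 : Couples G' s22γ (minus g')) (d2 : Couples G' s22P (minus (g' + e')))
    (d3 : Couples G' s22Q (minus (g' + e' - a.val / 2))) (hk : e + e' = k) (ha : a = 0) :
    ∃ φ, conj φ G = G' ∧ mapDir φ (axis 2) = axis 2 := by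
  subst ha
  simp only [Fin.val_zero, Nat.cast_zero, zero_div, sub_zero] at c3 d3
  refine ⟨vflip ((g' + g) / 2), conj_eq_of_common hG hG' (hasParts_vflip _) (by simp)
    minus_kernel ((Subgroup.closure_le _).2 ?_), mapDir_aff_axis 2⟩
  rintro h (rfl | rfl | rfl)
  · refine ⟨_, c1, ?_⟩
    rw [minus_conj_minus, one_mul, inv_one, mul_one]
    convert d1 using 2
    ring
  · refine ⟨_, c2, ?_⟩
    rw [minus_conj_minus, one_mul, inv_one, mul_one]
    refine Couples.shift_minus hG' d2 (n := k) ?_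
    rw [← hk]
    ring
  · refine ⟨_, c3, ?_⟩
    rw [minus_conj_minus, one_mul, inv_one, mul_one]
    refine Couples.shift_minus hG' d3 (n := k) ?_
    rw [← hk]
    ring

/-- For `a = 1` the couplings of `P` and `Q` differ by one half, so interchanging these mirrors by
the diagonal reflection changes `e` by one half modulo 1. -/
theorem unique_nameBar_of_swap {g e g' e' : ℝ} {k : ℤ}
    (hG : IsModel G (nameBar 1 1)) (hG' : IsModel G' (nameBar 1 1))
    (c1 : Couples G s22γ (minus g)) (c2 : Couples G s22P (minus (g + e)))
    (c3 : Couples G s22Q (minus (g + e - 1 / 2)))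
    (d1 : Couples G' s22γ (minus g')) (d2 : Couples G' s22P (minus (g' + e')))
    (d3 : Couples G' s22Q (minus (g' + e' - 1 / 2))) (hk : e' - e + 1 / 2 = k) :
    ∃ φ, conj φ G = G' ∧ mapDir φ (axis 2) = axis 2 := by
  refine ⟨swapShift ((g' - g) / 2), conj_eq_of_common hG hG' (hasParts_swapShift _)
    (diag_conj_mem ?_) (plus_kernel (by simp [nameBar, Name.fiber, FiberKind.isInterval]))
    ((Subgroup.closure_le _).2 ?_), mapDir_swapShift _⟩
  · rintro h (rfl | rfl | rfl)
    · rw [s22γ_eq, diag_conj_perm, ← s22γ_eq]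
      exact Subgroup.subset_closure (by simp)
    · rw [s22P_eq, diag_conj_perm, ← s22Q_eq]
      exact Subgroup.subset_closure (by simp)
    · rw [s22Q_eq, diag_conj_perm, ← s22P_eq]
      exact Subgroup.subset_closure (by simp)
  · rintro h (rfl | rfl | rfl)
    · refine ⟨_, c1, ?_⟩
      rw [plus_conj_minus, s22γ_eq, diag_conj_perm, ← s22γ_eq]
      convert d1 using 2
      ring
    · refine ⟨_, c2, ?_⟩
      rw [plus_conj_minus, s22P_eq, diag_conj_perm, ← s22Q_eq]
      refine Couples.shift_minus hG' d3 (n := k - 1) ?_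
      push_cast
      rw [← hk]
      ring
    · refine ⟨_, c3, ?_⟩
      rw [plus_conj_minus, s22Q_eq, diag_conj_perm, ← s22P_eq]
      refine Couples.shift_minus hG' d2 (n := k) ?_
      rw [← hk]
      ring

/-- The name determines `e` only modulo one half. The parity of `n - n'` tells whether the two
offsets agree modulo 1; if not, `-e` (for `a = 0`) or the interchange of mirrors (for `a = 1`) gives
the other value, since `b = 1`. -/
theorem IsModel.unique_nameBar {a b : Fin 2} (hG : IsModel G (nameBar a b))
    (hG' : IsModel G' (nameBar a b)) (hb : b = 1) :
    ∃ φ, conj φ G = G' ∧ mapDir φ (axis 2) = axis 2 := by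
  obtain ⟨g, e, n, c1, c2, c3, hn⟩ := nameBar_couplings hG
  obtain ⟨g', e', n', d1, d2, d3, hn'⟩ := nameBar_couplings hG'
  by_cases hpar : (n - n') % 2 = 0
  · obtain ⟨k, hk⟩ : ∃ k, n - n' = 2 * k := ⟨(n - n') / 2, by omega⟩
    refine unique_nameBar_of_sub hG hG' c1 c2 c3 d1 d2 d3 (k := -k) ?_
    have : ((n - n' : ℤ) : ℝ) = 2 * k := by exact_mod_cast hk
    push_cast at this ⊢
    linarith
  · obtain ⟨k, hk⟩ : ∃ k, n - n' = 2 * k + 1 := ⟨(n - n') / 2, by omega⟩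
    have hk' : ((n - n' : ℤ) : ℝ) = 2 * k + 1 := by exact_mod_cast hk
    push_cast at hk'
    subst hb
    fin_cases a
    · refine unique_nameBar_of_add hG hG' c1 c2 c3 d1 d2 d3 (k := n - k) ?_ rfl
      push_cast
      simp at hn hn'
      linarith
    · simp only [Fin.val_one, Nat.cast_one] at c3 d3 hn hn'
      refine unique_nameBar_of_swap hG hG' c1 c2 c3 d1 d2 d3 (k := -k) ?_
      push_cast
      linarith

/-- The relation `γ δ Z² = 1` forces `1/2 + 1/2 + 2 c` to be an integer. -/
theorem nameCross_couplings (hG : IsModel G nameCross) : ∃ c : ℝ, ∃ n : ℤ,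
    Couples G xγ (plus (1 / 2)) ∧ Couples G xδ (plus (1 / 2)) ∧ Couples G xZ (plus c) ∧
    2 * c = n := by
  obtain ⟨hγ, hδ, c, hZ⟩ := hG.couplings
  have hγ' : Couples G xγ (plus (1 / 2)) := by simpa [GyrationHolds, half] using hγ
  have hδ' : Couples G xδ (plus (1 / 2)) := by simpa [GyrationHolds, half] using hδ
  have h := (hγ'.mul hδ').mul (hZ.mul hZ)
  rw [xγ_eq, xδ_eq, xZ_eq, Hz.perm_mul, Hz.perm_mul, Hz.perm_mul] at h
  have e : (((⟨true, 0, true, 0⟩ : Hz).mul ⟨true, 2, true, 0⟩).mul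
      ((⟨false, 1, true, 1⟩ : Hz).mul ⟨false, 1, true, 1⟩)).perm = 1 := by
    rw [← Hz.perm_one]
    rfl
  rw [e] at h
  simp only [plus_eq_vert, vert_mul] at h
  have h1 : Couples G 1 (plus (1 + 2 * c)) := by
    convert h using 1
    rw [plus_eq_vert]
    congr 1
    simp
    ring
  have h0 : Couples G 1 (plus 0) := by
    convert couples_one
    ext z
    simp [plus]
  obtain ⟨n, hn⟩ := Couples.sub_int hG h1 h0
  refine ⟨c, n - 1, hγ', hδ', hZ, ?_⟩
  push_cast
  linarith

/-- The coupling of `Z` is 0 or one half modulo 1. The diagonal reflection carries `Z` to `Z γ`,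
whose coupling is larger by one half, so it interchanges the two cases. -/
theorem IsModel.unique_nameCross (hG : IsModel G nameCross) (hG' : IsModel G' nameCross) :
    ∃ φ, conj φ G = G' ∧ mapDir φ (axis 2) = axis 2 := by
  obtain ⟨c, n, c1, c2, c3, hn⟩ := nameCross_couplings hG
  obtain ⟨c', n', d1, d2, d3, hn'⟩ := nameCross_couplings hG'
  by_cases hpar : (n - n') % 2 = 0
  · obtain ⟨k, hk⟩ : ∃ k, n - n' = 2 * k := ⟨(n - n') / 2, by omega⟩
    have hk' : ((n - n' : ℤ) : ℝ) = 2 * k := by exact_mod_cast hk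
    push_cast at hk'
    refine conj_vshift_eq hG hG' (v := 0) (fun _ => rfl) ((Subgroup.closure_le _).2 ?_)
    rintro h (rfl | rfl | rfl)
    · exact mem_common_of_plus c1 d1
    · exact mem_common_of_plus c2 d2
    · refine mem_common_of_plus c3 (Couples.shift_plus hG' d3 (n := -k) ?_)
      push_cast
      linarith
  · obtain ⟨k, hk⟩ : ∃ k, n - n' = 2 * k + 1 := ⟨(n - n') / 2, by omega⟩
    have hk' : ((n - n' : ℤ) : ℝ) = 2 * k + 1 := by exact_mod_cast hk
    push_cast at hk'
    have dZ : Couples G' (Hz.perm ⟨true, 1, false, 1⟩) (plus (c' + 1 / 2)) := by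
      have := d3.mul d1
      rw [xZ_eq, xγ_eq, Hz.perm_mul] at this
      simpa [plus_eq_vert, vert_mul, Hz.mul] using this
    -- This is the diagonal image of `δ`, written as `(Z γ)² γ`; its coupling is one half modulo 1
    -- because `2 c'` is an integer.
    have dδ : Couples G' (Hz.perm ⟨true, 0, true, 2⟩) (plus (2 * c' + 3 / 2)) := by
      have := (dZ.mul dZ).mul d1
      rw [xγ_eq, Hz.perm_mul, Hz.perm_mul] at this
      convert this using 1
      · simp [Hz.mul]
      · simp only [plus_eq_vert, vert_mul]
        congr 1
        simp
        ring
    refine ⟨swapShift 0, conj_eq_of_common hG hG' (hasParts_swapShift _)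
        (diag_conj_mem ?_) (plus_kernel fun _ => rfl)
        ((Subgroup.closure_le _).2 ?_), mapDir_swapShift _⟩
    · rintro h (rfl | rfl | rfl)
      · rw [xγ_eq, diag_conj_perm, ← xγ_eq]
        exact Subgroup.subset_closure (by simp)
      · rw [xδ_eq, diag_conj_perm, ← xδ_eq]
        refine perm_mem_x ?_
        decide
      · rw [xZ_eq, diag_conj_perm, ← xZ_eq]
        refine perm_mem_x ?_
        decide
    · rintro h (rfl | rfl | rfl)
      · refine ⟨_, c1, ?_⟩
        rw [plus_conj_plus, xγ_eq, diag_conj_perm, ← xγ_eq]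
        exact d1
      · refine ⟨_, c2, ?_⟩
        rw [plus_conj_plus, xδ_eq, diag_conj_perm]
        exact Couples.shift_plus hG' (n := n' + 1) dδ (by push_cast; linarith)
      · refine ⟨_, c3, ?_⟩
        rw [plus_conj_plus, xZ_eq, diag_conj_perm]
        refine Couples.shift_plus hG' (n := -k) dZ ?_
        push_cast
        linarith

/-- The model of a name is unique, for the names considered. -/
def Name.isUnique : Name → Bool
  | .two_star22 .circle none (.bar none) .blank (some 0) .blank (some 1) => true
  | .two_star22 .circle none (.bar none) .blank (some 1) .blank (some 1) => true
  | .two_two_cross .interval (some 1) (some 1) (.plain none) => true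
  | N => N.isDetermined

theorem IsModel.unique (hG : IsModel G N) (hG' : IsModel G' N) (hN : N.isUnique = true) :
    ∃ φ, conj φ G = G' ∧ mapDir φ (axis 2) = axis 2 := by
  unfold Name.isUnique at hN
  split at hN
  · exact IsModel.unique_nameBar hG hG' rfl
  · exact IsModel.unique_nameBar hG hG' rfl
  · exact IsModel.unique_nameCross hG hG'
  · exact hG.unique_of_determined hG' hN

end Exceptional

end Fibrifold

namespace Fibrifold

/-! ### Normalized groups and their affine conjugacies -/

/-- All elements are sign changes with translations, all rotations occur as linear parts, and the
primitive translations along the axes have length `1`. -/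
structure IsNormalized (G : Subgroup (E3 ≃ᵃ[ℝ] E3)) : Prop where
  exists_aff : ∀ g ∈ G, ∃ s t, g = aff s t
  rot : ∀ s, odd s = false → ∃ t, aff s t ∈ G
  prim : ∀ i (x : ℝ), aff (fun _ => false) (Pi.single i x) ∈ G ↔ ∃ n : ℤ, x = n

section Normalized

variable {G G' : Subgroup (E3 ≃ᵃ[ℝ] E3)} {D D' : Dat}

theorem isFibration_axis (h : ∀ g ∈ G, ∃ s t, g = aff s t) (i : Fin 3) : IsFibration G (axis i) :=
  ⟨finrank_axis i, fun g hg => by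
    obtain ⟨s, t, rfl⟩ := h g hg
    exact mapDir_aff_axis i⟩

/-- The half turn about axis `i` maps an invariant line to itself. If a spanning vector has nonzero
`i`-th coordinate, the eigenvalue is 1, so the other coordinates, which are negated, vanish. -/
theorem isFibration_iff (h : ∀ g ∈ G, ∃ s t, g = aff s t)
    (hr : ∀ s, odd s = false → ∃ t, aff s t ∈ G) {ℓ : Submodule ℝ E3} :
    IsFibration G ℓ ↔ ∃ i, ℓ = axis i := by
  constructor
  · rintro ⟨h1, h2⟩
    obtain ⟨⟨v, hv⟩, hv0, hspan⟩ := finrank_eq_one_iff'.1 h1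
    have hv0' : v ≠ 0 := fun h => hv0 (Subtype.ext h)
    obtain ⟨i, hi⟩ : ∃ i, v i ≠ 0 := by
      by_contra! hc
      exact hv0' (by ext i; simpa using hc i)
    have hodd : ∀ i : Fin 3, odd (fun j => j != i) = false := by decide
    obtain ⟨t, ht⟩ := hr _ (hodd i)
    have hm : (aff (fun j => j != i) t).linear v ∈ ℓ := by
      have := h2 _ ht
      rw [← this]
      exact ⟨v, hv, rfl⟩
    obtain ⟨c, hc⟩ := hspan ⟨_, hm⟩
    have hc' : ∀ j, c * v j = sgn (j != i) * v j := fun j => by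
      have := congrArg (fun p : ℓ => (p : E3) j) hc
      simpa using this
    have c1 : c = 1 := by
      have := hc' i
      simp only [bne_self_eq_false, sgn_false, Units.val_one] at this
      exact mul_right_cancel₀ hi this
    have hva : v ∈ axis i := mem_axis.2 fun j hj => by
      have := hc' j
      rw [bne_iff_ne.2 hj, c1] at this
      simp only [one_mul, sgn_true, Units.val_neg, Units.val_one, neg_mul] at this
      linarith
    refine ⟨i, Submodule.eq_of_le_of_finrank_eq (fun w hw => ?_) (by rw [h1, finrank_axis])⟩
    obtain ⟨d, hd⟩ := hspan ⟨w, hw⟩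
    have : w = d • v := (congrArg Subtype.val hd).symm
    rw [this]
    exact (axis i).smul_mem d hva
  · rintro ⟨i, rfl⟩
    exact isFibration_axis h i

theorem IsNormalized.isFibration_iff (h : IsNormalized G) {ℓ : Submodule ℝ E3} :
    IsFibration G ℓ ↔ ∃ i, ℓ = axis i :=
  Fibrifold.isFibration_iff h.exists_aff h.rot

theorem mul_trans (φ : E3 ≃ᵃ[ℝ] E3) (t : Fin 3 → ℝ) :
    φ * aff (fun _ => false) t = aff (fun _ => false) (φ.linear (WithLp.toLp 2 t)) * φ := by
  ext x i
  have : aff (fun _ => false) t x = x + WithLp.toLp 2 t := by ext i; simp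
  rw [AffineEquiv.mul_def, AffineEquiv.mul_def, AffineEquiv.trans_apply, AffineEquiv.trans_apply,
    this, aff_apply]
  have h2 := φ.map_vadd x (WithLp.toLp 2 t)
  simp only [vadd_eq_add] at h2
  rw [add_comm, h2]
  simp [add_comm]

theorem toLp_single (i : Fin 3) (x : ℝ) :
    WithLp.toLp 2 (Pi.single i x : Fin 3 → ℝ) = x • EuclideanSpace.single i (1 : ℝ) := by
  ext j
  by_cases h : j = i
  · subst h; simp
  · simp [h]

theorem eq_mon {φ : E3 ≃ᵃ[ℝ] E3} {τ : Equiv.Perm (Fin 3)} {c : Fin 3 → ℝˣ}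
    (h : ∀ i, φ.linear (EuclideanSpace.single i (1 : ℝ)) =
      (c i : ℝ) • EuclideanSpace.single (τ i) (1 : ℝ)) :
    φ = mon τ.symm (fun i => c (τ.symm i)) (φ 0) := by
  have hl : ∀ x, φ.linear x = (mon τ.symm (fun i => c (τ.symm i)) (φ 0)).linear x := by
    have : (φ.linear : E3 →ₗ[ℝ] E3) =
        ((mon τ.symm (fun i => c (τ.symm i)) (φ 0)).linear : E3 →ₗ[ℝ] E3) := by
      refine (EuclideanSpace.basisFun (Fin 3) ℝ).toBasis.ext fun i => ?_
      ext j
      have := congrArg (fun v : E3 => v j) (h i)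
      simp only [OrthonormalBasis.coe_toBasis, EuclideanSpace.basisFun_apply,
        LinearEquiv.coe_coe, mon_linear_apply]
      refine this.trans ?_
      by_cases hj : j = τ i
      · subst hj; simp
      · have : τ.symm j ≠ i := fun h => hj (by rw [← h]; simp)
        simp [hj, this]
    exact fun x => LinearMap.congr_fun this x
  have h0 : ∀ (ψ : E3 ≃ᵃ[ℝ] E3) x, ψ x = ψ.linear x + ψ 0 := fun ψ x => by
    have := ψ.map_vadd 0 x
    simpa using this
  ext x i
  rw [h0 φ, hl, h0 (mon _ _ _)]
  simp

theorem IsNormalized.exists_perm (h : IsNormalized G) (h' : IsNormalized G') {φ : E3 ≃ᵃ[ℝ] E3}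
    (e : conj φ G = G') : ∃ (τ : Equiv.Perm (Fin 3)) (c : Fin 3 → ℝˣ),
      ∀ i, φ.linear (EuclideanSpace.single i (1 : ℝ)) =
        (c i : ℝ) • EuclideanSpace.single (τ i) (1 : ℝ) := by
  have h1 : ∀ i, ∃ j, mapDir φ (axis i) = axis j := fun i =>
    h'.isFibration_iff.1 (e ▸ (h.isFibration_iff.2 ⟨i, rfl⟩).conj φ)
  choose τ hτ using h1
  have hinj : Function.Injective τ := fun i j hij =>
    axis_injective (mapDir_injective φ (by rw [hτ, hτ, hij]))
  have h2 : ∀ i, ∃ c : ℝˣ, φ.linear (EuclideanSpace.single i (1 : ℝ)) =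
      (c : ℝ) • EuclideanSpace.single (τ i) (1 : ℝ) := fun i => by
    have : φ.linear (EuclideanSpace.single i (1 : ℝ)) ∈ axis (τ i) := by
      rw [← hτ]
      exact ⟨_, Submodule.mem_span_singleton_self _, rfl⟩
    obtain ⟨c, hc⟩ := Submodule.mem_span_singleton.1 this
    refine ⟨Units.mk0 c ?_, hc.symm⟩
    rintro rfl
    rw [zero_smul, eq_comm, LinearEquiv.map_eq_zero_iff] at hc
    simp at hc
  choose c hc using h2
  exact ⟨Equiv.ofBijective τ (Finite.injective_iff_bijective.1 hinj), c, hc⟩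

/-- Affine conjugacies between normalized groups are signed permutations with translations. -/
theorem IsNormalized.exists_mon (h : IsNormalized G) (h' : IsNormalized G') {φ : E3 ≃ᵃ[ℝ] E3}
    (e : conj φ G = G') : ∃ π, ∃ ε : Fin 3 → Bool, ∃ v, φ = mon π (fun i => sgn (ε i)) v := by
  obtain ⟨τ, c, hc⟩ := h.exists_perm h' e
  -- Conjugation carries the translations along axis `i` to those along axis `τ i`, multiplying
  -- lengths by `c i`. Both sets are ℤ, so `c i` and its inverse are integers.
  have key : ∀ (i : Fin 3) (x : ℝ),
      (∃ n : ℤ, x = n) ↔ ∃ n : ℤ, x * c i = n := fun i x => by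
    rw [← h.prim i, ← h'.prim (τ i), ← e, ← mem_conj_of_mul_eq (mul_trans φ (Pi.single i x))]
    congr! 2
    rw [toLp_single, map_smul, hc, smul_smul, ← toLp_single]
  have hs : ∀ i, ∃ b, c i = sgn b := fun i => by
    obtain ⟨m, hm⟩ := (key i 1).1 ⟨1, by simp⟩
    obtain ⟨n, hn⟩ := (key i (c i)⁻¹).2 ⟨1, by simp⟩
    rw [one_mul] at hm
    have : m * n = 1 := by
      have : (m : ℝ) * n = 1 := by rw [← hm, ← hn]; simp
      exact_mod_cast this
    rcases Int.eq_one_or_neg_one_of_mul_eq_one this with rfl | rfl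
    · exact ⟨false, Units.ext (by simpa using hm)⟩
    · exact ⟨true, Units.ext (by simpa using hm)⟩
  choose b hb using hs
  refine ⟨τ.symm, fun i => b (τ.symm i), φ 0, ?_⟩
  simp_rw [← hb]
  exact eq_mon hc

theorem mon_inv {π : Equiv.Perm (Fin 3)} {d : Fin 3 → ℝˣ} {t : Fin 3 → ℝ} :
    (mon π d t)⁻¹ = mon π⁻¹ (fun i => (d (π⁻¹ i))⁻¹)
      (fun i => -(((d (π⁻¹ i))⁻¹ : ℝˣ) * t (π⁻¹ i))) := by
  rw [inv_eq_iff_mul_eq_one, mon_mul]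
  ext x i
  simp

theorem sgn_inv (b : Bool) : (sgn b)⁻¹ = sgn b := by cases b <;> simp [sgn]

theorem IsNormalized.trans_int (h : IsNormalized G) (n : Fin 3 → ℤ) :
    aff (fun _ => false) (fun i => (n i : ℝ)) ∈ G := by
  have := G.mul_mem (G.mul_mem ((h.prim 0 (n 0)).2 ⟨_, rfl⟩) ((h.prim 1 (n 1)).2 ⟨_, rfl⟩))
    ((h.prim 2 (n 2)).2 ⟨_, rfl⟩)
  rw [aff_mul, aff_mul] at this
  convert this using 2
  · simp
  · ext i
    fin_cases i <;> simp

/-! ### Invariants -/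

/-- `s` occurs with translation components `0` or `1/2`, as given by `u`, where `s` is positive. -/
def HasHalf (G : Subgroup (E3 ≃ᵃ[ℝ] E3)) (s u : Fin 3 → Bool) : Prop :=
  ∃ t, aff s t ∈ G ∧ ∀ i, s i = false → t i = if u i then 1 / 2 else 0

/-- A change of origin does not affect the translation components along coordinates that are not
reversed, and a sign change only turns 1/2 into -1/2. -/
theorem HasHalf.conj_mon (h' : IsNormalized G') {π : Equiv.Perm (Fin 3)}
    {ε : Fin 3 → Bool} {v : Fin 3 → ℝ} (e : conj (mon π (fun i => sgn (ε i)) v) G = G')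
    {s u : Fin 3 → Bool} (hs : HasHalf G s u) :
    HasHalf G' (fun i => s (π i)) (fun i => u (π i)) := by
  obtain ⟨t, ht, hu⟩ := hs
  have h1 := (mem_conj_of_mul_eq (mon_mul_aff (π := π) (d := fun i => sgn (ε i)) (t' := v))).2 ht
  rw [e] at h1
  -- An integral translation restores 1/2 from -1/2 where the conjugating map reverses the
  -- coordinate.
  have h2 := G'.mul_mem (h'.trans_int fun i => if ε i && u (π i) then 1 else 0) h1
  rw [aff_mul] at h2
  simp only [Bool.false_bne] at h2
  refine ⟨_, h2, fun i hi => ?_⟩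
  have := hu _ hi
  simp only [this, hi]
  cases ε i <;> by_cases hu : u (π i) = true <;> simp [hu]
  norm_num

theorem hasHalf_conj_mon (h : IsNormalized G) (h' : IsNormalized G') {π : Equiv.Perm (Fin 3)}
    {ε : Fin 3 → Bool} {v : Fin 3 → ℝ} (e : conj (mon π (fun i => sgn (ε i)) v) G = G')
    (s u : Fin 3 → Bool) :
    HasHalf G' (fun i => s (π i)) (fun i => u (π i)) ↔ HasHalf G s u := by
  refine ⟨fun hs => ?_, HasHalf.conj_mon h' e⟩
  have e2 := conj_inv_eq e
  rw [mon_inv] at e2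
  simp only [sgn_inv] at e2
  simpa using HasHalf.conj_mon h e2 hs

/-- Some point is fixed by rotations with all linear parts. -/
def HasRotationCenter (G : Subgroup (E3 ≃ᵃ[ℝ] E3)) : Prop :=
  ∃ x : E3, ∀ s, odd s = false → ∃ t, aff s t ∈ G ∧ aff s t x = x

theorem HasRotationCenter.conj_mon {π : Equiv.Perm (Fin 3)} {d : Fin 3 → ℝˣ} {v : Fin 3 → ℝ}
    (e : conj (mon π d v) G = G') (h : HasRotationCenter G) : HasRotationCenter G' := by
  obtain ⟨x, hx⟩ := h
  refine ⟨mon π d v x, fun s hs => ?_⟩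
  obtain ⟨t, ht, hf⟩ := hx (fun j => s (π.symm j)) (by rw [odd_perm π.symm, hs])
  have h1 := (mem_conj_of_mul_eq (mon_mul_aff (π := π) (d := d) (t' := v))).2 ht
  rw [e] at h1
  simp only [Equiv.symm_apply_apply] at h1
  refine ⟨_, h1, ?_⟩
  have h2 := congrArg (fun ψ : E3 ≃ᵃ[ℝ] E3 => ψ x)
    (mon_mul_aff (π := π) (d := d) (t' := v) (s := fun j => s (π.symm j)) (t := t))
  simp only [Equiv.symm_apply_apply, AffineEquiv.mul_def, AffineEquiv.trans_apply, hf] at h2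
  exact h2.symm

/-! ### Invariants of finite data -/

def anyB (f : (Fin 3 → Bool) → Bool) : Bool := !allB fun s => !f s

theorem anyB_iff {f : (Fin 3 → Bool) → Bool} : anyB f = true ↔ ∃ s, f s = true := by
  rw [anyB, Bool.not_eq_true', ← Bool.not_eq_true, allB_iff]
  simp

/-- The value of `HasHalf` computed from the data. -/
def Dat.half (D : Dat) (s u : Fin 3 → Bool) : Bool :=
  D.ok s && anyB fun w => D.W w &&
    ((s 0 || (D.c s 0 + 2 * (w 0).toInt - 2 * (u 0).toInt) % 4 == 0) &&
    (s 1 || (D.c s 1 + 2 * (w 1).toInt - 2 * (u 1).toInt) % 4 == 0) &&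
    (s 2 || (D.c s 2 + 2 * (w 2).toInt - 2 * (u 2).toInt) % 4 == 0))

theorem Dat.half_iff {s u : Fin 3 → Bool} : D.half s u = true ↔ D.ok s = true ∧
    ∃ w, D.W w = true ∧ ∀ i, s i = true ∨
      (D.c s i + 2 * (w i).toInt - 2 * (u i).toInt) % 4 = 0 := by
  simp [Dat.half, anyB_iff, Fin.forall_fin_succ, and_assoc]

theorem Dat.mem_of_two_mul {s w : Fin 3 → Bool} {T : Fin 3 → ℤ} (hs : D.ok s = true)
    (hw : D.W w = true) (hT : ∀ i, (T i - D.c s i - 2 * (w i).toInt) % 4 = 0) :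
    D.mem s T = true := by
  rw [mem_iff, latMem_iff]
  refine ⟨hs, fun i => by have := hT i; omega, ?_⟩
  convert hw
  rename_i i
  have := hT i
  rw [Bool.eq_iff_iff, beq_iff_eq]
  cases h : w i
  · rw [h, Bool.toInt_false] at this
    simp only [Bool.false_eq_true, iff_false]
    omega
  · rw [h, Bool.toInt_true] at this
    simp only [iff_true]
    omega

theorem Repr.hasHalf_iff (h : Repr G 1 D) {s u : Fin 3 → Bool} :
    HasHalf G s u ↔ D.half s u = true := by
  rw [Dat.half_iff]
  constructor
  · rintro ⟨t, ht, hu⟩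
    obtain ⟨s', T, hm, e⟩ := (h _).1 ht
    obtain ⟨rfl, rfl⟩ := aff_inj.1 e
    obtain ⟨w, hw, k, hT⟩ := Dat.exists_of_mem hm
    refine ⟨(Dat.mem_iff.1 hm).1, w, hw, fun i => ?_⟩
    rw [or_iff_not_imp_left, Bool.not_eq_true]
    intro hi
    have h1 := hu i hi
    have h2 := hT i
    have h3 : T i = 2 * (u i).toInt := by
      have : (T i : ℝ) = 2 * ((u i).toInt : ℝ) := by
        cases hui : u i <;> simp [hui] at h1 ⊢ <;> linarith
      exact_mod_cast this
    omega
  · rintro ⟨hs, w, hw, hi⟩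
    -- On reversed coordinates the translation is unconstrained and is taken from the representative
    -- and the centring vector; elsewhere it must be the prescribed value.
    refine ⟨_, (h.mem_aff (T := fun i => if s i then D.c s i + 2 * (w i).toInt
      else 2 * (u i).toInt)).2 (Dat.mem_of_two_mul hs hw fun i => ?_), fun i hi => ?_⟩
    · have := hi i
      cases h : s i
      · simp [h] at this ⊢; omega
      · simp
    · simp only [hi]
      cases u i <;> simp
      norm_num

theorem Dat.Valid.latMem_of_mem (hv : D.Valid) {T : Fin 3 → ℤ}
    (h : D.mem (fun _ => false) T = true) : latMem D.W T = true := by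
  have h1 := (latMem_flip fun _ => true).trans (Dat.mem_iff.1 hv.one).2
  convert latMem_add hv.add (Dat.mem_iff.1 h).2 h1
  simp [flip]

theorem Repr.isNormalized (h : Repr G 1 D) (hv : D.Valid)
    (hW : ∀ i, D.W (fun j => j == i) = false) : IsNormalized G where
  exists_aff g hg := by
    obtain ⟨s, T, -, rfl⟩ := (h g).1 hg
    exact ⟨_, _, rfl⟩
  rot s hs := by
    refine ⟨_, (h.mem_aff (T := D.c s)).2 (Dat.mem_iff.2 ⟨by simp [Dat.ok, hs], ?_⟩)⟩
    rw [latMem_iff]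
    exact ⟨by simp, by simpa using hv.zero⟩
  prim i x := by
    constructor
    · intro hx
      obtain ⟨s, T, hm, e⟩ := (h _).1 hx
      obtain ⟨rfl, e'⟩ := aff_inj.1 e
      obtain ⟨h1, h2⟩ := latMem_iff.1 (hv.latMem_of_mem hm)
      have hT : ∀ j, j ≠ i → T j = 0 := fun j hj => by
        have := congrFun e' j
        simpa [hj] using this.symm
      have h4 : T i % 4 ≠ 2 := fun h4 => by
        have : (fun j => T j % 4 == 2) = fun j => j == i := by
          ext j
          by_cases hj : j = i
          · subst hj; simp [h4]
          · simp [hj, hT j hj]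
        rw [this, hW] at h2
        exact absurd h2 (by simp)
      have := h1 i
      obtain ⟨n, hn⟩ : ∃ n, T i = 4 * n := ⟨T i / 4, by omega⟩
      refine ⟨n, ?_⟩
      have := congrFun e' i
      simp only [Pi.single_eq_same, Pi.one_apply, Units.val_one, one_mul, hn] at this
      rw [this]
      push_cast
      ring
    · rintro ⟨n, rfl⟩
      have hm : D.mem (fun _ => false) (fun j => 4 * (Pi.single i n : Fin 3 → ℤ) j) = true := by
        rw [← hv.one]
        exact Dat.mem_congr fun i => by simp
      convert h.mem_aff.2 hm
      rename_i j
      by_cases hj : j = i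
      · subst hj; simp
      · simp [hj]

end Normalized

end Fibrifold

namespace Fibrifold

/-! ### The groups of the table -/

/-- The digits list the images of 0, 1, 2. The first two are the 3-cycles, the remaining three the
transpositions. -/
def perm120 : Equiv.Perm (Fin 3) := ⟨![1, 2, 0], ![2, 0, 1], by decide, by decide⟩
def perm201 : Equiv.Perm (Fin 3) := ⟨![2, 0, 1], ![1, 2, 0], by decide, by decide⟩
def perm102 : Equiv.Perm (Fin 3) := ⟨![1, 0, 2], ![1, 0, 2], by decide, by decide⟩
def perm021 : Equiv.Perm (Fin 3) := ⟨![0, 2, 1], ![0, 2, 1], by decide, by decide⟩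
def perm210 : Equiv.Perm (Fin 3) := ⟨![2, 1, 0], ![2, 1, 0], by decide, by decide⟩

/-- Primitive lattices. -/
def latP (u : Fin 3 → Bool) : Bool := !u 0 && !u 1 && !u 2

/-- Body-centred lattices. -/
def latI (u : Fin 3 → Bool) : Bool := u 0 == u 1 && u 1 == u 2

/-- Face-centred lattices. -/
def latF (u : Fin 3 → Bool) : Bool := !(u 0 ^^ u 1 ^^ u 2)

/-- Lattices centred on the face orthogonal to one axis. -/
def latOne (i : Fin 3) (u : Fin 3 → Bool) : Bool := !u i && u (i + 1) == u (i + 2)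

/-- The translation part of a rotation, when those of the first two rotations are `a` and `b`. -/
def rotC (a b : Fin 3 → ℤ) (x y : Bool) (i : Fin 3) : ℤ :=
  match x, y with
  | false, false => 0
  | false, true => a i
  | true, false => b i
  | true, true => a i + if i = 0 then b i else -b i

/-- Data with the translation parts `a`, `b` of two rotations, inverted at the origin. -/
def mkDat (W : (Fin 3 → Bool) → Bool) (inv : Bool) (a b : Fin 3 → ℤ) : Dat where
  W := W
  inv := inv
  c s i := if odd s then -rotC a b (!s 0) (!s 1) i else rotC a b (s 0) (s 1) i

/-- The name of a fibration, as an index into the line, and coordinates adapted to it: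
a permutation, a shift, and the axes to be scaled by `2`. -/
structure AxisEntry where
  name : ℕ
  π : Equiv.Perm (Fin 3)
  V : Fin 3 → ℤ
  z₀ : Bool
  z₁ : Bool

/-- Finite data for a line of the table: a group, a shift completing the interchange of the first
two axes to a symmetry (if there is one), and the fibrations. -/
structure Entry where
  W : (Fin 3 → Bool) → Bool
  inv : Bool
  a : Fin 3 → ℤ
  b : Fin 3 → ℤ
  swap : Fin 3 → ℤ
  axes : Fin 3 → AxisEntry

def Entry.dat (E : Entry) : Dat := mkDat E.W E.inv E.a E.b

def AxisEntry.z (A : AxisEntry) : Fin 3 → Bool := ![A.z₀, A.z₁, false]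

/-- Listed in the order of the table, with `a`, `b` in quarters and shifts in eighths of the axis
lengths. If there are inversions, one is at the origin. The `i`-th axis entry makes axis `i`
vertical, and the primary name belongs to axis 2. Axes are doubled where this fits the horizontal
lattice to the standard plane group. -/
def entries : List Entry := [
  ⟨latP, true, ![0, 0, 0], ![0, 0, 0], ![0, 0, 0],
    ![⟨0, perm120, ![0, 0, 0], false, false⟩,
      ⟨0, perm021, ![0, 0, 0], false, false⟩,
      ⟨0, 1, ![0, 0, 0], false, false⟩]⟩,
  ⟨latF, true, ![0, 0, 0], ![0, 0, 0], ![0, 0, 0],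
    ![⟨0, perm120, ![0, 0, 0], true, true⟩,
      ⟨0, perm021, ![0, 0, 0], true, true⟩,
      ⟨0, 1, ![0, 0, 0], true, true⟩]⟩,
  ⟨latP, true, ![0, 0, 2], ![0, 0, 2], ![0, 0, 0],
    ![⟨1, perm120, ![0, 2, 0], false, true⟩,
      ⟨1, perm021, ![0, 2, 0], false, true⟩,
      ⟨0, 1, ![0, 0, 0], false, false⟩]⟩,
  ⟨latOne 2, true, ![0, 0, 0], ![0, 2, 0], ![2, 2, 0],
    ![⟨1, perm120, ![2, 0, 0], true, false⟩,
      ⟨1, perm021, ![0, 0, 2], true, false⟩,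
      ⟨0, perm102, ![0, 2, 0], true, true⟩]⟩,
  ⟨latOne 2, true, ![0, 0, 2], ![0, 2, 2], ![2, 2, 0],
    ![⟨1, perm120, ![0, 2, 0], true, true⟩,
      ⟨1, perm021, ![2, 2, 0], true, true⟩,
      ⟨0, perm102, ![0, 2, 0], true, true⟩]⟩,
  ⟨latI, true, ![0, 0, 0], ![0, 2, 0], ![2, 2, 2],
    ![⟨1, perm120, ![2, 2, 0], false, false⟩,
      ⟨1, perm021, ![0, 0, 2], false, false⟩,
      ⟨0, perm102, ![0, 2, 0], true, true⟩]⟩,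
  ⟨latI, true, ![0, 0, 2], ![2, 0, 0], ![2, 2, 2],
    ![⟨0, perm210, ![0, 2, 0], true, true⟩,
      ⟨0, perm021, ![0, 2, 0], true, true⟩,
      ⟨0, perm102, ![0, 2, 0], true, true⟩]⟩,
  ⟨latOne 2, true, ![0, 0, 0], ![0, 0, 0], ![0, 0, 0],
    ![⟨1, perm210, ![0, 0, 0], false, true⟩,
      ⟨1, perm201, ![0, 0, 0], false, true⟩,
      ⟨0, 1, ![0, 0, 0], false, false⟩]⟩,
  ⟨latOne 2, true, ![0, 0, 2], ![0, 0, 2], ![0, 0, 0],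
    ![⟨1, perm120, ![0, 2, 0], true, true⟩,
      ⟨1, perm021, ![0, 2, 0], true, true⟩,
      ⟨0, 1, ![0, 0, 0], false, false⟩]⟩,
  ⟨latI, true, ![0, 0, 0], ![0, 0, 0], ![0, 0, 0],
    ![⟨0, perm120, ![0, 0, 0], false, false⟩,
      ⟨0, perm021, ![0, 0, 0], false, false⟩,
      ⟨0, 1, ![0, 0, 0], false, false⟩]⟩,
  ⟨latI, true, ![0, 0, 2], ![0, 0, 2], ![0, 0, 0],
    ![⟨1, perm210, ![2, 0, 0], true, true⟩,
      ⟨1, perm201, ![2, 0, 0], true, true⟩,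
      ⟨0, 1, ![0, 0, 0], false, false⟩]⟩,
  ⟨latP, true, ![2, 0, 0], ![0, 2, 0], ![0, 0, 0],
    ![⟨1, perm210, ![0, 2, 2], false, false⟩,
      ⟨1, perm201, ![0, 2, 2], false, false⟩,
      ⟨0, 1, ![2, 2, 0], false, false⟩]⟩,
  ⟨latP, true, ![2, 0, 2], ![0, 2, 2], ![0, 0, 0],
    ![⟨1, perm210, ![2, 2, 0], true, false⟩,
      ⟨1, perm201, ![2, 2, 0], true, false⟩,
      ⟨0, 1, ![2, 2, 0], false, false⟩]⟩,
  ⟨latP, true, ![0, 2, 0], ![2, 0, 0], ![0, 0, 0],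
    ![⟨1, perm210, ![0, 2, 0], false, true⟩,
      ⟨1, perm201, ![0, 2, 0], false, true⟩,
      ⟨0, 1, ![2, 2, 0], false, false⟩]⟩,
  ⟨latP, true, ![0, 2, 2], ![2, 0, 2], ![0, 0, 0],
    ![⟨0, perm120, ![2, 2, 0], false, false⟩,
      ⟨0, perm021, ![2, 2, 0], false, false⟩,
      ⟨0, 1, ![2, 2, 0], false, false⟩]⟩,
  ⟨latF, true, ![0, 1, 1], ![1, 0, 1], ![0, 0, 0],
    ![⟨0, perm120, ![1, 1, 0], true, true⟩,
      ⟨0, perm021, ![1, 1, 0], true, true⟩,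
      ⟨0, 1, ![1, 1, 0], true, true⟩]⟩,
  ⟨latP, true, ![2, 2, 0], ![2, 2, 0], ![0, 0, 0],
    ![⟨1, perm120, ![0, 0, 0], true, false⟩,
      ⟨1, perm021, ![0, 0, 0], true, false⟩,
      ⟨0, 1, ![0, 0, 0], false, false⟩]⟩,
  ⟨latP, true, ![2, 2, 2], ![2, 2, 2], ![0, 0, 0],
    ![⟨1, perm120, ![0, 0, 0], false, false⟩,
      ⟨1, perm021, ![0, 0, 0], false, false⟩,
      ⟨0, 1, ![0, 0, 0], false, false⟩]⟩,
  ⟨latP, true, ![0, 2, 0], ![0, 2, 0], ![0, 0, 0],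
    ![⟨2, perm120, ![0, 0, 0], true, false⟩,
      ⟨1, perm201, ![0, 0, 2], false, false⟩,
      ⟨0, 1, ![0, 2, 0], false, false⟩]⟩,
  ⟨latP, true, ![0, 2, 2], ![0, 2, 2], ![0, 0, 0],
    ![⟨2, perm120, ![0, 0, 0], false, false⟩,
      ⟨1, perm021, ![0, 2, 0], false, true⟩,
      ⟨0, 1, ![0, 2, 0], false, false⟩]⟩,
  ⟨latOne 0, true, ![2, 0, 0], ![2, 0, 0], ![0, 0, 0],
    ![⟨2, perm210, ![0, 0, 2], false, false⟩,
      ⟨1, perm021, ![0, 0, 0], true, true⟩,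
      ⟨0, perm102, ![0, 2, 0], true, false⟩]⟩,
  ⟨latOne 0, true, ![2, 0, 2], ![2, 0, 0], ![0, 0, 0],
    ![⟨2, perm210, ![0, 2, 0], true, true⟩,
      ⟨1, perm021, ![0, 2, 0], true, true⟩,
      ⟨0, perm102, ![2, 2, 2], true, false⟩]⟩,
  ⟨latP, true, ![2, 0, 0], ![2, 2, 0], ![0, 0, 0],
    ![⟨2, perm210, ![0, 2, 2], false, false⟩,
      ⟨1, perm021, ![0, 0, 0], true, false⟩,
      ⟨0, perm102, ![2, 2, 0], true, false⟩]⟩,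
  ⟨latP, true, ![2, 0, 2], ![2, 2, 2], ![0, 0, 0],
    ![⟨2, perm210, ![2, 2, 0], true, false⟩,
      ⟨1, perm021, ![0, 0, 0], false, false⟩,
      ⟨0, perm102, ![2, 2, 0], true, false⟩]⟩,
  ⟨latP, true, ![2, 0, 0], ![2, 2, 2], ![0, 0, 0],
    ![⟨2, perm120, ![0, 0, 2], false, false⟩,
      ⟨1, perm021, ![2, 2, 0], false, false⟩,
      ⟨0, perm102, ![2, 2, 0], true, false⟩]⟩,
  ⟨latP, true, ![2, 0, 2], ![2, 2, 0], ![0, 0, 0],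
    ![⟨0, perm210, ![2, 2, 0], true, false⟩,
      ⟨0, perm021, ![2, 2, 0], true, false⟩,
      ⟨0, perm102, ![2, 2, 0], true, false⟩]⟩,
  ⟨latP, true, ![0, 2, 0], ![2, 2, 0], ![0, 0, 0],
    ![⟨1, perm120, ![0, 0, 0], true, false⟩,
      ⟨2, perm201, ![0, 2, 0], false, true⟩,
      ⟨0, 1, ![2, 2, 0], true, false⟩]⟩,
  ⟨latP, true, ![0, 2, 2], ![2, 2, 2], ![0, 0, 0],
    ![⟨1, perm120, ![0, 0, 0], false, false⟩,
      ⟨2, perm021, ![2, 2, 0], false, false⟩,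
      ⟨0, 1, ![2, 2, 0], true, false⟩]⟩,
  ⟨latP, false, ![0, 0, 0], ![0, 0, 0], ![0, 0, 0],
    ![⟨0, perm120, ![0, 0, 0], false, false⟩,
      ⟨0, perm021, ![0, 0, 0], false, false⟩,
      ⟨0, 1, ![0, 0, 0], false, false⟩]⟩,
  ⟨latF, false, ![0, 0, 0], ![0, 0, 0], ![0, 0, 0],
    ![⟨0, perm120, ![0, 0, 0], true, true⟩,
      ⟨0, perm021, ![0, 0, 0], true, true⟩,
      ⟨0, 1, ![0, 0, 0], true, true⟩]⟩,
  ⟨latP, false, ![0, 0, 0], ![0, 0, 2], ![0, 0, 2],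
    ![⟨1, perm120, ![0, 2, 0], false, false⟩,
      ⟨1, perm021, ![0, 0, 0], false, false⟩,
      ⟨0, 1, ![0, 0, 0], false, false⟩]⟩,
  ⟨latOne 2, false, ![0, 0, 0], ![0, 0, 0], ![0, 0, 0],
    ![⟨1, perm210, ![0, 0, 0], false, true⟩,
      ⟨1, perm201, ![0, 0, 0], false, true⟩,
      ⟨0, 1, ![0, 0, 0], false, false⟩]⟩,
  ⟨latI, false, ![0, 0, 0], ![0, 0, 0], ![0, 0, 0],
    ![⟨0, perm120, ![0, 0, 0], false, false⟩,
      ⟨0, perm021, ![0, 0, 0], false, false⟩,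
      ⟨0, 1, ![0, 0, 0], false, false⟩]⟩,
  ⟨latI, false, ![0, 0, 0], ![0, 0, 2], ![0, 0, 2],
    ![⟨0, perm120, ![2, 2, 0], false, false⟩,
      ⟨0, perm201, ![0, 2, 0], false, false⟩,
      ⟨0, 1, ![0, 0, 0], false, false⟩]⟩,
  ⟨latOne 2, false, ![0, 0, 0], ![0, 0, 2], ![0, 0, 2],
    ![⟨1, perm120, ![0, 2, 0], true, false⟩,
      ⟨1, perm021, ![0, 0, 0], true, false⟩,
      ⟨0, 1, ![0, 0, 0], false, false⟩]⟩,
  ⟨latP, false, ![2, 0, 0], ![0, 2, 0], ![0, 0, 0],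
    ![⟨1, perm210, ![0, 2, 0], false, false⟩,
      ⟨1, perm201, ![0, 2, 0], false, false⟩,
      ⟨0, 1, ![2, 2, 0], false, false⟩]⟩,
  ⟨latP, false, ![2, 0, 0], ![0, 2, 2], ![0, 0, 2],
    ![⟨0, perm120, ![0, 0, 0], false, false⟩,
      ⟨0, perm021, ![0, 2, 0], false, false⟩,
      ⟨0, 1, ![2, 2, 0], false, false⟩]⟩]

/-- A number describing the occurrences of `s` with `u` in relation to an axis. -/
def feature (B : (Fin 3 → Bool) → (Fin 3 → Bool) → Bool) (i : Fin 3) : ℕ :=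
  10 * (B (fun j => j == i) fun _ => false).toNat +
  9 * (∑ k, if k = i then 0 else (B (fun j => j == i) fun j => j == k).toNat) +
  15 * (B (fun j => j == i) fun j => j != i).toNat +
  3 * (B (fun j => j != i) fun _ => false).toNat +
  15 * (B (fun j => j != i) fun j => j == i).toNat +
  6 * (B (fun _ => false) fun j => j != i).toNat +
  14 * (B (fun _ => false) fun _ => true).toNat +
  7 * (∑ k, if k = i then 0 else (B (fun j => j == k) fun j => j == i).toNat) +
  13 * (B (fun _ => true) fun _ => false).toNat

/-- A symmetric function of the features of the axes is an invariant of the space group. The weights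
in `feature` have no meaning beyond separating what has to be separated. -/
def Dat.key (D : Dat) : ℕ := ∑ i, feature D.half i ^ 2

def keys : List ℕ :=
  [2028, 26508, 2850, 9792, 10604, 15827, 17787, 8707, 9771, 14700, 16856, 3849, 4763, 3009,
  2883, 4107, 4548, 4374, 3326, 3419, 10700, 11491, 4586, 4893, 5313, 5808, 4082, 3918, 27, 1728,
  243, 729, 3072, 3072, 1089, 459, 675]

section Checks

def Dat.validB (D : Dat) : Bool :=
  D.W (fun _ => false) &&
  (allB fun u => allB fun v => !(D.W u && D.W v) || D.W fun i => u i ^^ v i) &&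
  D.mem (fun _ => false) (fun _ => 0) &&
  (allB fun s => allB fun r => !(D.ok s && D.ok r) ||
    D.mem (fun i => s i ^^ r i) (fun i => D.c s i + flip s (D.c r) i))

theorem Dat.valid_of_validB {D : Dat} (h : D.validB = true) : D.Valid := by
  simp only [validB, Bool.and_eq_true, allB_iff, Bool.or_eq_true, Bool.not_eq_true',
    Bool.and_eq_false_iff] at h
  obtain ⟨⟨⟨h1, h2⟩, h3⟩, h4⟩ := h
  refine ⟨h1, fun u v hu hv => ?_, h3, fun s r hs hr => ?_⟩
  · simpa [hu, hv] using h2 u v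
  · simpa [hs, hr] using h4 s r

/-- Sufficient conditions for two data to describe the same group. -/
def Dat.same (D D' : Dat) : Bool :=
  D.inv == D'.inv && (allB fun u => D.W u == D'.W u) &&
  allB fun s => !D.ok s || latMem D.W fun i => D.c s i - D'.c s i

theorem Dat.mem_of_same {D D' : Dat} (h : D.same D' = true)
    (hW : ∀ u v, D.W u = true → D.W v = true → D.W (fun i => u i ^^ v i) = true)
    (s : Fin 3 → Bool) (T : Fin 3 → ℤ) : D.mem s T = D'.mem s T := by
  simp only [same, Bool.and_eq_true, beq_iff_eq, allB_iff, Bool.or_eq_true, Bool.not_eq_true'] at h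
  obtain ⟨⟨h1, h2⟩, h3⟩ := h
  have hok : D'.ok s = D.ok s := by simp [ok, h1]
  have h2' : D'.W = D.W := (funext h2).symm
  rw [Bool.eq_iff_iff, mem_iff, mem_iff, hok, h2']
  refine and_congr_right fun hs => ?_
  have h4 := (h3 s).resolve_left (by simp [hs])
  have h5 := (latMem_flip fun _ => true).trans h4
  constructor <;> intro hT
  · convert latMem_add hW hT h4 using 2
    ext i
    ring
  · convert latMem_add hW hT h5 using 2
    ext i
    simp only [flip, if_true]
    ring

def PointGroupType.hasInv : PointGroupType → Bool
  | .p222 => false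
  | .star222 => true

namespace Entry

def name (E : Entry) (L : Line) (i : Fin 3) : Name := L.names.getD (E.axes i).name L.primary

def checkAxes (E : Entry) (L : Line) : Bool :=
  [0, 1, 2].all fun i => (E.axes i).π 2 == i && decide ((E.axes i).name < L.names.length) &&
    checkModel (E.dat.tr (E.axes i).π (E.axes i).V) (E.axes i).z (E.name L i)

/-- The last condition controls symmetric axes: two axes share a name only if the line has at most
two names and the third axis has the primary one. -/
def checkNames (E : Entry) (L : Line) : Bool :=
  ((List.range L.names.length).all fun n => [0, 1, 2].any fun i => (E.axes i).name == n) &&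
  L.names.all Name.isUnique && (E.axes 2).name == 0 &&
  ([0, 1, 2].all fun i => (decide (L.names.length < 3) && (E.axes i).name == 0) ||
    (E.axes (i + 1)).name != (E.axes (i + 2)).name)

def checkFeatures (E : Entry) : Bool :=
  [0, 1, 2].all fun i => [0, 1, 2].all fun j => (E.axes i).name == (E.axes j).name ||
    feature E.dat.half i != feature E.dat.half j

def checkGroup (E : Entry) (L : Line) : Bool :=
  E.dat.validB && !E.W (fun j => j == 0) && !E.W (fun j => j == 1) && !E.W (fun j => j == 2) &&
  E.inv == L.pointGroup.hasInv

def checkSwap (E : Entry) : Bool := (E.dat.tr perm102 E.swap).same E.dat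

end Entry

end Checks

/-! ### The groups of the table, by their index -/

def ent (k : Fin 37) : Entry := entries.get (k.cast rfl)
def line (k : Fin 37) : Line := table.get (k.cast rfl)

theorem checkGroup_all : ∀ k, (ent k).checkGroup (line k) = true := by decide +kernel
theorem checkAxes_all : ∀ k, (ent k).checkAxes (line k) = true := by decide +kernel
theorem checkNames_all : ∀ k, (ent k).checkNames (line k) = true := by decide +kernel
theorem checkFeatures_all : ∀ k, (ent k).checkFeatures = true := by decide +kernel
-- Exempt are Pbca, with index 25, and the lines with three names, whose axes are pairwise
-- inequivalent.
theorem checkSwap_all :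
    ∀ k, (k == 25 || decide (2 < (line k).names.length) || (ent k).checkSwap) = true := by
  decide +kernel

theorem checkKeys : ∀ k, (ent k).dat.key = keys.getD k 0 := by decide +kernel

/-- Indices 32 and 33 are I222 and I2₁2₁2₁, whose keys coincide. -/
theorem key_injective : ∀ k k' : Fin 37, keys.getD k 0 = keys.getD k' 0 →
    k = k' ∨ (k = 32 ∧ k' = 33) ∨ (k = 33 ∧ k' = 32) := by decide +kernel

attribute [irreducible] ent line

end Fibrifold

/-! ### Names, aliases and symmetric axes of the groups of the table -/

namespace Fibrifold

variable {G G' : Subgroup (E3 ≃ᵃ[ℝ] E3)} {D D' : Dat}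

/-- Both fibered groups are carried to models of the same name, and such models are equivalent by a
map fixing the vertical direction. -/
theorem HasName.sameFibered {ℓ ℓ' : Submodule ℝ E3} {N : Name} (h : HasName G ℓ N)
    (h' : HasName G' ℓ' N) (hN : N.isUnique = true) : SameFibered G ℓ G' ℓ' := by
  obtain ⟨-, φ, h1, h2⟩ := h
  obtain ⟨-, ψ, h3, h4⟩ := h'
  obtain ⟨χ, h5, h6⟩ := h2.unique h4 hN
  refine ⟨ψ⁻¹ * χ * φ, ?_, ?_⟩
  · rw [conj_mul, conj_mul, h5, conj_inv_eq rfl]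
  · rw [mapDir_mul, mapDir_mul, h1, ← axis_two, h6, axis_two]
    exact mapDir_inv_eq h3

theorem Dat.half_perm (h : Repr G 1 D) (h' : Repr G' 1 D') (n : IsNormalized G)
    (n' : IsNormalized G') {π : Equiv.Perm (Fin 3)} {ε : Fin 3 → Bool} {v : Fin 3 → ℝ}
    (e : conj (mon π (fun i => sgn (ε i)) v) G = G') (s u : Fin 3 → Bool) :
    D'.half (fun i => s (π i)) (fun i => u (π i)) = D.half s u := by
  rw [Bool.eq_iff_iff, ← h.hasHalf_iff, ← h'.hasHalf_iff, hasHalf_conj_mon n n' e]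

/-- The features are built from `i`, its complement, and sums over the other axes, so relabelling
the axes merely permutes them. -/
theorem feature_perm {B B' : (Fin 3 → Bool) → (Fin 3 → Bool) → Bool} {π : Equiv.Perm (Fin 3)}
    (h : ∀ s u, B' (fun i => s (π i)) (fun i => u (π i)) = B s u) (i : Fin 3) :
    feature B' i = feature B (π i) := by
  have e1 : ∀ i : Fin 3, (fun j => π j == π i) = fun j => j == i := fun i => by
    ext j
    rw [Bool.eq_iff_iff, beq_iff_eq, beq_iff_eq, π.injective.eq_iff]
  have e2 : ∀ i : Fin 3, (fun j => π j != π i) = fun j => j != i := fun i =>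
    funext fun j => congrArg not (congrFun (e1 i) j)
  have s1 := Equiv.sum_comp π fun k =>
    if k = π i then 0 else (B (fun j => j == π i) fun j => j == k).toNat
  have s2 := Equiv.sum_comp π fun k =>
    if k = π i then 0 else (B (fun j => j == k) fun j => j == π i).toNat
  simp only [feature]
  rw [← s1, ← s2]
  simp only [← h, e1, e2, π.injective.eq_iff]

theorem exists_perm_feature (h : Repr G 1 D) (h' : Repr G' 1 D') (n : IsNormalized G)
    (n' : IsNormalized G') {φ : E3 ≃ᵃ[ℝ] E3} (e : conj φ G = G') :
    ∃ π : Equiv.Perm (Fin 3), (∀ i, mapDir φ (axis (π i)) = axis i) ∧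
      ∀ s u, D'.half (fun i => s (π i)) (fun i => u (π i)) = D.half s u := by
  obtain ⟨π, ε, v, rfl⟩ := n.exists_mon n' e
  exact ⟨π, mapDir_mon_axis, Dat.half_perm h h' n n' e⟩

theorem Dat.key_eq (h : Repr G 1 D) (h' : Repr G' 1 D') (n : IsNormalized G)
    (n' : IsNormalized G') (e : SameSpaceGroup G G') : D.key = D'.key := by
  obtain ⟨φ, e⟩ := e
  obtain ⟨π, -, hπ⟩ := exists_perm_feature h h' n n' e
  simp only [key, feature_perm hπ]
  exact (Equiv.sum_comp π fun i => feature D.half i ^ 2).symm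

theorem SameSpaceGroup.symm (h : SameSpaceGroup G G') : SameSpaceGroup G' G := by
  obtain ⟨φ, e⟩ := h
  exact ⟨φ⁻¹, conj_inv_eq e⟩

theorem SameSpaceGroup.trans {G'' : Subgroup (E3 ≃ᵃ[ℝ] E3)} (h : SameSpaceGroup G G')
    (h' : SameSpaceGroup G' G'') : SameSpaceGroup G G'' := by
  obtain ⟨φ, rfl⟩ := h
  obtain ⟨ψ, rfl⟩ := h'
  exact ⟨ψ * φ, conj_mul _ _⟩

theorem SameFibered.sameSpaceGroup {ℓ ℓ' : Submodule ℝ E3} (h : SameFibered G ℓ G' ℓ') :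
    SameSpaceGroup G G' := h.imp fun _ => And.left

section Table

variable (k : Fin 37)

theorem dat_valid : (ent k).dat.Valid := by
  have := checkGroup_all k
  simp only [Entry.checkGroup, Bool.and_eq_true] at this
  exact Dat.valid_of_validB this.1.1.1.1

noncomputable def grp : Subgroup (E3 ≃ᵃ[ℝ] E3) := (ent k).dat.group (dat_valid k)

theorem repr_grp : Repr (grp k) 1 (ent k).dat := Dat.repr_group _

theorem isSpaceGroup_grp : IsSpaceGroup (grp k) := (dat_valid k).isSpaceGroup

theorem isNormalized_grp : IsNormalized (grp k) := by
  refine (repr_grp k).isNormalized (dat_valid k) fun i => ?_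
  have := checkGroup_all k
  simp only [Entry.checkGroup, Bool.and_eq_true, Bool.not_eq_true'] at this
  fin_cases i
  exacts [this.1.1.1.2, this.1.1.2, this.1.2]

theorem hasPointGroup_grp : HasPointGroup (grp k) (line k).pointGroup := by
  have h := (repr_grp k).hasPointGroup (dat_valid k).zero
  have := checkGroup_all k
  simp only [Entry.checkGroup, Bool.and_eq_true, beq_iff_eq] at this
  rw [show (ent k).dat.inv = (ent k).inv from rfl, this.2] at h
  cases hp : (line k).pointGroup <;> rw [hp] at h <;> exact h

/-- The name of the `i`-th axis. -/
def axisName (i : Fin 3) : Name := (ent k).name (line k) i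

theorem forall_axis {p : Fin 3 → Bool} (h : [0, 1, 2].all p = true) (i : Fin 3) : p i = true := by
  simp only [List.all_cons, List.all_nil, Bool.and_eq_true] at h
  fin_cases i
  exacts [h.1, h.2.1, h.2.2.1]

theorem hasName_axisName (i : Fin 3) : HasName (grp k) (axis i) (axisName k i) := by
  have := forall_axis (checkAxes_all k) i
  simp only [Bool.and_eq_true, beq_iff_eq] at this
  have h := isModel_of_check ((repr_grp k).conj _ _ _) this.2
  refine ⟨isFibration_axis (isNormalized_grp k).exists_aff i, _, ?_, h⟩
  rw [← axis_two]
  convert mapDir_mon_axis 2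
  exact this.1.1.symm

theorem axisName_mem (i : Fin 3) : axisName k i ∈ (line k).names := by
  have := forall_axis (checkAxes_all k) i
  simp only [Bool.and_eq_true, decide_eq_true_eq] at this
  rw [axisName, Entry.name, List.getD_eq_getElem _ _ this.1.2]
  exact List.getElem_mem _

theorem exists_axisName {N : Name} (h : N ∈ (line k).names) : ∃ i, N = axisName k i := by
  have := checkNames_all k
  simp only [Entry.checkNames, Bool.and_eq_true] at this
  obtain ⟨n, hn, rfl⟩ := List.getElem_of_mem h
  obtain ⟨i, -, hi⟩ := List.any_eq_true.1
    (List.all_eq_true.1 this.1.1.1 n (List.mem_range.2 hn))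
  refine ⟨i, ?_⟩
  rw [axisName, Entry.name, beq_iff_eq.1 hi, List.getD_eq_getElem _ _ hn]

theorem isUnique_of_mem {N : Name} (h : N ∈ (line k).names) : N.isUnique = true := by
  have := checkNames_all k
  simp only [Entry.checkNames, Bool.and_eq_true] at this
  exact List.all_eq_true.1 this.1.1.2 N h

theorem axisName_two : axisName k 2 = (line k).primary := by
  have := checkNames_all k
  simp only [Entry.checkNames, Bool.and_eq_true, beq_iff_eq] at this
  simp [axisName, Entry.name, this.1.2, Line.names]

variable {k} {k' : Fin 37}

/-- A symmetry preserves features, and axes with different names have different features. -/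
theorem index_eq_of_mapDir {φ : E3 ≃ᵃ[ℝ] E3} (e : conj φ (grp k) = grp k) {i j : Fin 3}
    (h : mapDir φ (axis i) = axis j) : ((ent k).axes i).name = ((ent k).axes j).name := by
  obtain ⟨π, h1, h2⟩ := exists_perm_feature (repr_grp k) (repr_grp k) (isNormalized_grp k)
    (isNormalized_grp k) e
  have hi : π j = i := axis_injective (mapDir_injective φ ((h1 j).trans h.symm))
  have h3 := feature_perm h2 j
  rw [hi] at h3
  have := forall_axis (forall_axis (checkFeatures_all k) i) j
  simp only [Bool.or_eq_true, beq_iff_eq, bne_iff_ne] at this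
  exact this.resolve_right fun h => h h3.symm

/-- In I222 half turns about all three coordinate axes pass through the origin. -/
theorem hasRotationCenter_grp : HasRotationCenter (grp 32) := by
  refine ⟨0, fun s hs => ⟨fun _ => 0, ?_, by ext; simp⟩⟩
  have := ((repr_grp 32).mem_aff (s := s) (T := fun _ => 0)).2 ?_
  · simpa using this
  · revert s
    decide +kernel

/-- A fixed point of half turns in all three directions has coordinates in eighths, and the
translation parts of the half turns are then eight times the coordinates, off the axis of rotation.
Modulo 4 this leaves 64 candidates, each missing some half turn. -/
theorem not_hasRotationCenter_grp : ¬ HasRotationCenter (grp 33) := by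
  rintro ⟨x, hx⟩
  have hodd : ∀ i : Fin 3, odd (fun j => j != i) = false := by decide
  have h1 : ∀ i : Fin 3, ∃ T : Fin 3 → ℤ, (ent 33).dat.mem (fun j => j != i) T = true ∧
      ∀ j, j ≠ i → 8 * x j = T j := fun i => by
    obtain ⟨t, ht, hf⟩ := hx _ (hodd i)
    obtain ⟨s', T, hm, e⟩ := (repr_grp 33 _).1 ht
    obtain ⟨rfl, rfl⟩ := aff_inj.1 e
    refine ⟨T, hm, fun j hj => ?_⟩
    have := congrArg (fun y : E3 => y j) hf
    simp [bne_iff_ne.2 hj] at this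
    linarith
  have h2 : ∀ j, ∃ n : ℤ, 8 * x j = n := fun j => by
    obtain ⟨T, -, hT⟩ := h1 (j + 1)
    exact ⟨T j, hT j (by simp)⟩
  choose V hV using h2
  have h3 : ∀ a b c : Fin 4, ∃ i : Fin 3, ∀ w : Fin 4, (ent 33).dat.mem (fun j => j != i)
      (fun j => if j = i then (w : ℤ) else (![a, b, c] j : ℤ)) = false := by
    decide +kernel
  have h4 : ∀ n : ℤ, ∃ m : Fin 4, (m : ℤ) % 4 = n % 4 := fun n => by
    exact ⟨⟨(n % 4).toNat, by omega⟩, by simp only; omega⟩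
  choose f hf using h4
  -- The index `i` is a direction in which no half turn fixes the point; the component `w` along its
  -- axis is arbitrary, as a fixing half turn has it 0 anyway.
  obtain ⟨i, hi⟩ := h3 (f (V 0)) (f (V 1)) (f (V 2))
  obtain ⟨T, hm, hT⟩ := h1 i
  refine Bool.false_ne_true ((hi (f (T i))).symm.trans (Eq.trans (Dat.mem_congr fun j => ?_) hm))
  have hj : j ≠ i → T j = V j := fun hj =>
    Int.cast_injective (α := ℝ) ((hT j hj).symm.trans (hV j))
  by_cases h : j = i
  · subst h; simp [hf]
  · rw [if_neg h, hj h, ← hf (V j)]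
    fin_cases j <;> rfl

theorem index_unique (h : SameSpaceGroup (grp k) (grp k')) : k = k' := by
  have h1 := Dat.key_eq (repr_grp k) (repr_grp k') (isNormalized_grp k) (isNormalized_grp k') h
  rw [checkKeys, checkKeys] at h1
  have key : ¬ SameSpaceGroup (grp 32) (grp 33) := fun ⟨φ, e⟩ => by
    obtain ⟨π, ε, v, rfl⟩ := (isNormalized_grp 32).exists_mon (isNormalized_grp 33) e
    exact not_hasRotationCenter_grp (hasRotationCenter_grp.conj_mon e)
  rcases key_injective k k' h1 with h2 | ⟨rfl, rfl⟩ | ⟨rfl, rfl⟩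
  · exact h2
  · exact absurd h key
  · exact absurd h.symm key

/-- The name occurs on an axis of the group of its own line, and uniqueness of models identifies the
two fibered groups. The invariants then give equality of the lines and of the names. -/
theorem axisName_eq {N : Name} {i : Fin 3} (hN : N ∈ (line k').names)
    (h : HasName (grp k) (axis i) N) : k = k' ∧ N = axisName k i := by
  obtain ⟨j, rfl⟩ := exists_axisName k' hN
  have h1 := h.sameFibered (hasName_axisName k' j) (isUnique_of_mem k' hN)
  obtain rfl := index_unique h1.sameSpaceGroup
  obtain ⟨φ, e, he⟩ := h1
  refine ⟨rfl, ?_⟩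
  rw [axisName, axisName, Entry.name, Entry.name, index_eq_of_mapDir e he]

theorem sameFibered_of_axisName {i j : Fin 3} (h : axisName k i = axisName k j) :
    SameFibered (grp k) (axis i) (grp k) (axis j) :=
  (hasName_axisName k i).sameFibered (h ▸ hasName_axisName k j)
    (isUnique_of_mem k (axisName_mem k i))

theorem primary_line_Pbca : (line 25).primary = namePbca := by
  unfold line
  rfl

theorem line_Pbca_names : (line 25).names = [namePbca] := by
  unfold line
  rfl

theorem axisName_Pbca (i : Fin 3) : axisName 25 i = namePbca := by
  have := axisName_mem 25 i
  rwa [line_Pbca_names, List.mem_singleton] at this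

theorem eq_Pbca {i : Fin 3} (h : axisName k i = namePbca) : k = 25 :=
  (axisName_eq (k' := 25) (i := i) (N := namePbca) (by simp [line_Pbca_names])
    (h ▸ hasName_axisName k i)).1

/-- For each axis, the pure half glides along the two other axes do not both occur or both fail
among the reflections reversing it. This forbids an interchange of those axes. -/
theorem half_Pbca : ∀ i : Fin 3,
    (ent 25).dat.half (fun j => j == i) (fun j => j == i + 1) ≠
      (ent 25).dat.half (fun j => j == i) (fun j => j == i + 2) := by decide +kernel

theorem perm_swap : ∀ (π : Equiv.Perm (Fin 3)) (i j : Fin 3), π i = i → π j ≠ j →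
    π (i + 2) = i + 1 ∧ ∀ m, (π m == i + 2) = (m == i + 1) := by decide

/-- A symmetry fixing an axis and another direction to a different one interchanges the two
other axes. -/
theorem IsNormalized.exists_of_isSymmetricAxis (n : IsNormalized G) (hr : Repr G 1 D) {i : Fin 3}
    (h : IsSymmetricAxis G (axis i)) : ∃ φ, conj φ G = G ∧ mapDir φ (axis i) = axis i ∧
      mapDir φ (axis (i + 1)) = axis (i + 2) ∧
      D.half (fun j => j == i) (fun j => j == i + 1) =
        D.half (fun j => j == i) (fun j => j == i + 2) := by
  obtain ⟨φ, e, h1, ℓ₁, ℓ₂, f1, f2, n1, n2, n3, e1, -⟩ := h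
  obtain ⟨π, hπ, hD⟩ := exists_perm_feature hr hr n n e
  have hi : π i = i := axis_injective (mapDir_injective φ ((hπ i).trans h1.symm))
  obtain ⟨j, rfl⟩ := n.isFibration_iff.1 f1
  have hj : π j ≠ j := fun hj => n1 (by
    have := hπ j
    rwa [hj, e1, eq_comm] at this)
  have h2 := perm_swap π i j hi hj
  refine ⟨φ, e, h1, by rw [← h2.1, hπ], ?_⟩
  have := hD (fun j => j == i) (fun j => j == i + 2)
  rw [← this]
  congr 1
  · ext m
    nth_rw 2 [← hi]
    rw [Bool.eq_iff_iff, beq_iff_eq, beq_iff_eq, π.injective.eq_iff]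
  · ext m
    rw [h2.2]

theorem isSymmetricAxis_two (h : (ent k).checkSwap = true) :
    IsSymmetricAxis (grp k) (axis 2) := by
  have e : conj (mon perm102 1 fun i => ((1 : Fin 3 → ℝˣ) i : ℝ) * (ent k).swap i / 8) (grp k) =
      grp k := by
    refine ((repr_grp k).conj _ _ _).eq (repr_grp k) (Dat.mem_of_same h fun u v hu hv => ?_)
    exact (dat_valid k).add _ _ hu hv
  exact ⟨_, e, mapDir_mon_axis (π := perm102) 2, axis 0, axis 1,
    isFibration_axis (isNormalized_grp k).exists_aff 0,
    isFibration_axis (isNormalized_grp k).exists_aff 1, axis_injective.ne (by decide),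
    axis_injective.ne (by decide), axis_injective.ne (by decide),
    mapDir_mon_axis (π := perm102) 1, mapDir_mon_axis (π := perm102) 0⟩

theorem SameFibered.isSymmetricAxis {ℓ ℓ' : Submodule ℝ E3} (h : SameFibered G ℓ G' ℓ')
    (hs : IsSymmetricAxis G ℓ) : IsSymmetricAxis G' ℓ' := by
  obtain ⟨φ, rfl, rfl⟩ := h
  exact hs.conj φ

/-- A symmetric axis forces the two others to share a name, which by the checks happens only
opposite a primary axis; Pbca is excluded by its glides. Conversely the interchange at axis 2 is
explicit, and every axis with the primary name is equivalent to it. -/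
theorem isSymmetricAxis_grp_iff {i : Fin 3} : IsSymmetricAxis (grp k) (axis i) ↔
    (line k).secondary.length ≤ 1 ∧ axisName k i = (line k).primary ∧
      axisName k i ≠ namePbca := by
  constructor
  · intro h
    obtain ⟨φ, e, -, he, hD⟩ := (isNormalized_grp k).exists_of_isSymmetricAxis (repr_grp k) h
    have h1 := index_eq_of_mapDir e he
    have := checkNames_all k
    simp only [Entry.checkNames, Bool.and_eq_true] at this
    have := forall_axis this.2 i
    simp only [Bool.or_eq_true, Bool.and_eq_true, decide_eq_true_eq, beq_iff_eq, bne_iff_ne, h1,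
      ne_eq, not_true_eq_false, or_false] at this
    refine ⟨?_, ?_, fun hN => ?_⟩
    · have := this.1
      simp only [Line.names, List.length_cons] at this
      omega
    · simp [axisName, Entry.name, this.2, Line.names]
    · obtain rfl := eq_Pbca hN
      exact half_Pbca i hD
  · rintro ⟨h1, h2, h3⟩
    refine (sameFibered_of_axisName ((axisName_two k).trans h2.symm)).isSymmetricAxis
      (isSymmetricAxis_two ?_)
    have := checkSwap_all k
    simp only [Bool.or_eq_true, beq_iff_eq] at this
    rcases this with (rfl | h4) | h4
    · exact absurd (h2.trans primary_line_Pbca) h3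
    · have := of_decide_eq_true h4
      simp only [Line.names, List.length_cons] at this
      omega
    · exact h4

/-- Uniqueness of models gives one direction, affine invariance of names the other. -/
theorem hasName_iff_sameSpaceGroup {N : Name} (hN : N ∈ (line k).names) :
    (∃ ℓ, HasName G ℓ N) ↔ SameSpaceGroup (grp k) G := by
  obtain ⟨i, rfl⟩ := exists_axisName k hN
  constructor
  · rintro ⟨ℓ, h⟩
    exact ((hasName_axisName k i).sameFibered h (isUnique_of_mem k hN)).sameSpaceGroup
  · rintro ⟨φ, rfl⟩
    exact ⟨_, (hasName_axisName k i).conj φ⟩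

theorem exists_line {L : Line} (h : L ∈ table) : ∃ k, L = line k := by
  obtain ⟨n, hn, rfl⟩ := List.getElem_of_mem h
  refine ⟨⟨n, hn⟩, ?_⟩
  unfold line
  rfl

/-- The names on each line of the table are those of a single space group. -/
theorem exists_group_of_mem_table {L : Line} (hL : L ∈ table) :
    ∃ G : Subgroup (E3 ≃ᵃ[ℝ] E3),
      IsSpaceGroup G ∧ HasPointGroup G L.pointGroup ∧
      (∀ N ∈ L.names, ∀ G' : Subgroup (E3 ≃ᵃ[ℝ] E3), IsSpaceGroup G' →
        ((∃ ℓ, HasName G' ℓ N) ↔ SameSpaceGroup G G')) ∧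
      (∀ ℓ, IsFibration G ℓ → ∃ N ∈ L.names, HasName G ℓ N ∧
        (∀ L' ∈ table, ∀ N' ∈ L'.names, HasName G ℓ N' → N' = N) ∧
        (IsSymmetricAxis G ℓ ↔ L.secondary.length ≤ 1 ∧ N = L.primary ∧ N ≠ namePbca)) := by
  obtain ⟨k, rfl⟩ := exists_line hL
  refine ⟨grp k, isSpaceGroup_grp k, hasPointGroup_grp k,
    fun N hN G' _ => hasName_iff_sameSpaceGroup hN, fun ℓ hℓ => ?_⟩
  obtain ⟨i, rfl⟩ := (isNormalized_grp k).isFibration_iff.1 hℓ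
  refine ⟨axisName k i, axisName_mem k i, hasName_axisName k i, fun L' hL' N' hN' h => ?_,
    isSymmetricAxis_grp_iff⟩
  obtain ⟨k', rfl⟩ := exists_line hL'
  exact (axisName_eq hN' h).2

theorem hasSingleAsymmetricName_Pbca : HasSingleAsymmetricName (grp 25) := by
  have n := isNormalized_grp 25
  constructor
  · intro ℓ ℓ' h h'
    obtain ⟨i, rfl⟩ := n.isFibration_iff.1 h
    obtain ⟨j, rfl⟩ := n.isFibration_iff.1 h'
    exact sameFibered_of_axisName ((axisName_Pbca i).trans (axisName_Pbca j).symm)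
  · intro ℓ h hs
    obtain ⟨i, rfl⟩ := n.isFibration_iff.1 h
    exact (isSymmetricAxis_grp_iff.1 hs).2.2 (axisName_Pbca i)

theorem hasName_namePbca_iff : (∃ ℓ, HasName G ℓ namePbca) ↔ SameSpaceGroup (grp 25) G :=
  hasName_iff_sameSpaceGroup (by simp [line_Pbca_names])

end Table

end Fibrifold

namespace Fibrifold

/-! ### Normalization of space groups -/

variable {G : Subgroup (E3 ≃ᵃ[ℝ] E3)}

theorem isometry_inv {φ : E3 ≃ᵃ[ℝ] E3} (h : Isometry φ) : Isometry (φ⁻¹ : E3 ≃ᵃ[ℝ] E3) :=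
  h.right_inv φ.apply_symm_apply

theorem IsSpaceGroup.conj (h : IsSpaceGroup G) {φ : E3 ≃ᵃ[ℝ] E3} (hφ : Isometry φ) :
    IsSpaceGroup (conj φ G) where
  isometry g hg := by
    have h1 := (hφ.comp (h.isometry _ (mem_conj_iff.1 hg))).comp (isometry_inv hφ)
    convert h1
    ext x : 1
    simp [AffineEquiv.mul_def, AffineEquiv.inv_def]
  discrete C hC x := by
    refine ((h.discrete _ (hC.image (isometry_inv hφ).continuous) (φ⁻¹ x)).image φ).subset ?_
    rintro y ⟨hy, g, hg, rfl⟩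
    refine ⟨φ⁻¹ (g x), ⟨⟨_, hy, rfl⟩, _, mem_conj_iff.1 hg, ?_⟩, φ.apply_symm_apply _⟩
    simp [AffineEquiv.mul_def, AffineEquiv.inv_def]
  cocompact := by
    obtain ⟨C, hC, h1⟩ := h.cocompact
    refine ⟨φ '' C, hC.image hφ.continuous, fun x => ?_⟩
    obtain ⟨g, hg, y, hy, e⟩ := h1 (φ⁻¹ x)
    refine ⟨_, conj_mem_conj.2 hg, φ y, ⟨y, hy, rfl⟩, ?_⟩
    simp only [AffineEquiv.mul_def, AffineEquiv.inv_def, AffineEquiv.trans_apply,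
      AffineEquiv.symm_apply_apply] at e ⊢
    rw [e]
    simp

theorem eq_aff {g : E3 ≃ᵃ[ℝ] E3} {s : Fin 3 → Bool}
    (h : ∀ i, g.linear (EuclideanSpace.single i (1 : ℝ)) =
    (sgn (s i) : ℝ) • EuclideanSpace.single i (1 : ℝ)) : g = aff s (g 0) :=
  eq_mon (τ := 1) h

theorem linear_conj_repr (b : OrthonormalBasis (Fin 3) ℝ E3) (g : E3 ≃ᵃ[ℝ] E3) (i : Fin 3) (x : ℝ) :
    g.linear (b i) = x • b i ↔
      (b.repr.toLinearEquiv.toAffineEquiv * g * b.repr.toLinearEquiv.toAffineEquiv⁻¹).linear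
        (EuclideanSpace.single i (1 : ℝ)) = x • EuclideanSpace.single i (1 : ℝ) := by
  have : (b.repr.toLinearEquiv.toAffineEquiv * g * b.repr.toLinearEquiv.toAffineEquiv⁻¹).linear
      (EuclideanSpace.single i (1 : ℝ)) = b.repr (g.linear (b i)) := by
    rw [← b.repr_symm_single]
    rfl
  rw [this, ← b.repr_self i, ← map_smul b.repr, b.repr.injective.eq_iff]

/-- Coordinates in the orthonormal basis of the point group turn all elements into sign changes with
translations, without changing distances. -/
theorem HasPointGroup.exists_isometry {p : PointGroupType} (h : HasPointGroup G p) :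
    ∃ φ : E3 ≃ᵃ[ℝ] E3, Isometry φ ∧ (∀ g ∈ Fibrifold.conj φ G, ∃ s t, g = aff s t) ∧
      ∀ s, (∃ t, aff s t ∈ Fibrifold.conj φ G) ↔ (p.hasInv || !odd s) = true := by
  obtain ⟨b, hb⟩ : ∃ b : OrthonormalBasis (Fin 3) ℝ E3, ∀ A : E3 ≃ₗ[ℝ] E3,
      A ∈ pointGroup G ↔ ∃ s : Fin 3 → Bool, (p.hasInv || !odd s) = true ∧
        ∀ i, A (b i) = (sgn (s i) : ℝ) • b i := by
    cases p
    · obtain ⟨b, hb⟩ := h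
      refine ⟨b, fun A => (hb A).trans ⟨?_, ?_⟩⟩
      · rintro ⟨s, hs, hA⟩
        obtain ⟨r, rfl⟩ := exists_sg s
        exact ⟨r, by simpa [PointGroupType.hasInv] using (sg_prod r).1 hs,
          fun i => by rw [hA, sg_cast]⟩
      · rintro ⟨r, hr, hA⟩
        exact ⟨fun i => sg (r i), (sg_prod r).2 (by simpa [PointGroupType.hasInv] using hr),
          fun i => by rw [hA, sg_cast]⟩
    · obtain ⟨b, hb⟩ := h
      refine ⟨b, fun A => (hb A).trans ⟨?_, ?_⟩⟩
      · rintro ⟨s, hA⟩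
        obtain ⟨r, rfl⟩ := exists_sg s
        exact ⟨r, by simp [PointGroupType.hasInv], fun i => by rw [hA, sg_cast]⟩
      · rintro ⟨r, hr, hA⟩
        exact ⟨fun i => sg (r i), fun i => by rw [hA, sg_cast]⟩
  refine ⟨b.repr.toLinearEquiv.toAffineEquiv, b.repr.isometry, ?_, fun s => ⟨?_, fun hs => ?_⟩⟩
  · rintro _ ⟨g, hg, rfl⟩
    obtain ⟨s, -, hs⟩ := (hb g.linear).1 ⟨g, hg, rfl⟩
    exact ⟨s, _, eq_aff fun i => (linear_conj_repr b g i _).1 (hs i)⟩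
  · rintro ⟨t, g, hg, e⟩
    obtain ⟨s', h', hs⟩ := (hb g.linear).1 ⟨g, hg, rfl⟩
    have e' := eq_aff fun i => (linear_conj_repr b g i _).1 (hs i)
    obtain ⟨rfl, -⟩ := aff_inj.1 (e.symm.trans e')
    exact h'
  -- The prescribed sign change in the given basis; it belongs to the point group, and any element
  -- with this linear part will do.
  · let A : E3 ≃ₗ[ℝ] E3 := b.repr.toLinearEquiv.trans
      ((aff s fun _ => 0).linear.trans b.repr.toLinearEquiv.symm)
    have hA : ∀ i, A (b i) = (sgn (s i) : ℝ) • b i := fun i => by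
      apply b.repr.injective
      ext j
      by_cases hj : j = i
      · subst hj; simp [A]
      · simp [A, hj]
    obtain ⟨g, hg, e⟩ := (hb A).2 ⟨s, hs, hA⟩
    rw [← e] at hA
    have e' := eq_aff fun i => (linear_conj_repr b g i _).1 (hA i)
    exact ⟨_, g, hg, e'⟩

/-! ### Translations -/

/-- Multiplying a translation by its conjugate under the half turn about axis `i` doubles the `i`-th
component and cancels the others. -/
theorem trans_single (hr : ∀ s, odd s = false → ∃ t, aff s t ∈ G) {t : Fin 3 → ℝ}
    (ht : aff (fun _ => false) t ∈ G) (i : Fin 3) :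
    aff (fun _ => false) (Pi.single i (2 * t i)) ∈ G := by
  have hodd : ∀ i : Fin 3, odd (fun j => j != i) = false := by decide
  obtain ⟨v, hv⟩ := hr _ (hodd i)
  have := G.mul_mem ht (G.mul_mem (G.mul_mem hv ht) (G.inv_mem hv))
  rw [aff_mul, aff_inv, aff_mul, aff_mul] at this
  convert this using 2
  · ext j; simp
  · ext j
    by_cases hj : j = i
    · subst hj
      simp; ring
    · have : (j != i) = true := by simpa using hj
      simp [hj, this]

/-- By cocompactness there are elements reaching far along the axis. Among infinitely many, two have
the same signs, and their quotient is a translation with nonzero component, which `trans_single`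
turns into one along the axis. -/
theorem IsSpaceGroup.exists_trans (hG : IsSpaceGroup G)
    (h : ∀ g ∈ G, ∃ s t, g = aff s t) (hr : ∀ s, odd s = false → ∃ t, aff s t ∈ G) (i : Fin 3) :
    ∃ x : ℝ, x ≠ 0 ∧ aff (fun _ => false) (Pi.single i x) ∈ G := by
  obtain ⟨C, hC, hx⟩ := hG.cocompact
  obtain ⟨R, hR⟩ := hC.isBounded.exists_norm_le
  -- Targets are spaced by `2 R + 1` and reached up to an error `R`, so different `n` give
  -- components at least 1 apart.
  have key : ∀ n : ℕ, ∃ s t, aff s t ∈ G ∧ |t i - n * (2 * R + 1)| ≤ R := fun n => by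
    obtain ⟨g, hg, y, hy, e⟩ := hx (EuclideanSpace.single i (n * (2 * R + 1) : ℝ))
    obtain ⟨s, t, rfl⟩ := h g hg
    refine ⟨s, t, hg, ?_⟩
    have h1 := congrArg (fun v : E3 => v i) e
    simp only [aff_apply, PiLp.single_apply, if_true] at h1
    have h2 : t i - n * (2 * R + 1) = -(sgn (s i) * y i) := by rw [← h1]; ring
    have h3 := (PiLp.norm_apply_le y i).trans (hR y hy)
    rw [h2, abs_neg]
    cases s i <;> simpa using h3
  choose s t hst ht using key
  obtain ⟨n, m, hnm, e⟩ := Finite.exists_ne_map_eq_of_infinite s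
  have h1 := G.mul_mem (hst n) (G.inv_mem (hst m))
  rw [aff_inv, aff_mul, e] at h1
  have h2 : aff (fun _ => false) (fun i => t n i - t m i) ∈ G := by
    convert h1 using 2
    · simp
    · ext j
      cases s m j <;> simp <;> ring
  refine ⟨_, ?_, trans_single hr h2 i⟩
  intro h0
  have h3 := abs_le.1 (ht n)
  have h4 := abs_le.1 (ht m)
  have h5 : 0 ≤ R := (abs_nonneg _).trans (ht n)
  rcases lt_or_gt_of_ne hnm with hl | hl
  · have : (n : ℝ) + 1 ≤ m := by exact_mod_cast hl
    nlinarith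
  · have : (m : ℝ) + 1 ≤ n := by exact_mod_cast hl
    nlinarith

/-- The translations along an axis. -/
noncomputable def axisTrans (G : Subgroup (E3 ≃ᵃ[ℝ] E3)) (i : Fin 3) : AddSubgroup ℝ where
  carrier := {x | aff (fun _ => false) (Pi.single i x) ∈ G}
  zero_mem' := by
    have : (Pi.single i 0 : Fin 3 → ℝ) = fun _ => 0 := by simp; rfl
    simp [this, G.one_mem]
  add_mem' {x y} hx hy := by
    have := G.mul_mem hx hy
    rw [aff_mul] at this
    simpa [Pi.single_add, Pi.add_def, add_comm] using this
  neg_mem' {x} hx := by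
    have := G.inv_mem hx
    rw [aff_inv] at this
    simpa [Pi.single_neg, Pi.neg_def] using this

/-- The translations along an axis form a subgroup of ℝ. A dense one would move the origin to
infinitely many points of the unit ball, so it is cyclic, and it is nontrivial. -/
theorem IsSpaceGroup.exists_prim (hG : IsSpaceGroup G)
    (h : ∀ g ∈ G, ∃ s t, g = aff s t) (hr : ∀ s, odd s = false → ∃ t, aff s t ∈ G) (i : Fin 3) :
    ∃ d : ℝˣ, ∀ x : ℝ, aff (fun _ => false) (Pi.single i x) ∈ G ↔ ∃ n : ℤ, x = n * d := by
  obtain ⟨x, hx, hxG⟩ := hG.exists_trans h hr i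
  rcases (axisTrans G i).dense_or_cyclic with hd | ⟨a, ha⟩
  · exfalso
    have h1 := hG.discrete (Metric.closedBall 0 1) (isCompact_closedBall _ _) 0
    have h2 : (Set.Ioo (0 : ℝ) 1 ∩ (axisTrans G i : Set ℝ)).Finite := by
      refine Set.Finite.of_finite_image (f := fun x => EuclideanSpace.single i (x : ℝ))
        (h1.subset ?_) fun x _ y _ e => by simpa using congrArg (fun v : E3 => v i) e
      rintro _ ⟨y, ⟨hy, hyG⟩, rfl⟩
      refine ⟨?_, _, hyG, ?_⟩
      · rw [mem_closedBall_zero_iff, PiLp.norm_single, Real.norm_eq_abs,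
          abs_of_pos hy.1]
        exact hy.2.le
      · ext j; simp [Pi.single_apply]
    obtain ⟨y, hy, hyA, hn⟩ := (hd.sdiff_finite h2).inter_open_nonempty _ isOpen_Ioo
      (Set.nonempty_Ioo.2 one_pos)
    exact hn ⟨hy, hyA⟩
  · have ha' : ∀ x : ℝ, aff (fun _ => false) (Pi.single i x) ∈ G ↔ ∃ n : ℤ, x = n * a := fun x => by
      have : x ∈ axisTrans G i ↔ x ∈ AddSubgroup.closure {a} := by rw [ha]
      rw [AddSubgroup.mem_closure_singleton] at this
      exact this.trans (by simp [eq_comm])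
    refine ⟨Units.mk0 a ?_, ha'⟩
    rintro rfl
    obtain ⟨n, hn⟩ := (ha' x).1 hxG
    simp [hx] at hn

theorem IsSpaceGroup.exists_isNormalized (hG : IsSpaceGroup G)
    (h : ∀ g ∈ G, ∃ s t, g = aff s t) (hr : ∀ s, odd s = false → ∃ t, aff s t ∈ G) :
    ∃ d : Fin 3 → ℝˣ, IsNormalized (Fibrifold.conj (mon 1 d 0) G) := by
  choose d hd using fun i => hG.exists_prim h hr i
  have key : ∀ s t, aff s (fun i => ((d i)⁻¹ : ℝˣ) * t i) ∈
      Fibrifold.conj (mon 1 (fun i => (d i)⁻¹) 0) G ↔ aff s t ∈ G := fun s t => by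
    refine mem_conj_of_mul_eq ?_
    rw [mon_mul_aff]
    simp
  refine ⟨fun i => (d i)⁻¹, ?_, fun s hs => ?_, fun i x => ?_⟩
  · rintro _ ⟨g, hg, rfl⟩
    obtain ⟨s, t, rfl⟩ := h g hg
    have e : (mon 1 (fun i => (d i)⁻¹) 0) * aff s t = _ := mon_mul_aff
    exact ⟨_, _, mul_inv_eq_iff_eq_mul.2 e⟩
  · obtain ⟨t, ht⟩ := hr s hs
    exact ⟨_, (key s t).2 ht⟩
  · have h1 := key (fun _ => false) (Pi.single i (x * d i))
    have h2 : (fun j => ((d j)⁻¹ : ℝˣ) * (Pi.single i (x * d i) : Fin 3 → ℝ) j) =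
        Pi.single i x := by
      ext j
      by_cases hj : j = i
      · subst hj; simp; field_simp
      · simp [hj]
    rw [h2] at h1
    rw [h1, hd]
    simp

end Fibrifold

namespace Fibrifold

/-! ### Groups with a cyclic symmetry of the axes -/

/-- Constraints on the translation parts of rotations. -/
def admissible (W : (Fin 3 → Bool) → Bool) (inv : Bool) (a b : Fin 3 → ℤ) : Bool :=
  a 0 % 2 == 0 && b 1 % 2 == 0 && (a 2 - b 2) % 2 == 0 &&
  if inv then latMem W (fun i => 2 * a i) && latMem W (fun i => 2 * b i)
  else a 1 == 0 && a 2 == 0 && b 0 == 0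

/-- Occurrences of rotations are invariant under the cyclic permutation of the axes. -/
def Dat.cyclic (D : Dat) : Bool := allB fun u => allB fun s =>
  D.half (fun i => s (perm201 i)) (fun i => u (perm201 i)) == D.half s u

/-- Some symmetry interchanges the first and third axes. -/
def Dat.hasSwap (D : Dat) : Bool := anyB fun v =>
  (D.tr perm210 fun i => 2 * (v i).toInt).same D

/-- The glides of Pbca distinguish the two cyclic orders of the axes, so there are two settings,
related by interchanging the last two axes. -/
def Dat.isPbca (D : Dat) : Bool :=
  D.same (ent 25).dat || (D.tr perm021 fun _ => 0).same (ent 25).dat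

/-- A finite search over three lattices, two values of `inv` and 4⁶ translation parts. The data need
not be valid: admissibility and cyclic invariance already suffice for the conclusion. -/
theorem cyclic_dat {W : (Fin 3 → Bool) → Bool} (hW : W = latP ∨ W = latI ∨ W = latF) (inv : Bool)
    (a b : Fin 3 → Fin 4) :
    admissible W inv (fun i => a i) (fun i => b i) = true →
    (mkDat W inv (fun i => a i) (fun i => b i)).cyclic = true →
    (mkDat W inv (fun i => a i) (fun i => b i)).hasSwap = true ∨
      (mkDat W inv (fun i => a i) (fun i => b i)).isPbca = true := by
  have ha : a = ![a 0, a 1, a 2] := by ext i; fin_cases i <;> rfl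
  have hb : b = ![b 0, b 1, b 2] := by ext i; fin_cases i <;> rfl
  rw [ha, hb]
  generalize a 0 = a0
  generalize a 1 = a1
  generalize a 2 = a2
  generalize b 0 = b0
  generalize b 1 = b1
  generalize b 2 = b2
  clear ha hb a b
  rcases hW with rfl | rfl | rfl <;> revert inv a0 a1 a2 b0 b1 b2 <;> decide +kernel

end Fibrifold

/-! ### Finite data for an arbitrary normalized group -/

namespace Fibrifold

variable {G : Subgroup (E3 ≃ᵃ[ℝ] E3)}

/-- The centring of the translation lattice of a normalized group. -/
noncomputable def latW (G : Subgroup (E3 ≃ᵃ[ℝ] E3)) (u : Fin 3 → Bool) : Bool :=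
  @decide (HasHalf G (fun _ => false) u) (Classical.dec _)

theorem latW_iff {u : Fin 3 → Bool} :
    latW G u = true ↔ aff (fun _ => false) (fun i => if u i then 1 / 2 else 0) ∈ G := by
  refine (@decide_eq_true_iff _ (Classical.dec _)).trans ?_
  rw [HasHalf]
  constructor
  · rintro ⟨t, ht, h⟩
    rwa [show t = _ from funext fun i => h i rfl] at ht
  · exact fun h => ⟨_, h, fun i _ => rfl⟩

namespace IsNormalized

variable (n : IsNormalized G)

theorem latW_zero : latW G (fun _ => false) = true := by
  rw [latW_iff]
  simp [G.one_mem]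

include n

theorem add_int {s : Fin 3 → Bool} {t : Fin 3 → ℝ} (m : Fin 3 → ℤ) :
    aff s (fun i => t i + m i) ∈ G ↔ aff s t ∈ G := by
  have := G.mul_mem_cancel_left (n.trans_int m) (y := aff s t)
  rw [aff_mul] at this
  simpa using this

/-- Twice each component of a translation is an axis translation, hence integral. So translations
have components in ½ℤ, and modulo ℤ³ only the parities of the doubled components matter. -/
theorem latMem_iff {T : Fin 3 → ℤ} :
    aff (fun _ => false) (fun i => (T i : ℝ) / 4) ∈ G ↔ latMem (latW G) T = true := by
  have key : (∀ i, T i % 2 = 0) →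
      (aff (fun _ => false) (fun i => (T i : ℝ) / 4) ∈ G ↔
        latW G (fun i => T i % 4 == 2) = true) := fun h => by
    rw [latW_iff, ← n.add_int (t := fun i => if T i % 4 == 2 then 1 / 2 else 0) fun i => T i / 4]
    congr! 2
    ext i
    have h1 : T i % 4 = 0 ∨ T i % 4 = 2 := by have := h i; omega
    have h2 : (T i : ℝ) = ((4 * (T i / 4) + T i % 4 : ℤ) : ℝ) := by rw [Int.mul_ediv_add_emod]
    rw [h2]
    rcases h1 with h1 | h1 <;> rw [h1] <;> push_cast <;> simp
    ring
  rw [Fibrifold.latMem_iff]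
  refine ⟨fun h => ?_, fun h => (key h.1).2 h.2⟩
  have h2 : ∀ i, T i % 2 = 0 := fun i => by
    obtain ⟨m, hm⟩ := (n.prim i _).1 (trans_single n.rot h i)
    have : T i = 2 * m := by
      have : (T i : ℝ) = 2 * m := by rw [← hm]; ring
      exact_mod_cast this
    omega
  exact ⟨h2, (key h2).1 h⟩

theorem exists_int {t : Fin 3 → ℝ} (h : aff (fun _ => false) t ∈ G) :
    ∃ T : Fin 3 → ℤ, t = fun i => (T i : ℝ) / 4 := by
  choose m hm using fun i => (n.prim i _).1 (trans_single n.rot h i)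
  refine ⟨fun i => 2 * m i, ?_⟩
  ext i
  push_cast
  rw [← hm]
  ring

theorem latW_add {u v : Fin 3 → Bool} (hu : latW G u = true) (hv : latW G v = true) :
    latW G (fun i => u i ^^ v i) = true := by
  rw [latW_iff] at *
  have := G.mul_mem hu hv
  rw [aff_mul, ← n.add_int fun i => -if u i && v i then 1 else 0] at this
  convert this using 2
  · simp
  · ext i
    cases u i <;> cases v i <;> norm_num

theorem latW_single (i : Fin 3) : latW G (fun j => j == i) = false := by
  rw [← Bool.not_eq_true, latW_iff]
  intro h
  have h2 : (fun j : Fin 3 => if (j == i) = true then (1 : ℝ) / 2 else 0) =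
      Pi.single i (1 / 2) := by
    ext j
    simp [Pi.single_apply]
  rw [h2, n.prim] at h
  obtain ⟨m, hm⟩ := h
  have : (1 : ℝ) = 2 * m := by rw [← hm]; norm_num
  have : (1 : ℤ) = 2 * m := by exact_mod_cast this
  omega

/-- The square of a half turn about axis `i`, possibly with a screw component, is a translation
along this axis. -/
theorem sq_int {i : Fin 3} {t : Fin 3 → ℝ} (h : aff (fun j => j != i) t ∈ G) :
    ∃ m : ℤ, 2 * t i = m := by
  rw [← n.prim i]
  convert G.mul_mem h h using 1
  rw [aff_mul]
  congr 1
  · ext j; simp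
  · ext j
    by_cases hj : j = i
    · subst hj; simp; ring
    · simp [hj, bne_iff_ne.2 hj]

/-- Two half turns generate the rotations modulo translations, and an inversion at the origin
supplies the other elements. Dividing by these representatives leaves only lattice translations. -/
theorem repr {inv : Bool} (hp : ∀ s, (∃ t, aff s t ∈ G) ↔ (inv || !odd s) = true)
    {a b : Fin 3 → ℤ} (ha : aff (fun j => j != 0) (fun i => (a i : ℝ) / 4) ∈ G)
    (hb : aff (fun j => j != 1) (fun i => (b i : ℝ) / 4) ∈ G)
    (hi : inv = true → aff (fun _ => true) (fun _ => 0) ∈ G) :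
    Repr G 1 (mkDat (latW G) inv a b) := by
  have hr : ∀ x y : Bool, aff ![x, y, x ^^ y] (fun i => (rotC a b x y i : ℝ) / 4) ∈ G := by
    have ha' : aff ![false, true, true] (fun i => (a i : ℝ) / 4) ∈ G := by
      convert ha using 2
      ext i; fin_cases i <;> rfl
    have hb' : aff ![true, false, true] (fun i => (b i : ℝ) / 4) ∈ G := by
      convert hb using 2
      ext i; fin_cases i <;> rfl
    rintro (_ | _) (_ | _)
    · convert G.one_mem
      rw [← aff_one]
      congr 1
      · ext i; fin_cases i <;> rfl
      · simp [rotC]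
    · exact ha'
    · exact hb'
    · convert G.mul_mem ha' hb' using 1
      rw [aff_mul]
      congr 1
      · ext i; fin_cases i <;> rfl
      · ext i; fin_cases i <;> (simp [rotC]; ring)
  -- An orientation reversing sign change is the inversion times a rotation, and a rotation is
  -- determined by its first two signs.
  have e1 : ∀ s, odd s = true → s = fun i => true ^^ ![!s 0, !s 1, !s 0 ^^ !s 1] i := by decide
  have e2 : ∀ s, odd s = false → s = ![s 0, s 1, s 0 ^^ s 1] := by decide
  have hc : ∀ s, (inv || !odd s) = true →
      aff s (fun i => ((mkDat (latW G) inv a b).c s i : ℝ) / 4) ∈ G := fun s hs => by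
    by_cases ho : odd s = true
    · have h1 := hr (!s 0) (!s 1)
      have h2 := G.mul_mem (hi (by simpa [ho] using hs)) h1
      rw [aff_mul] at h2
      convert h2 using 2
      · exact e1 s ho
      · simp [mkDat, ho, neg_div]
    · convert hr (s 0) (s 1) using 2
      · exact e2 s (by simpa using ho)
      · simp [mkDat, ho]
  have hmem : ∀ s, (inv || !odd s) = true → ∀ t, aff s t ∈ G ↔ aff (fun _ => false)
      (fun i => t i - ((mkDat (latW G) inv a b).c s i : ℝ) / 4) ∈ G := fun s hs t => by
    have := G.mul_mem_cancel_right (hc s hs) (y := aff (fun _ => false)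
      (fun i => t i - ((mkDat (latW G) inv a b).c s i : ℝ) / 4))
    rw [aff_mul] at this
    simpa using this
  intro g
  constructor
  · intro hg
    obtain ⟨s, t, rfl⟩ := n.exists_aff g hg
    have hs := (hp s).1 ⟨t, hg⟩
    have h1 := (hmem s hs t).1 hg
    obtain ⟨T, hT⟩ := n.exists_int h1
    rw [hT, n.latMem_iff] at h1
    refine ⟨s, fun i => T i + (mkDat (latW G) inv a b).c s i, Dat.mem_iff.2 ⟨hs, ?_⟩, ?_⟩
    · rw [← h1]
      congr 1
      ext i
      exact add_sub_cancel_right (T i) _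
    · congr 1
      ext i
      have := congrFun hT i
      push_cast
      simp only [Pi.one_apply, Units.val_one, one_mul]
      linarith
  · rintro ⟨s, T, hm, rfl⟩
    obtain ⟨h1, h2⟩ := Dat.mem_iff.1 hm
    rw [hmem s h1]
    convert n.latMem_iff.2 h2 using 2
    ext i
    push_cast
    simp only [Pi.one_apply, Units.val_one, one_mul]
    ring

/-- Squares of the three half turns must be axis translations, which makes `a 0`, `b 1` and `a 2 - b
2` even. With an inversion at the origin, twice each translation part is moreover a lattice vector.
-/
theorem admissible {inv : Bool} {a b : Fin 3 → ℤ}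
    (ha : aff (fun j => j != 0) (fun i => (a i : ℝ) / 4) ∈ G)
    (hb : aff (fun j => j != 1) (fun i => (b i : ℝ) / 4) ∈ G)
    (hi : inv = true → aff (fun _ => true) (fun _ => 0) ∈ G)
    (h0 : inv = false → a 1 = 0 ∧ a 2 = 0 ∧ b 0 = 0) :
    admissible (latW G) inv a b = true := by
  have even : ∀ {i : Fin 3} {c : Fin 3 → ℤ},
      aff (fun j => j != i) (fun i => (c i : ℝ) / 4) ∈ G → c i % 2 = 0 := fun {i c} h => by
    obtain ⟨m, hm⟩ := n.sq_int h
    have : c i = 2 * m := by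
      have : (c i : ℝ) = 2 * m := by rw [← hm]; ring
      exact_mod_cast this
    omega
  have hab : aff (fun j => j != 2)
      (fun i => (((if i = 0 then a i + b i else a i - b i) : ℤ) : ℝ) / 4) ∈ G := by
    convert G.mul_mem ha hb using 1
    rw [aff_mul]
    congr 1
    · ext i; revert i; decide
    · ext i; fin_cases i <;> (simp; ring)
  have h3 := even hab
  -- The commutator of an element with the inversion at the origin is the translation by twice its
  -- translation part.
  have hinv : aff (fun _ => true) (fun _ => 0) ∈ G → ∀ {s} {c : Fin 3 → ℤ},
      aff s (fun i => (c i : ℝ) / 4) ∈ G → latMem (latW G) (fun i => 2 * c i) = true :=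
    fun hI s c h => by
      rw [← n.latMem_iff]
      convert G.mul_mem h (G.mul_mem hI (G.mul_mem (G.inv_mem h) hI)) using 1
      rw [aff_inv, aff_mul, aff_mul, aff_mul]
      congr 1
      · ext i; simp
      · ext i
        cases s i <;> (simp; ring)
  simp only [Fibrifold.admissible, Bool.and_eq_true, beq_iff_eq]
  refine ⟨⟨⟨even ha, even hb⟩, by simpa using h3⟩, ?_⟩
  cases inv
  · simpa [and_assoc] using h0 rfl
  · simpa using ⟨hinv (hi rfl) ha, hinv (hi rfl) hb⟩

end IsNormalized

end Fibrifold

/-! ### Groups with a single asymmetric name are Pbca -/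

namespace Fibrifold

variable {G : Subgroup (E3 ≃ᵃ[ℝ] E3)}

theorem mem_conj_shift {s : Fin 3 → Bool} {t v : Fin 3 → ℝ} :
    aff s (fun i => t i + (v i - sgn (s i) * v i)) ∈ conj (aff (fun _ => false) v) G ↔
      aff s t ∈ G := by
  refine mem_conj_of_mul_eq (mon_mul_aff.trans ?_)
  simp [aff]

theorem exists_aff_conj_shift {v : Fin 3 → ℝ} (s : Fin 3 → Bool) :
    (∃ t, aff s t ∈ conj (aff (fun _ => false) v) G) ↔ ∃ t, aff s t ∈ G := by
  constructor
  · rintro ⟨t, ht⟩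
    refine ⟨fun i => t i - (v i - sgn (s i) * v i), (mem_conj_shift (v := v)).1 ?_⟩
    simpa using ht
  · rintro ⟨t, ht⟩
    exact ⟨_, mem_conj_shift.2 ht⟩

namespace IsNormalized

theorem conj_shift (n : IsNormalized G) (v : Fin 3 → ℝ) :
    IsNormalized (conj (aff (fun _ => false) v) G) where
  exists_aff := by
    rintro _ ⟨g, hg, rfl⟩
    obtain ⟨s, t, rfl⟩ := n.exists_aff g hg
    exact ⟨_, _, mul_inv_eq_iff_eq_mul.2 mon_mul_aff⟩
  rot s hs := (exists_aff_conj_shift s).2 (n.rot s hs)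
  prim i x := by
    rw [← n.prim i, ← mem_conj_shift (G := G) (v := v) (t := Pi.single i x)]
    simp

/-- Translation parts in quarters are reduced modulo ℤ³. Vanishing components stay zero, which
preserves the normalization of the origin. -/
theorem exists_fin_four (n : IsNormalized G) {s : Fin 3 → Bool} {t : Fin 3 → ℝ}
    (h : aff s t ∈ G) (hz : ∀ i, ∃ m : ℤ, 4 * t i = m) : ∃ a : Fin 3 → Fin 4,
      aff s (fun i => ((a i : ℤ) : ℝ) / 4) ∈ G ∧ ∀ i, t i = 0 → (a i : ℤ) = 0 := by
  choose m hm using hz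
  refine ⟨fun i => ⟨(m i % 4).toNat, by omega⟩, ?_, fun i hi => ?_⟩
  · rw [← n.add_int fun i => m i / 4]
    convert h using 2
    ext i
    have h1 : (((m i % 4).toNat : ℕ) : ℤ) = m i - 4 * (m i / 4) := by omega
    rw [h1]
    push_cast
    rw [← hm]
    ring
  · have h1 := hm i
    rw [hi, mul_zero] at h1
    have : m i = 0 := by exact_mod_cast h1.symm
    simp [this]

/-- With inversions, the origin is put at a centre of inversion. Otherwise it is put on the axis of
a half turn in direction 0, at the point where the `b 0` component of a half turn in direction 1
vanishes. -/
theorem exists_shift (n : IsNormalized G) {inv : Bool}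
    (hp : ∀ s, (∃ t, aff s t ∈ G) ↔ (inv || !odd s) = true) :
    ∃ (v : Fin 3 → ℝ) (a b : Fin 3 → Fin 4),
      aff (fun j => j != 0) (fun i => ((a i : ℤ) : ℝ) / 4) ∈ conj (aff (fun _ => false) v) G ∧
      aff (fun j => j != 1) (fun i => ((b i : ℤ) : ℝ) / 4) ∈ conj (aff (fun _ => false) v) G ∧
      (inv = true → aff (fun _ => true) (fun _ => 0) ∈ conj (aff (fun _ => false) v) G) ∧
      (inv = false → (a 1 : ℤ) = 0 ∧ (a 2 : ℤ) = 0 ∧ (b 0 : ℤ) = 0) := by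
  cases inv
  · obtain ⟨t, ht⟩ := n.rot (fun j => j != 0) (by decide)
    obtain ⟨u, hu⟩ := n.rot (fun j => j != 1) (by decide)
    refine ⟨![-u 0 / 2, -t 1 / 2, -t 2 / 2], ?_⟩
    have h1 := mem_conj_shift (v := ![-u 0 / 2, -t 1 / 2, -t 2 / 2]).2 ht
    have h2 := mem_conj_shift (v := ![-u 0 / 2, -t 1 / 2, -t 2 / 2]).2 hu
    have n' := n.conj_shift ![-u 0 / 2, -t 1 / 2, -t 2 / 2]
    generalize conj (aff (fun _ => false) ![-u 0 / 2, -t 1 / 2, -t 2 / 2]) G = G' at *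
    have h1' : aff (fun j => j != 0) ![t 0, 0, 0] ∈ G' := by
      convert h1 using 2
      ext i; fin_cases i <;> (simp; try ring)
    have h2' : aff (fun j => j != 1) ![0, u 1, u 2 - t 2] ∈ G' := by
      convert h2 using 2
      ext i; fin_cases i <;> (simp; try ring)
    have h3 : aff (fun j => j != 2) ![t 0, -u 1, t 2 - u 2] ∈ G' := by
      convert G'.mul_mem h1' h2' using 1
      rw [aff_mul]
      congr 1
      · ext i; revert i; decide
      · ext i; fin_cases i <;> simp
    obtain ⟨x, hx⟩ := n'.sq_int h1'
    obtain ⟨y, hy⟩ := n'.sq_int h2'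
    obtain ⟨z, hz⟩ := n'.sq_int h3
    simp at hx hy hz
    obtain ⟨a, ha, ha0⟩ := n'.exists_fin_four h1' fun i => by
      fin_cases i
      · exact ⟨2 * x, by simp [← hx]; ring⟩
      · exact ⟨0, by simp⟩
      · exact ⟨0, by simp⟩
    obtain ⟨b, hb, hb0⟩ := n'.exists_fin_four h2' fun i => by
      fin_cases i
      · exact ⟨0, by simp⟩
      · exact ⟨2 * y, by simp [← hy]; ring⟩
      · exact ⟨-2 * z, by simp [← hz]; ring⟩
    exact ⟨a, b, ha, hb, by simp, fun _ => ⟨ha0 1 rfl, ha0 2 rfl, hb0 0 rfl⟩⟩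
  · obtain ⟨w, hw⟩ := (hp fun _ => true).2 rfl
    refine ⟨fun i => -w i / 2, ?_⟩
    have hi := mem_conj_shift (v := fun i => -w i / 2).2 hw
    have n' := n.conj_shift fun i => -w i / 2
    generalize conj (aff (fun _ => false) fun i => -w i / 2) G = G' at *
    have hi' : aff (fun _ => true) (fun _ => 0) ∈ G' := by
      convert hi using 2
      ext i; simp
    -- Twice the translation part is a lattice vector, and doubling again gives an integral axis
    -- translation, so all parts are in quarters.
    have key : ∀ {s : Fin 3 → Bool} {t : Fin 3 → ℝ}, aff s t ∈ G' → ∀ i, ∃ m : ℤ, 4 * t i = m :=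
      fun {s t} h i => by
        have := G'.mul_mem h (G'.mul_mem hi' (G'.mul_mem (G'.inv_mem h) hi'))
        rw [aff_inv, aff_mul, aff_mul, aff_mul] at this
        have h2 : aff (fun _ => false) (fun i => 2 * t i) ∈ G' := by
          convert this using 2
          · ext j; simp
          · ext j; cases s j <;> (simp; ring)
        obtain ⟨m, hm⟩ := (n'.prim i _).1 (trans_single n'.rot h2 i)
        exact ⟨m, by rw [← hm]; ring⟩
    obtain ⟨t, ht⟩ := n'.rot (fun j => j != 0) (by decide)
    obtain ⟨u, hu⟩ := n'.rot (fun j => j != 1) (by decide)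
    obtain ⟨a, ha, -⟩ := n'.exists_fin_four ht (key ht)
    obtain ⟨b, hb, -⟩ := n'.exists_fin_four hu (key hu)
    exact ⟨a, b, ha, hb, fun _ => hi', by simp⟩

theorem isSymmetricAxis (n : IsNormalized G) {φ : E3 ≃ᵃ[ℝ] E3} (e : conj φ G = G)
    {π : Equiv.Perm (Fin 3)} (hπ : ∀ i, mapDir φ (axis (π i)) = axis i) {i j : Fin 3}
    (hi : π i = i) (hj : π j ≠ j) : IsSymmetricAxis G (axis i) := by
  have key : ∀ (π : Equiv.Perm (Fin 3)) (i j : Fin 3), π i = i → π j ≠ j →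
      π (i + 1) = i + 2 ∧ π (i + 2) = i + 1 ∧ i + 1 ≠ i + 2 ∧ i + 1 ≠ i ∧ i + 2 ≠ i := by decide
  obtain ⟨h1, h2, h3, h4, h5⟩ := key π i j hi hj
  refine ⟨φ, e, ?_, axis (i + 1), axis (i + 2), isFibration_axis n.exists_aff _,
    isFibration_axis n.exists_aff _, axis_injective.ne h3, axis_injective.ne h4,
    axis_injective.ne h5, ?_, ?_⟩
  · have := hπ i
    rwa [hi] at this
  · rw [← h2, hπ]
  · rw [← h1, hπ]

/-- Cyclic symmetry treats the three face centrings alike. A face centring together with the body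
centring would give half an axis vector, so only P, I and F remain. -/
theorem latW_cases (n : IsNormalized G)
    (h : ∀ u, latW G (fun i => u (perm201 i)) = latW G u) :
    latW G = latP ∨ latW G = latI ∨ latW G = latF := by
  have h0 := latW_zero (G := G)
  have s0 := n.latW_single 0
  have s1 := n.latW_single 1
  have s2 := n.latW_single 2
  have h1 := h ![true, true, false]
  have h2 := h ![true, false, true]
  have h3 : latW G ![true, true, false] = true → latW G ![true, true, true] = true → False :=
    fun h1 h2 => by
      have := n.latW_add h1 h2
      rw [show (fun i => (![true, true, false] i ^^ ![true, true, true] i)) =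
        fun j : Fin 3 => j == 2 by decide, s2] at this
      exact absurd this (by decide)
  rw [show (fun i => (![true, true, false] : Fin 3 → Bool) (perm201 i)) =
    ![false, true, true] by decide] at h1
  rw [show (fun i => (![true, false, true] : Fin 3 → Bool) (perm201 i)) =
    ![true, true, false] by decide] at h2
  rw [show (fun _ => false) = ![false, false, false] by decide] at h0
  rw [show (fun j : Fin 3 => j == 0) = ![true, false, false] by decide] at s0
  rw [show (fun j : Fin 3 => j == 1) = ![false, true, false] by decide] at s1
  rw [show (fun j : Fin 3 => j == 2) = ![false, false, true] by decide] at s2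
  simp only [funext_iff, forall_bool_fun, Bool.forall_bool, h0, s0, s1, s2, h1, ← h2]
  cases hp : latW G ![true, true, false] <;> cases hq : latW G ![true, true, true]
  · left; decide
  · right; left; decide
  · right; right; decide
  · exact (h3 hp hq).elim

/-- A normalized group with a single asymmetric name is equivalent to the group of the table. -/
theorem sameSpaceGroup_Pbca (n : IsNormalized G) {inv : Bool}
    (hp : ∀ s, (∃ t, aff s t ∈ G) ↔ (inv || !odd s) = true) (hs : HasSingleAsymmetricName G) :
    SameSpaceGroup (grp 25) G := by
  obtain ⟨v, a, b, ha, hb, hi, h0⟩ := n.exists_shift hp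
  have n' := n.conj_shift v
  have hp' := fun s => (exists_aff_conj_shift (G := G) (v := v) s).trans (hp s)
  have hs' := hs.conj (aff (fun _ => false) v)
  suffices SameSpaceGroup (grp 25) (conj (aff (fun _ => false) v) G) from
    this.trans (SameSpaceGroup.symm ⟨_, rfl⟩)
  generalize conj (aff (fun _ => false) v) G = G' at *
  have hR := n'.repr hp' ha hb hi
  have hA := n'.admissible ha hb hi h0
  have fib := isFibration_axis n'.exists_aff
  have nosym : ∀ {φ : E3 ≃ᵃ[ℝ] E3} {π : Equiv.Perm (Fin 3)} {i j : Fin 3}, conj φ G' = G' →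
      (∀ i, mapDir φ (axis (π i)) = axis i) → π i = i → π j = j := fun {φ π i j} e hπ h1 => by
    by_contra h2
    exact hs'.2 _ (fib i) (n'.isSymmetricAxis e hπ h1 h2)
  -- A symmetry from axis 0 to axis 1 exists because all fibrations are the same. Were axis 2 fixed,
  -- it would be symmetric; hence the axes are permuted cyclically.
  obtain ⟨φ, e, he⟩ := hs'.1 _ _ (fib 0) (fib 1)
  obtain ⟨π, hπ, hD⟩ := exists_perm_feature hR hR n' n' e
  have h10 : π 1 = 0 := axis_injective (mapDir_injective φ ((hπ 1).trans he.symm))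
  have h22 : π 2 ≠ 2 := fun h => absurd ((nosym (j := 1) e hπ h).symm.trans h10) (by decide)
  have h3 : ∀ π : Equiv.Perm (Fin 3), π 1 = 0 → π 2 ≠ 2 → π = perm201 := by decide
  obtain rfl := h3 π h10 h22
  have hcyc : (mkDat (latW G') inv (fun i => a i) (fun i => b i)).cyclic = true := by
    simp only [Dat.cyclic, allB_iff, beq_iff_eq]
    exact fun u s => hD s u
  have hlat : ∀ u, latW G' u =
      (mkDat (latW G') inv (fun i => a i) (fun i => b i)).half (fun _ => false) u := fun u => by
    rw [Bool.eq_iff_iff, ← hR.hasHalf_iff]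
    exact @decide_eq_true_iff _ (Classical.dec _)
  have hW := n'.latW_cases fun u => by
    rw [hlat, hlat u]
    exact hD (fun _ => false) u
  have hadd : ∀ u v, latW G' u = true → latW G' v = true → latW G' (fun i => u i ^^ v i) = true :=
    fun u v => n'.latW_add
  rcases cyclic_dat hW inv a b hA hcyc with h | h
  · exfalso
    -- A symmetry interchanging axes 0 and 2 makes axis 1 symmetric, against the assumption.
    obtain ⟨w, hw⟩ := anyB_iff.1 h
    have e := (hR.conj perm210 1 fun i => 2 * (w i).toInt).eq hR
      (Dat.mem_of_same hw fun u v => hadd _ _)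
    exact absurd (nosym (i := 1) (j := 0) e mapDir_mon_axis rfl) (by decide)
  · simp only [Dat.isPbca, Bool.or_eq_true] at h
    rcases h with h | h
    · rw [hR.eq (repr_grp 25) (Dat.mem_of_same h hadd)]
      exact ⟨1, conj_one⟩
    · exact SameSpaceGroup.symm ⟨_, (hR.conj perm021 1 fun _ => 0).eq (repr_grp 25)
        (Dat.mem_of_same h fun u v => hadd _ _)⟩

end IsNormalized

theorem HasSingleAsymmetricName.sameSpaceGroup (hG : IsSpaceGroup G) {p : PointGroupType}
    (hp : HasPointGroup G p) (h : HasSingleAsymmetricName G) : SameSpaceGroup (grp 25) G := by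
  obtain ⟨φ, hφ, h1, h2⟩ := hp.exists_isometry
  have h3 : ∀ s, odd s = false → ∃ t, aff s t ∈ Fibrifold.conj φ G :=
    fun s hs => (h2 s).2 (by simp [hs])
  obtain ⟨d, n⟩ := (hG.conj hφ).exists_isNormalized h1 h3
  have key : ∀ s, (∃ t, aff s t ∈ Fibrifold.conj (mon 1 d 0) (Fibrifold.conj φ G)) ↔
      ∃ t, aff s t ∈ Fibrifold.conj φ G := fun s => by
    constructor
    · rintro ⟨t, g, hg, e⟩
      obtain ⟨r, u, rfl⟩ := h1 g hg
      have e2 : aff s t = _ := e.symm.trans (mul_inv_eq_iff_eq_mul.2 mon_mul_aff)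
      obtain ⟨rfl, -⟩ := aff_inj.1 e2
      exact ⟨u, hg⟩
    · rintro ⟨t, ht⟩
      exact ⟨_, _, ht, mul_inv_eq_iff_eq_mul.2 mon_mul_aff⟩
  exact (n.sameSpaceGroup_Pbca (fun s => (key s).trans (h2 s))
    ((h.conj φ).conj (mon 1 d 0))).trans (SameSpaceGroup.symm ⟨_, conj_mul _ _⟩)

end Fibrifold

namespace Fibrifold

/-! ### The cyclic extension -/

variable {G : Subgroup (E3 ≃ᵃ[ℝ] E3)} {c φ : E3 ≃ᵃ[ℝ] E3}

/-- `c` normalizes `G`, permutes three axes cyclically, and generates with `G` an irreducible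
space group in which `G` has index `3`. -/
structure IsCyclicExtension (G : Subgroup (E3 ≃ᵃ[ℝ] E3)) (c : E3 ≃ᵃ[ℝ] E3) : Prop where
  permutes : PermutesAxesCyclically G c
  conj_eq : conj c G = G
  isSpaceGroup : IsSpaceGroup (G ⊔ Subgroup.zpowers c)
  irreducible : IsIrreducibleGroup (G ⊔ Subgroup.zpowers c)
  relIndex : G.relIndex (G ⊔ Subgroup.zpowers c) = 3

theorem PermutesAxesCyclically.conj (h : PermutesAxesCyclically G c) :
    PermutesAxesCyclically (conj φ G) (φ * c * φ⁻¹) := by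
  obtain ⟨ℓ₁, ℓ₂, ℓ₃, f1, f2, f3, n1, n2, n3, e1, e2, e3⟩ := h
  refine ⟨_, _, _, f1.conj φ, f2.conj φ, f3.conj φ, (mapDir_injective φ).ne n1,
    (mapDir_injective φ).ne n2, (mapDir_injective φ).ne n3, ?_, ?_, ?_⟩
  · rw [← mapDir_mul, inv_mul_cancel_right, mapDir_mul, e1]
  · rw [← mapDir_mul, inv_mul_cancel_right, mapDir_mul, e2]
  · rw [← mapDir_mul, inv_mul_cancel_right, mapDir_mul, e3]

theorem conj_sup_zpowers : conj φ G ⊔ Subgroup.zpowers (φ * c * φ⁻¹) =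
    conj φ (G ⊔ Subgroup.zpowers c) := by
  rw [Fibrifold.conj, Fibrifold.conj, Subgroup.map_sup, MonoidHom.map_zpowers]
  rfl

/-- Conjugation by an isometry, not merely by an affine map, because the extension has to remain a
group of isometries. -/
theorem IsCyclicExtension.conj (h : IsCyclicExtension G c) (hφ : Isometry φ) :
    IsCyclicExtension (conj φ G) (φ * c * φ⁻¹) where
  permutes := h.permutes.conj
  conj_eq := by rw [← conj_mul, inv_mul_cancel_right, conj_mul, h.conj_eq]
  isSpaceGroup := by
    rw [conj_sup_zpowers]
    exact h.isSpaceGroup.conj hφ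
  irreducible ℓ hℓ := by
    rw [conj_sup_zpowers] at hℓ
    have := hℓ.conj φ⁻¹
    rw [conj_inv_eq rfl] at this
    exact h.irreducible _ this
  relIndex := by
    rw [conj_sup_zpowers]
    exact (Subgroup.relIndex_map_map_of_injective _ _ (MulAut.conj φ).injective).trans h.relIndex

/-- The cyclic permutation of the coordinates. -/
noncomputable def cycle : E3 ≃ᵃ[ℝ] E3 := mon perm120 1 fun _ => 0

theorem mapDir_cycle (i : Fin 3) : mapDir cycle (axis (perm120 i)) = axis i := mapDir_mon_axis i

theorem conj_cycle : conj cycle (grp 25) = grp 25 := by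
  have h : ((ent 25).dat.tr perm120 fun _ => 0).same (ent 25).dat = true := by decide +kernel
  have e := ((repr_grp 25).conj perm120 1 fun _ => 0).eq (repr_grp 25)
    (Dat.mem_of_same h fun u v hu hv => (dat_valid 25).add _ _ hu hv)
  convert e
  rw [cycle]
  congr 1
  ext
  simp

theorem cycle_sq : cycle ^ 2 = mon perm201 1 fun _ => 0 := by
  rw [sq, cycle, mon_mul]
  congr 1
  · decide
  · ext; simp
  · ext; simp

theorem cycle_cube : cycle ^ 3 = 1 := by
  rw [pow_succ, cycle_sq, cycle, mon_mul, ← aff_one, aff]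
  congr 1
  · decide
  · ext; simp
  · ext; simp

theorem mem_zpowers_cycle {h : E3 ≃ᵃ[ℝ] E3} (hh : h ∈ Subgroup.zpowers cycle) :
    h = 1 ∨ h = cycle ∨ h = cycle ^ 2 := by
  obtain ⟨k, rfl⟩ := hh
  have h1 : cycle ^ (k % 3) = cycle ^ k := by
    conv_rhs => rw [← Int.mul_ediv_add_emod k 3, zpow_add, zpow_mul]
    rw [show cycle ^ (3 : ℤ) = cycle ^ 3 from zpow_natCast _ 3, cycle_cube, one_zpow, one_mul]
  have h2 : k % 3 = 0 ∨ k % 3 = 1 ∨ k % 3 = 2 := by omega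
  simp only [← h1]
  rcases h2 with h2 | h2 | h2 <;> rw [h2]
  · left; simp
  · right; left; simp
  · right; right; exact zpow_natCast _ 2

theorem exists_mon_of_mem_zpowers {h : E3 ≃ᵃ[ℝ] E3} (hh : h ∈ Subgroup.zpowers cycle) :
    ∃ π, h = mon π 1 fun _ => 0 := by
  rcases mem_zpowers_cycle hh with rfl | rfl | rfl
  · exact ⟨1, by rw [← aff_one]; rfl⟩
  · exact ⟨_, rfl⟩
  · exact ⟨_, cycle_sq⟩

theorem zpowers_cycle_le : Subgroup.zpowers cycle ≤
    Subgroup.normalizer (grp 25 : Set (E3 ≃ᵃ[ℝ] E3)) := by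
  rw [Subgroup.zpowers_le, Subgroup.mem_normalizer_iff]
  intro g
  conv_rhs => rw [← conj_cycle]
  exact conj_mem_conj.symm

theorem not_isFibration_cycle (i : Fin 3) : mapDir cycle (axis i) ≠ axis i := fun h => by
  have h1 := mapDir_cycle (perm120.symm i)
  rw [Equiv.apply_symm_apply, h] at h1
  have h2 : ∀ i, i ≠ perm120.symm i := by decide
  exact h2 i (axis_injective h1)

/-- Elements of the group fix each axis direction, whereas nontrivial powers of the 3-cycle do not.
-/
theorem inf_zpowers_cycle : grp 25 ⊓ Subgroup.zpowers cycle = ⊥ := by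
  rw [eq_bot_iff]
  rintro g ⟨hg, hz⟩
  have h1 : ∀ i, mapDir g (axis i) = axis i := fun i =>
    (isFibration_axis (isNormalized_grp 25).exists_aff i).2 g hg
  rcases mem_zpowers_cycle hz with rfl | rfl | rfl
  · exact Subgroup.mem_bot.2 rfl
  · exact (not_isFibration_cycle 0 (h1 0)).elim
  · have : cycle = (cycle ^ 2) ^ 2 := by
      rw [← pow_mul, show 2 * 2 = 3 + 1 from rfl, pow_succ, cycle_cube, one_mul]
    refine (not_isFibration_cycle 0 ?_).elim
    rw [this, sq (cycle ^ 2), mapDir_mul, h1, h1]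

theorem orderOf_cycle : orderOf cycle = 3 := by
  have : Fact (Nat.Prime 3) := ⟨Nat.prime_three⟩
  refine orderOf_eq_prime cycle_cube fun h => not_isFibration_cycle 0 ?_
  rw [h, mapDir_one]

theorem isCyclicExtension_Pbca : IsCyclicExtension (grp 25) cycle where
  permutes := ⟨axis 1, axis 0, axis 2, isFibration_axis (isNormalized_grp 25).exists_aff _,
    isFibration_axis (isNormalized_grp 25).exists_aff _,
    isFibration_axis (isNormalized_grp 25).exists_aff _, axis_injective.ne (by decide),
    axis_injective.ne (by decide), axis_injective.ne (by decide), mapDir_cycle 0, mapDir_cycle 2,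
    mapDir_cycle 1⟩
  conj_eq := conj_cycle
  isSpaceGroup := by
    refine isSpaceGroup_of_mon (fun g hg => ?_) fun T =>
      Subgroup.mem_sup_left ((isNormalized_grp 25).trans_int T)
    -- The cycle normalizes the group, so every element is a power of the cycle times an element of
    -- the group, again a signed permutation with translations in quarters.
    rw [sup_comm, ← SetLike.mem_coe,
      Subgroup.coe_mul_of_left_le_normalizer_right _ _ zpowers_cycle_le] at hg
    obtain ⟨h, hh, γ, hγ, rfl⟩ := hg
    obtain ⟨π, rfl⟩ := exists_mon_of_mem_zpowers hh
    obtain ⟨s, T, -, rfl⟩ := (repr_grp 25 γ).1 hγ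
    refine ⟨π, fun i => s (π i), fun i => T (π i), ?_⟩
    simp only [aff, mon_mul]
    congr 1
    · simp
    · ext; simp
  irreducible ℓ hℓ := by
    have h1 : IsFibration (grp 25) ℓ := ⟨hℓ.1, fun g hg => hℓ.2 g (Subgroup.mem_sup_left hg)⟩
    obtain ⟨i, rfl⟩ := (isNormalized_grp 25).isFibration_iff.1 h1
    exact not_isFibration_cycle i
      (hℓ.2 _ (Subgroup.mem_sup_right (Subgroup.mem_zpowers cycle)))
  relIndex := by
    -- By the second isomorphism theorem the index is that of the trivial intersection in the group
    -- of order 3 generated by the cycle.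
    have := Subgroup.normal_subgroupOf_of_le_normalizer zpowers_cycle_le
    have := Subgroup.normal_subgroupOf_sup_of_le_normalizer zpowers_cycle_le
    have h := Nat.card_congr
      (QuotientGroup.quotientInfEquivProdNormalizerQuotient _ _ zpowers_cycle_le).toEquiv
    rw [sup_comm]
    refine h.symm.trans ?_
    change (grp 25).relIndex (Subgroup.zpowers cycle) = 3
    rw [← Subgroup.inf_relIndex_right, inf_zpowers_cycle, Subgroup.relIndex_bot_left,
      Nat.card_zpowers, orderOf_cycle]

/-- Rescaled along its axes, the group has a cyclic extension. -/
theorem exists_isCyclicExtension {p : PointGroupType} (hp : HasPointGroup G p)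
    (h : SameSpaceGroup (grp 25) G) : ∃ φ : E3 ≃ᵃ[ℝ] E3,
      (∀ ℓ, IsFibration G ℓ → mapDir φ ℓ = ℓ) ∧ IsSpaceGroup (conj φ G) ∧
      ∃ c, IsCyclicExtension (conj φ G) c := by
  obtain ⟨ρ, hρ, h1, h2⟩ := hp.exists_isometry
  obtain ⟨ψ, e⟩ : SameSpaceGroup (conj ρ G) (grp 25) := (h.trans ⟨ρ, rfl⟩).symm
  have h3 : ∀ s, odd s = false → ∃ t, aff s t ∈ Fibrifold.conj ρ G :=
    fun s hs => (h2 s).2 (by simp [hs])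
  have h4 : ∀ i, ∃ j, mapDir ψ (axis i) = axis j := fun i =>
    (isNormalized_grp 25).isFibration_iff.1 (e ▸ (isFibration_axis h1 i).conj ψ)
  choose τ hτ using h4
  have hinj : Function.Injective τ := fun i j hij =>
    axis_injective (mapDir_injective ψ (by rw [hτ, hτ, hij]))
  -- The conjugacy `ψ` onto the model may permute the axes. The coordinate permutation `σ` undoes
  -- this by an isometry, so that the total map fixes each invariant direction and is a rescaling
  -- along the axes with a translation.
  let σ : Equiv.Perm (Fin 3) := Equiv.ofBijective τ (Finite.injective_iff_bijective.1 hinj)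
  have hμ : ∀ i, mapDir (mon σ 1 fun _ => 0) (axis (τ i)) = axis i := mapDir_mon_axis (π := σ)
  have hμi : Isometry (mon σ 1 fun _ => 0) := isometry_mon_sgn (s := fun _ => false)
  have hconj : Fibrifold.conj (ρ⁻¹ * (mon σ 1 fun _ => 0) * ψ * ρ) G =
      Fibrifold.conj (ρ⁻¹ * mon σ 1 fun _ => 0) (grp 25) := by
    rw [conj_mul, conj_mul, e]
  have hiso : Isometry (ρ⁻¹ * mon σ 1 fun _ => 0 : E3 ≃ᵃ[ℝ] E3) := (isometry_inv hρ).comp hμi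
  refine ⟨ρ⁻¹ * (mon σ 1 fun _ => 0) * ψ * ρ, fun ℓ hℓ => ?_, ?_, ?_⟩
  · obtain ⟨i, hi⟩ := (isFibration_iff h1 h3).1 (hℓ.conj ρ)
    rw [mapDir_mul, mapDir_mul, mapDir_mul, hi, hτ, hμ, mapDir_inv_eq hi]
  · rw [hconj]
    exact (isSpaceGroup_grp 25).conj hiso
  · rw [hconj]
    exact ⟨_, isCyclicExtension_Pbca.conj hiso⟩

theorem hasSingleAsymmetricName_iff (hG : IsSpaceGroup G) {p : PointGroupType}
    (hp : HasPointGroup G p) :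
    HasSingleAsymmetricName G ↔ SameSpaceGroup (grp 25) G := by
  refine ⟨HasSingleAsymmetricName.sameSpaceGroup hG hp, ?_⟩
  rintro ⟨φ, rfl⟩
  exact hasSingleAsymmetricName_Pbca.conj φ

end Fibrifold

/-! ### The main theorem -/

theorem mainTheorem8 :
    -- the names on each line are the names of the fibrations of a single space group
    (∀ L ∈ table, ∃ G : Subgroup (E3 ≃ᵃ[ℝ] E3),
      IsSpaceGroup G ∧ HasPointGroup G L.pointGroup ∧
      (∀ N ∈ L.names, ∀ G' : Subgroup (E3 ≃ᵃ[ℝ] E3), IsSpaceGroup G' →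
        ((∃ ℓ, HasName G' ℓ N) ↔ SameSpaceGroup G G')) ∧
      (∀ ℓ, IsFibration G ℓ → ∃ N ∈ L.names, HasName G ℓ N ∧
        (∀ L' ∈ table, ∀ N' ∈ L'.names, HasName G ℓ N' → N' = N) ∧
        (IsSymmetricAxis G ℓ ↔ L.secondary.length ≤ 1 ∧ N = L.primary ∧ N ≠ namePbca))) ∧
    -- the only group with a single asymmetric name
    (∀ G : Subgroup (E3 ≃ᵃ[ℝ] E3), IsSpaceGroup G →
      HasPointGroup G .p222 ∨ HasPointGroup G .star222 →
      ((HasSingleAsymmetricName G ↔ ∃ ℓ, HasName G ℓ namePbca) ∧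
      -- after rescaling the axes, adjoining a cyclic permutation of them gives an irreducible
      -- space group in which the group has index 3
      (HasSingleAsymmetricName G → ∃ φ : E3 ≃ᵃ[ℝ] E3,
        (∀ ℓ, IsFibration G ℓ → mapDir φ ℓ = ℓ) ∧ IsSpaceGroup (conj φ G) ∧
        ∃ c : E3 ≃ᵃ[ℝ] E3, PermutesAxesCyclically (conj φ G) c ∧
          conj c (conj φ G) = conj φ G ∧
          IsSpaceGroup (conj φ G ⊔ Subgroup.zpowers c) ∧
          IsIrreducibleGroup (conj φ G ⊔ Subgroup.zpowers c) ∧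
          (conj φ G).relIndex (conj φ G ⊔ Subgroup.zpowers c) = 3))) := by
  refine ⟨fun L hL => exists_group_of_mem_table hL, fun G hG hp => ?_⟩
  obtain ⟨p, hp⟩ : ∃ p, HasPointGroup G p := hp.elim (fun h => ⟨_, h⟩) fun h => ⟨_, h⟩
  refine ⟨(hasSingleAsymmetricName_iff hG hp).trans hasName_namePbca_iff.symm, fun h => ?_⟩
  obtain ⟨φ, h1, h2, c, hc⟩ :=
    exists_isCyclicExtension hp ((hasSingleAsymmetricName_iff hG hp).1 h)
  exact ⟨φ, h1, h2, c, hc.permutes, hc.conj_eq, hc.isSpaceGroup, hc.irreducible, hc.relIndex⟩
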